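/- Let $n\ge 2$ be an even integer, let $\mu\ge 0$ and $\nu^2\ge 0$ be constants, and let $f\in\mathcal C^{\frac n2+1}([0,\infty)\times\mathbb R^n)$, $u_0\in\mathcal C^{\frac n2+2}(\mathbb R^n)$, $u_1\in\mathcal C^{\frac n2+1}(\mathbb R^n)$ be real-valued. Put $\delta=(\mu-1)^2-4\nu^2$, where $\sqrt\delta=i\sqrt{-\delta}$ if $\delta<0$, and let $\mathsf F(\alpha,\beta;\gamma;z)$ be Gauss' hypergeometric function. For real $t,x,b,y$ define $$E(t,x;b,y)=(1+t)^{-\frac\mu2+\frac{1-\sqrt\delta}2}(1+b)^{\frac\mu2+\frac{1-\sqrt\delta}2}\big((t+b+2)^2-(y-x)^2\big)^{\frac{\sqrt\delta-1}2}\,\mathsf F\Big(\tfrac{1-\sqrt\delta}2,\tfrac{1-\sqrt\delta}2;1;\tfrac{(t-b)^2-(y-x)^2}{(t+b+2)^2-(y-x)^2}\Big),$$ $$K_0(t,x;y)=-\frac{\partial}{\partial b}E(t,x;b,y)\Big|_{b=0},\qquad K_1(t,x;y)=E(t,x;0,y).$$ For a function $\varphi$ on $\mathbb R^n$, $t>0$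 and $x\in\mathbb R^n$ define $$w[\varphi](t,x)=\frac1{n!!}\,\frac{\partial}{\partial t}\Big(\frac1t\frac{\partial}{\partial t}\Big)^{\frac{n-2}2}\left(t^n\,\frac1{|B_t(x)|}\int_{B_t(x)}\frac{\varphi(z)}{(t^2-|z-x|^2)^{1/2}}\,\mathrm dz\right),$$ where $B_t(x)$ is the ball of radius $t$ around $x$ in $\mathbb R^n$ and $n!!=n(n-2)\cdots 2$, and put $w[f](t,x;b)=w[f(b,\cdot)](t,x)$ for $b\ge0$. Then the Cauchy problem $$u_{tt}-\Delta u+\frac{\mu}{1+t}u_t+\frac{\nu^2}{(1+t)^2}u=f(t,x)\quad(t>0,\ x\in\mathbb R^n),\qquad u(0,x)=u_0(x),\quad u_t(0,x)=u_1(x)\quad(x\in\mathbb R^n)$$ has a classical solution $u\in\mathcal C^2([0,\infty)\times\mathbb R^n)$, and every such solution is given, for all $t>0$ and $x\in\mathbb R^n$, by $$\begin{aligned}u(t,x)={}&(1+t)^{-\frac\mu2}w[u_0](t,x)+\frac1{2^{\sqrt\delta-1}}\int_0^t w[u_0](s,x)\,K_0(t,0;s)\,\mathrm ds+\frac1{2^{\sqrt\delta-1}}\int_0^t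 w[u_1+\mu u_0](s,x)\,K_1(t,0;s)\,\mathrm ds\\&+\frac1{2^{\sqrt\delta-1}}\int_0^t\int_0^{t-b}w[f](s,x;b)\,E(t,0;b,s)\,\mathrm ds\,\mathrm db,\end{aligned}$$ where all the derivatives and integrals occurring in this formula exist (the integrals as absolutely convergent ones). -/

import Mathlib

open MeasureTheory Set
open scoped Laplacian

namespace ScaleInvariantWave

/-- The discriminant `δ = (μ - 1)² - 4 ν²`. It may be negative. -/
noncomputable def discr (μ ν : ℝ) : ℝ := (μ - 1) ^ 2 - 4 * ν ^ 2

/-- The square root `√δ`, as a complex number: the usual real square root if `0 ≤ δ`,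
and `i √(-δ)` if `δ < 0`. -/
noncomputable def sqrtDiscr (μ ν : ℝ) : ℂ := ((discr μ ν : ℝ) : ℂ) ^ (1 / 2 : ℂ)

/-- The kernel function `E(t,x;b,y;μ,ν²)` (here `x` and `y` are real numbers), where `₂F₁` is
Gauss' hypergeometric function. -/
noncomputable def kernelE (μ ν t x b y : ℝ) : ℂ :=
  ((1 + t : ℝ) : ℂ) ^ (-(μ : ℂ) / 2 + (1 - sqrtDiscr μ ν) / 2) *
    ((1 + b : ℝ) : ℂ) ^ ((μ : ℂ) / 2 + (1 - sqrtDiscr μ ν) / 2) *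
    (((t + b + 2) ^ 2 - (y - x) ^ 2 : ℝ) : ℂ) ^ ((sqrtDiscr μ ν - 1) / 2) *
    ₂F₁ ((1 - sqrtDiscr μ ν) / 2) ((1 - sqrtDiscr μ ν) / 2) (1 : ℂ)
      ((((t - b) ^ 2 - (y - x) ^ 2) / ((t + b + 2) ^ 2 - (y - x) ^ 2) : ℝ) : ℂ)

/-- `K₀(t,x;y;μ,ν²) = -∂_b E(t,x;b,y;μ,ν²)` at `b = 0`. -/
noncomputable def kernelK₀ (μ ν t x y : ℝ) : ℂ :=
  -deriv (fun b : ℝ => kernelE μ ν t x b y) 0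

/-- `K₁(t,x;y;μ,ν²) = E(t,x;0,y;μ,ν²)`. -/
noncomputable def kernelK₁ (μ ν t x y : ℝ) : ℂ := kernelE μ ν t x 0 y

/-- The function `t ↦ tⁿ ⨍_{B_t(x)} φ(z) (t² - |z - x|²)^{-1/2} dz`. -/
noncomputable def weightedBallMean (n : ℕ) (φ : EuclideanSpace ℝ (Fin n) → ℝ)
    (x : EuclideanSpace ℝ (Fin n)) (t : ℝ) : ℝ :=
  t ^ n * ⨍ z in Metric.ball x t, φ z / √(t ^ 2 - ‖z - x‖ ^ 2)

/-- The differential operator `(1/t) ∂/∂t` on functions of one real variable. -/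
noncomputable def radialDeriv (g : ℝ → ℝ) : ℝ → ℝ := fun t => (1 / t) * deriv g t

/-- The operator `w[φ](t,x)` in even space dimension `n`:
`(1/n‼) (∂/∂t) ((1/t) ∂/∂t)^{(n-2)/2} (tⁿ ⨍_{B_t(x)} φ(z) (t² - |z - x|²)^{-1/2} dz)`.
For `φ = f(b, ·)` this is `w[f](t,x;b)`. It is meant for `t > 0`. -/
noncomputable def evenWaveOp (n : ℕ) (φ : EuclideanSpace ℝ (Fin n) → ℝ)
    (t : ℝ) (x : EuclideanSpace ℝ (Fin n)) : ℝ :=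
  1 / (Nat.doubleFactorial n : ℝ) * deriv (radialDeriv^[(n - 2) / 2] (weightedBallMean n φ x)) t

/-- The expression defining `w[φ](t,x)` makes sense: the weighted ball integral converges
absolutely, and every function that has to be differentiated is differentiable at `t`. -/
def EvenWaveOpWellDefined (n : ℕ) (φ : EuclideanSpace ℝ (Fin n) → ℝ)
    (t : ℝ) (x : EuclideanSpace ℝ (Fin n)) : Prop :=
  IntegrableOn (fun z => φ z / √(t ^ 2 - ‖z - x‖ ^ 2)) (Metric.ball x t) ∧
    ∀ j ≤ (n - 2) / 2, DifferentiableAt ℝ (radialDeriv^[j] (weightedBallMean n φ x)) t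

/-- `u` is a classical solution (of class `C²` on `[0,∞) × ℝⁿ`) of the Cauchy problem
`u_tt - Δu + μ/(1+t) u_t + ν²/(1+t)² u = f` for `t > 0`, `u(0,·) = u₀`, `u_t(0,·) = u₁`.
The values of `u` and `f` at negative times play no role. -/
structure IsClassicalSolution (n : ℕ) (μ ν : ℝ) (f : ℝ → EuclideanSpace ℝ (Fin n) → ℝ)
    (u₀ u₁ : EuclideanSpace ℝ (Fin n) → ℝ) (u : ℝ → EuclideanSpace ℝ (Fin n) → ℝ) : Prop where
  contDiffOn : ContDiffOn ℝ 2 (fun p : ℝ × EuclideanSpace ℝ (Fin n) => u p.1 p.2)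
    (Ici (0 : ℝ) ×ˢ univ)
  equation : ∀ t : ℝ, 0 < t → ∀ x : EuclideanSpace ℝ (Fin n),
    iteratedDeriv 2 (fun s => u s x) t - Δ (u t) x + μ / (1 + t) * deriv (fun s => u s x) t
      + ν ^ 2 / (1 + t) ^ 2 * u t x = f t x
  initial_value : ∀ x, u 0 x = u₀ x
  initial_velocity : ∀ x, HasDerivWithinAt (fun t => u t x) (u₁ x) (Ici 0) 0

/-- The right-hand side of the representation formula at a point `(t,x)`, `t > 0`. -/
noncomputable def evenRepresentation (n : ℕ) (μ ν : ℝ)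
    (f : ℝ → EuclideanSpace ℝ (Fin n) → ℝ) (u₀ u₁ : EuclideanSpace ℝ (Fin n) → ℝ)
    (t : ℝ) (x : EuclideanSpace ℝ (Fin n)) : ℂ :=
  (((1 + t) ^ (-μ / 2) * evenWaveOp n u₀ t x : ℝ) : ℂ)
    + 1 / (2 : ℂ) ^ (sqrtDiscr μ ν - 1) *
        (∫ s in (0 : ℝ)..t, (evenWaveOp n u₀ s x : ℂ) * kernelK₀ μ ν t 0 s)
    + 1 / (2 : ℂ) ^ (sqrtDiscr μ ν - 1) *
        (∫ s in (0 : ℝ)..t,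
          (evenWaveOp n (fun z => u₁ z + μ * u₀ z) s x : ℂ) * kernelK₁ μ ν t 0 s)
    + 1 / (2 : ℂ) ^ (sqrtDiscr μ ν - 1) *
        (∫ b in (0 : ℝ)..t, (∫ s in (0 : ℝ)..(t - b),
          (evenWaveOp n (f b) s x : ℂ) * kernelE μ ν t 0 b s))

/-- Every derivative and integral in the representation formula at `(t,x)` makes sense. -/
structure EvenRepresentationWellDefined (n : ℕ) (μ ν : ℝ)
    (f : ℝ → EuclideanSpace ℝ (Fin n) → ℝ) (u₀ u₁ : EuclideanSpace ℝ (Fin n) → ℝ)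
    (t : ℝ) (x : EuclideanSpace ℝ (Fin n)) : Prop where
  waveOp_u₀ : ∀ s, 0 < s → s ≤ t → EvenWaveOpWellDefined n u₀ s x
  waveOp_u₁ : ∀ s, 0 < s → s ≤ t → EvenWaveOpWellDefined n (fun z => u₁ z + μ * u₀ z) s x
  waveOp_f : ∀ b ∈ Icc 0 t, ∀ s, 0 < s → s ≤ t - b → EvenWaveOpWellDefined n (f b) s x
  kernel : ∀ s ∈ Icc 0 t, DifferentiableAt ℝ (fun b : ℝ => kernelE μ ν t 0 b s) 0
  integral_K₀ : IntervalIntegrable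
    (fun s => (evenWaveOp n u₀ s x : ℂ) * kernelK₀ μ ν t 0 s) volume 0 t
  integral_K₁ : IntervalIntegrable
    (fun s => (evenWaveOp n (fun z => u₁ z + μ * u₀ z) s x : ℂ) * kernelK₁ μ ν t 0 s) volume 0 t
  integral_E_inner : ∀ b ∈ Icc 0 t, IntervalIntegrable
    (fun s => (evenWaveOp n (f b) s x : ℂ) * kernelE μ ν t 0 b s) volume 0 (t - b)
  integral_E_outer : IntervalIntegrable
    (fun b => ∫ s in (0 : ℝ)..(t - b), (evenWaveOp n (f b) s x : ℂ) * kernelE μ ν t 0 b s)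
    volume 0 t

end ScaleInvariantWave

/-!
The dimension is `n = 2k`. The proof constructs a solution by hand, identifies it with the real part
of the right-hand side of the formula, and gets the rest from uniqueness.

*Free waves.* The mean `M` of `φ(x + t y)` over the unit ball with weight `(1 - |y|²)^{-1/2}`
satisfies the Euler–Poisson–Darboux equation `t (M_tt - ΔM) + n M_t = 0` (`descentMean_epd`): the
weight is the projection of the surface measure of the sphere in `ℝⁿ⁺¹`, and the equation is the
statement that the spherical Laplacian has integral zero (`integral_descentWeight_mul`). The operator
`P ↦ (a - 1) P + t P_t` lowers the parameter `a` of the equation by two (`SatisfiesEPD.lower`), so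
after `k - 1` steps one arrives at parameter `2`, where `t P` solves the wave equation. This gives
`V` with `V_tt = ΔV`, `V(0) = 0`, `V_t(0) = φ` (`waveSol_wave`, `dirDeriv_waveSol_zero`), and
`w[φ] = V_t` (`evenWaveOp_eq`).

*Transmutation.* Writing `u = (1 + t)^{-μ/2} v` removes the damping term and leaves
`v_tt - Δv + m (1 + t)⁻² v = (1 + t)^{μ/2} f` with `m = μ(2 - μ)/4 + ν² = a(1 - a)`,
`a = (1 - √δ)/2`. With `ζ = (s² - (t - b)²) / (4 (1 + t)(1 + b))` one has
`E(t, 0; b, s) = 2^{√δ - 1} ((1 + b)/(1 + t))^{μ/2} h(ζ)` (`kernelE_eq_profile`), where `h` is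
`₂F₁(a, 1 - a; 1; ·)` in the form given by Pfaff's transformation. Since `m` is real, the real and
the imaginary part of `h` both solve `ζ(1 - ζ) q'' + (1 - 2ζ) q' - m q = 0` (`profile_ode`), and
then `q(ζ)` and its derivatives in `b` and `s` solve `k_tt - k_ss + m (1 + t)⁻² k = 0`. For such
kernels, `c V(t - b, x) + ∫_0^{t-b} V(s, x) k(t, b, s) ds` turns a solution `V` of the wave equation
into a solution of the undamped equation (`transmute_equation`). Duhamel's integral over the starting
time `b` takes care of the source (`undamped_equation`), and an integration by parts in `s` turns the
result into the terms of the formula (`undamped_eq_reducedFormula`).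

*Real and imaginary part.* The construction works for every real solution `q` of the profile
equation that is regular at zero, and yields the solution with source and data multiplied by `q(0)`
(`isClassicalSolution_undamped`). For the real part of `h` this factor is `1`, for the imaginary part
it is `0`. By uniqueness the former is the solution of the Cauchy problem, and the latter vanishes.

*Uniqueness* (`IsClassicalSolution.unique`) is an energy estimate with a weight that is supported in
a backward cone (`localEnergy_deriv`). As `μ ≥ 0`, the damping term has the favourable sign.

*Regularity.* Wave solutions are kept as functions of `(β, t, x)` with a parameter `β`. The source is
only given for `b ≥ 0`, and enters through `F(β, x) = f(β², x)` at `β = √b`, which has the required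
smoothness on the whole space; smoothness of the integrand of Duhamel's integral in `b` is never needed. Likewise
`1 + t` is replaced by a positive smooth function on the line and the profile is cut off away from
`ζ ≤ 1/8`; nothing changes for `0 ≤ b ≤ t`, `0 ≤ s ≤ t - b`, where `ζ ≤ 0`.
-/

set_option linter.unusedSectionVars false

namespace ScaleInvariantWave

open Filter Topology

/-! ### Integrals depending on a parameter -/

section ParametricIntegrals

variable {P Y F : Type} [NormedAddCommGroup P] [NormedSpace ℝ P] [FiniteDimensional ℝ P]
  [NormedAddCommGroup Y] [NormedSpace ℝ Y] [FiniteDimensional ℝ Y] [MeasurableSpace Y]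
  [BorelSpace Y] [NormedAddCommGroup F] [NormedSpace ℝ F]

lemma exists_bound_near {S : Set P} (hS : IsOpen S) {K : Set Y} (hK : IsCompact K)
    {h : P → Y → F} (hc : ContinuousOn (fun z : P × Y => h z.1 z.2) (S ×ˢ univ)) {p₀ : P}
    (hp : p₀ ∈ S) :
    ∃ C : ℝ, ∃ N ∈ 𝓝 p₀, N ⊆ S ∧ ∀ p ∈ N, ∀ y ∈ K, ‖h p y‖ ≤ C := by
  obtain ⟨N, hN, hNS, hNc⟩ := local_compact_nhds (hS.mem_nhds hp)
  have hc' : ContinuousOn (fun z : P × Y => h z.1 z.2) (N ×ˢ K) :=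
    hc.mono (prod_mono hNS (subset_univ _))
  obtain ⟨C, hC⟩ := (hNc.prod hK).exists_bound_of_continuousOn hc'
  exact ⟨C, N, hN, hNS, fun p hp y hy => hC (p, y) ⟨hp, hy⟩⟩

lemma continuous_slice {S : Set P} {h : P → Y → F}
    (hc : ContinuousOn (fun z : P × Y => h z.1 z.2) (S ×ˢ univ)) {p : P} (hp : p ∈ S) :
    Continuous (h p) := by
  rw [← continuousOn_univ]
  exact hc.comp (f := fun y => (p, y)) (by fun_prop) (fun y _ => ⟨hp, mem_univ _⟩)

lemma integrable_weighted {ν : Measure Y} {ρ : Y → ℝ} (hρ : Integrable ρ ν) {K : Set Y}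
    (hK : IsCompact K) (hρK : ∀ᵐ y ∂ν, ρ y ≠ 0 → y ∈ K) {g : Y → F} (hg : Continuous g) :
    Integrable (fun y => ρ y • g y) ν := by
  obtain ⟨C, hC⟩ := hK.exists_bound_of_continuousOn hg.continuousOn
  refine Integrable.mono' (hρ.norm.mul_const C) (hρ.1.smul hg.aestronglyMeasurable) ?_
  filter_upwards [hρK] with y hy
  rw [norm_smul]
  by_cases h0 : ρ y = 0
  · simp [h0]
  · gcongr
    exact hC y (hy h0)

lemma continuousOn_weighted_integral {ν : Measure Y} {ρ : Y → ℝ} (hρ : Integrable ρ ν)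
    {K : Set Y} (hK : IsCompact K) (hρK : ∀ᵐ y ∂ν, ρ y ≠ 0 → y ∈ K) {S : Set P} (hS : IsOpen S)
    {h : P → Y → F} (hc : ContinuousOn (fun z : P × Y => h z.1 z.2) (S ×ˢ univ)) :
    ContinuousOn (fun p => ∫ y, ρ y • h p y ∂ν) S := by
  intro p₀ hp₀
  refine ContinuousAt.continuousWithinAt ?_
  obtain ⟨C, N, hN, hNS, hC⟩ := exists_bound_near hS hK hc hp₀
  refine continuousAt_of_dominated (bound := fun y => ‖ρ y‖ * C) ?_ ?_ (hρ.norm.mul_const C) ?_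
  · filter_upwards [hN] with p hp
    exact hρ.1.smul (continuous_slice hc (hNS hp)).aestronglyMeasurable
  · filter_upwards [hN] with p hp
    filter_upwards [hρK] with y hy
    rw [norm_smul]
    by_cases h0 : ρ y = 0
    · simp [h0]
    · gcongr
      exact hC p hp y (hy h0)
  · filter_upwards with y
    refine ContinuousAt.smul continuousAt_const ?_
    have := (hc (p₀, y) ⟨hp₀, mem_univ _⟩).continuousAt
      ((hS.prod isOpen_univ).mem_nhds ⟨hp₀, mem_univ _⟩)
    exact this.comp (f := fun p => (p, y)) (by fun_prop)

/-- Differentiation under an integral with an integrable, compactly supported weight. -/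
lemma hasFDerivAt_weighted_integral {ν : Measure Y} {ρ : Y → ℝ} (hρ : Integrable ρ ν)
    {K : Set Y} (hK : IsCompact K) (hρK : ∀ᵐ y ∂ν, ρ y ≠ 0 → y ∈ K) {S : Set P} (hS : IsOpen S)
    {h : P → Y → F} {h' : P → Y → P →L[ℝ] F}
    (hc : ContinuousOn (fun z : P × Y => h z.1 z.2) (S ×ˢ univ))
    (hc' : ContinuousOn (fun z : P × Y => h' z.1 z.2) (S ×ˢ univ))
    (hd : ∀ p ∈ S, ∀ y, HasFDerivAt (fun p => h p y) (h' p y) p) {p₀ : P} (hp₀ : p₀ ∈ S) :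
    HasFDerivAt (fun p => ∫ y, ρ y • h p y ∂ν) (∫ y, ρ y • h' p₀ y ∂ν) p₀ := by
  obtain ⟨C, N, hN, hNS, hC⟩ := exists_bound_near hS hK hc' hp₀
  refine hasFDerivAt_integral_of_dominated_of_fderiv_le (bound := fun y => ‖ρ y‖ * C) hN
    ?_ (integrable_weighted hρ hK hρK (continuous_slice hc hp₀))
    (F' := fun p y => ρ y • h' p y)
    (integrable_weighted hρ hK hρK (continuous_slice hc' hp₀)).1 ?_ (hρ.norm.mul_const C) ?_
  · filter_upwards [hN] with p hp
    exact hρ.1.smul (continuous_slice hc (hNS hp)).aestronglyMeasurable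
  · filter_upwards [hρK] with y hy
    intro p hp
    rw [norm_smul]
    by_cases h0 : ρ y = 0
    · simp [h0]
    · gcongr
      exact hC p hp y (hy h0)
  · filter_upwards with y
    intro p hp
    exact (hd p (hNS hp) y).const_smul (ρ y)

lemma hasFDerivAt_slice {h : P × Y → F} (hh : Differentiable ℝ h) (p : P) (y : Y) :
    HasFDerivAt (fun p => h (p, y)) ((fderiv ℝ h (p, y)).comp (ContinuousLinearMap.inl ℝ P Y))
      p := by
  exact (hh (p, y)).hasFDerivAt.comp p (hasFDerivAt_prodMk_left (𝕜 := ℝ) p y)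

lemma hasFDerivAt_weighted_integral_of_contDiff {ν : Measure Y} {ρ : Y → ℝ}
    (hρ : Integrable ρ ν) {K : Set Y} (hK : IsCompact K) (hρK : ∀ᵐ y ∂ν, ρ y ≠ 0 → y ∈ K)
    {h : P × Y → F} (hh : ContDiff ℝ 1 h) (p : P) :
    HasFDerivAt (fun p => ∫ y, ρ y • h (p, y) ∂ν)
      (∫ y, ρ y • (fderiv ℝ h (p, y)).comp (ContinuousLinearMap.inl ℝ P Y) ∂ν) p := by
  refine hasFDerivAt_weighted_integral hρ hK hρK isOpen_univ
    (h := fun p y => h (p, y))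
    (h' := fun p y => (fderiv ℝ h (p, y)).comp (ContinuousLinearMap.inl ℝ P Y))
    hh.continuous.continuousOn ?_ (fun p _ y => hasFDerivAt_slice
      (hh.differentiable one_ne_zero) p y) (mem_univ p)
  have := hh.continuous_fderiv one_ne_zero
  exact (this.clm_comp continuous_const).continuousOn

lemma contDiff_weighted_integral {ν : Measure Y} {ρ : Y → ℝ}
    (hρ : Integrable ρ ν) {K : Set Y} (hK : IsCompact K) (hρK : ∀ᵐ y ∂ν, ρ y ≠ 0 → y ∈ K)
    (m : ℕ) : ∀ {F : Type} [NormedAddCommGroup F] [NormedSpace ℝ F]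
    {h : P × Y → F} (_ : ContDiff ℝ m h), ContDiff ℝ m (fun p => ∫ y, ρ y • h (p, y) ∂ν) := by
  induction m with
  | zero =>
    intro F _ _ h hh
    rw [Nat.cast_zero, contDiff_zero] at hh ⊢
    rw [← continuousOn_univ]
    exact continuousOn_weighted_integral hρ hK hρK isOpen_univ (h := fun p y => h (p, y))
      hh.continuousOn
  | succ m ih =>
    intro F _ _ h hh
    have h1 : ContDiff ℝ 1 h := hh.of_le (by
      push_cast; exact le_add_self)
    rw [Nat.cast_succ, contDiff_succ_iff_hasFDerivAt]
    refine ⟨_, ?_, fun p => hasFDerivAt_weighted_integral_of_contDiff hρ hK hρK h1 p⟩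
    refine ih (h := fun z => (fderiv ℝ h z).comp (ContinuousLinearMap.inl ℝ P Y)) ?_
    have : ContDiff ℝ m (fderiv ℝ h) := hh.fderiv_right (by push_cast; exact le_rfl)
    exact this.clm_comp contDiff_const

end ParametricIntegrals

/-! ### Directional derivatives -/

section DirectionalDerivatives

variable {P Q : Type} [NormedAddCommGroup P] [NormedSpace ℝ P] [NormedAddCommGroup Q]
  [NormedSpace ℝ Q]

/-- The derivative of a real function in the direction `v`. -/
noncomputable def dirDeriv (v : P) (f : P → ℝ) : P → ℝ := fun p => fderiv ℝ f p v

/-- The sum of the second derivatives of a function in the directions `d i`. With `d` an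
orthonormal basis of the space variables this is the Laplacian in these variables. -/
noncomputable def dirLap {n : ℕ} (d : Fin n → P) (f : P → ℝ) : P → ℝ :=
  fun p => ∑ i, dirDeriv (d i) (dirDeriv (d i) f) p

lemma contDiff_dirDeriv {m : ℕ} {f : P → ℝ} (hf : ContDiff ℝ ((m + 1 : ℕ) : WithTop ℕ∞) f)
    (v : P) : ContDiff ℝ m (dirDeriv v f) := by
  have : ContDiff ℝ m (fderiv ℝ f) := hf.fderiv_right (by push_cast; exact le_rfl)
  exact this.clm_apply contDiff_const

lemma continuous_dirDeriv {f : P → ℝ} (hf : ContDiff ℝ 1 f) (v : P) :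
    Continuous (dirDeriv v f) :=
  (hf.continuous_fderiv one_ne_zero).clm_apply continuous_const

lemma contDiff_dirLap {n m : ℕ} {f : P → ℝ} (hf : ContDiff ℝ ((m + 2 : ℕ) : WithTop ℕ∞) f)
    (d : Fin n → P) : ContDiff ℝ m (dirLap d f) := by
  unfold dirLap
  exact ContDiff.sum fun i _ => contDiff_dirDeriv (m := m)
    (contDiff_dirDeriv (m := m + 1) hf (d i)) (d i)

lemma hasDerivAt_dirDeriv {f : P → ℝ} {p v : P} {r : ℝ} (hf : DifferentiableAt ℝ f (p + r • v)) :
    HasDerivAt (fun r : ℝ => f (p + r • v)) (dirDeriv v f (p + r • v)) r := by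
  have h1 : HasDerivAt (fun r : ℝ => p + r • v) v r := by
    simpa using ((hasDerivAt_id r).smul_const v).const_add p
  exact hf.hasFDerivAt.comp_hasDerivAt r h1

lemma dirDeriv_add_dir (v w : P) (f : P → ℝ) (p : P) :
    dirDeriv (v + w) f p = dirDeriv v f p + dirDeriv w f p := by
  simp [dirDeriv]

lemma dirDeriv_smul_dir (r : ℝ) (v : P) (f : P → ℝ) (p : P) :
    dirDeriv (r • v) f p = r * dirDeriv v f p := by
  simp [dirDeriv]

lemma dirDeriv_add {f g : P → ℝ} {p : P} (hf : DifferentiableAt ℝ f p)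
    (hg : DifferentiableAt ℝ g p) (v : P) :
    dirDeriv v (fun p => f p + g p) p = dirDeriv v f p + dirDeriv v g p := by
  simp [dirDeriv, fderiv_fun_add hf hg]

lemma dirDeriv_sum {ι : Type} (s : Finset ι) {f : ι → P → ℝ} {p : P}
    (hf : ∀ i ∈ s, DifferentiableAt ℝ (f i) p) (v : P) :
    dirDeriv v (fun p => ∑ i ∈ s, f i p) p = ∑ i ∈ s, dirDeriv v (f i) p := by
  simp [dirDeriv, fderiv_fun_sum hf]

lemma dirDeriv_mul {f g : P → ℝ} {p : P} (hf : DifferentiableAt ℝ f p)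
    (hg : DifferentiableAt ℝ g p) (v : P) :
    dirDeriv v (fun p => f p * g p) p = dirDeriv v f p * g p + f p * dirDeriv v g p := by
  simp [dirDeriv, fderiv_fun_mul hf hg]; ring

lemma dirDeriv_const_mul {f : P → ℝ} {p : P} (hf : DifferentiableAt ℝ f p) (c : ℝ) (v : P) :
    dirDeriv v (fun p => c * f p) p = c * dirDeriv v f p := by
  simp [dirDeriv, fderiv_const_mul hf c]

lemma dirDeriv_comp_affine {f : Q → ℝ} (L : P →L[ℝ] Q) (q : Q) {p : P}
    (hf : DifferentiableAt ℝ f (q + L p)) (v : P) :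
    dirDeriv v (fun p => f (q + L p)) p = dirDeriv (L v) f (q + L p) := by
  have h := hf.hasFDerivAt.comp p (L.hasFDerivAt.const_add q)
  have h' : HasFDerivAt (fun p => f (q + L p)) ((fderiv ℝ f (q + L p)).comp L) p := h
  simp [dirDeriv, h'.fderiv]

lemma dirDeriv_dirDeriv_eq {f : P → ℝ} (hf : ContDiff ℝ 2 f) (a b p : P) :
    dirDeriv a (dirDeriv b f) p = fderiv ℝ (fderiv ℝ f) p a b := by
  have hd : DifferentiableAt ℝ (fderiv ℝ f) p :=
    ((hf.fderiv_right (m := 1) (by norm_num)).differentiable one_ne_zero) p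
  have : HasFDerivAt (dirDeriv b f) _ p := hd.hasFDerivAt.clm_apply (hasFDerivAt_const b p)
  rw [dirDeriv, this.fderiv]
  simp

lemma dirDeriv_comm {f : P → ℝ} (hf : ContDiff ℝ 2 f) (v w p : P) :
    dirDeriv v (dirDeriv w f) p = dirDeriv w (dirDeriv v f) p := by
  have hs := (hf.contDiffAt (x := p)).isSymmSndFDerivAt (by simp)
  rw [dirDeriv_dirDeriv_eq hf, dirDeriv_dirDeriv_eq hf, hs.eq]

lemma dirLap_comp_affine {n : ℕ} {f : Q → ℝ} (hf : ContDiff ℝ 2 f) (L : P →L[ℝ] Q) (q : Q) (p : P)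
    (d : Fin n → P) :
    dirLap d (fun p => f (q + L p)) p = dirLap (fun i => L (d i)) f (q + L p) := by
  unfold dirLap
  refine Finset.sum_congr rfl fun i _ => ?_
  have : dirDeriv (d i) (fun p => f (q + L p)) = fun p => dirDeriv (L (d i)) f (q + L p) := by
    funext p
    exact dirDeriv_comp_affine L q (hf.differentiable two_ne_zero _) _
  rw [this, dirDeriv_comp_affine]
  exact (contDiff_dirDeriv (m := 1) hf _).differentiable one_ne_zero _

lemma dirDeriv_dirLap {n : ℕ} {f : P → ℝ} (hf : ContDiff ℝ 3 f) (d : Fin n → P) (v p : P) :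
    dirDeriv v (dirLap d f) p = dirLap d (dirDeriv v f) p := by
  have h2 : ContDiff ℝ 2 f := hf.of_le (by norm_num)
  unfold dirLap
  rw [dirDeriv_sum]
  · refine Finset.sum_congr rfl fun i _ => ?_
    rw [dirDeriv_comm (contDiff_dirDeriv (m := 2) hf _)]
    congr 1
    funext p'
    exact dirDeriv_comm h2 _ _ _
  · intro i _
    exact (contDiff_dirDeriv (m := 1) (contDiff_dirDeriv (m := 2) hf _) _).differentiable
      one_ne_zero _

lemma dirLap_add {n : ℕ} {f g : P → ℝ} (hf : ContDiff ℝ 2 f) (hg : ContDiff ℝ 2 g) (d : Fin n → P)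
    (p : P) : dirLap d (fun p => f p + g p) p = dirLap d f p + dirLap d g p := by
  unfold dirLap
  rw [← Finset.sum_add_distrib]
  refine Finset.sum_congr rfl fun i _ => ?_
  have : dirDeriv (d i) (fun p => f p + g p) = fun p => dirDeriv (d i) f p + dirDeriv (d i) g p := by
    funext p
    exact dirDeriv_add (hf.differentiable two_ne_zero _) (hg.differentiable two_ne_zero _) _
  rw [this, dirDeriv_add]
  · exact (contDiff_dirDeriv (m := 1) hf _).differentiable one_ne_zero _
  · exact (contDiff_dirDeriv (m := 1) hg _).differentiable one_ne_zero _

/-- A factor that is constant in the directions `d i` can be pulled out of the Laplacian. -/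
lemma dirLap_mul_of_const {n : ℕ} {c f : P → ℝ} (hc : ContDiff ℝ 1 c) (hf : ContDiff ℝ 2 f)
    (d : Fin n → P) (hcd : ∀ i p, dirDeriv (d i) c p = 0) (p : P) :
    dirLap d (fun p => c p * f p) p = c p * dirLap d f p := by
  unfold dirLap
  rw [Finset.mul_sum]
  refine Finset.sum_congr rfl fun i _ => ?_
  have hf1 := contDiff_dirDeriv (m := 1) hf (d i)
  have : dirDeriv (d i) (fun p => c p * f p) = fun p => c p * dirDeriv (d i) f p := by
    funext p
    rw [dirDeriv_mul (hc.differentiable one_ne_zero _) (hf.differentiable two_ne_zero _), hcd,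
      zero_mul, zero_add]
  rw [this, dirDeriv_mul (hc.differentiable one_ne_zero _) (hf1.differentiable one_ne_zero _), hcd,
      zero_mul, zero_add]

/-- The Laplacian of a function on Euclidean space in terms of second directional derivatives. -/
lemma laplacian_eq_dirLap {n : ℕ} {f : EuclideanSpace ℝ (Fin n) → ℝ} (hf : ContDiff ℝ 2 f)
    (x : EuclideanSpace ℝ (Fin n)) :
    Δ f x = dirLap (fun i => EuclideanSpace.single i (1 : ℝ)) f x := by
  rw [InnerProductSpace.laplacian_eq_iteratedFDeriv_orthonormalBasis f
    (EuclideanSpace.basisFun (Fin n) ℝ)]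
  unfold dirLap
  refine Finset.sum_congr rfl fun i _ => ?_
  rw [dirDeriv_dirDeriv_eq hf, iteratedFDeriv_two_apply]
  simp

end DirectionalDerivatives

/-! ### Integrals with variable upper limit -/

section IntegralsWithVariableLimit

variable {P Y : Type} [NormedAddCommGroup P] [NormedSpace ℝ P] [FiniteDimensional ℝ P]
  [NormedAddCommGroup Y] [NormedSpace ℝ Y] [FiniteDimensional ℝ Y] [MeasurableSpace Y]
  [BorelSpace Y]

lemma dirDeriv_weighted_integral {ν : Measure Y} {ρ : Y → ℝ}
    (hρ : Integrable ρ ν) {K : Set Y} (hK : IsCompact K) (hρK : ∀ᵐ y ∂ν, ρ y ≠ 0 → y ∈ K)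
    {h : P × Y → ℝ} (hh : ContDiff ℝ 1 h) (v p : P) :
    dirDeriv v (fun p => ∫ y, ρ y * h (p, y) ∂ν) p = ∫ y, ρ y * dirDeriv (v, 0) h (p, y) ∂ν := by
  have h1 := hasFDerivAt_weighted_integral_of_contDiff hρ hK hρK hh p
  simp only [smul_eq_mul] at h1
  simp only [dirDeriv]
  rw [h1.fderiv, ContinuousLinearMap.integral_apply]
  · simp
  · refine integrable_weighted hρ hK hρK ?_
    have := hh.continuous_fderiv one_ne_zero
    fun_prop

/-- The integral of `h(p, ·)` over `[0, τ]`, as a function of `(p, τ)`. -/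
noncomputable def primitiveAt (h : P × ℝ → ℝ) : P × ℝ → ℝ :=
  fun z => ∫ s in (0 : ℝ)..z.2, h (z.1, s)

/-- The substitution `s = τ σ` makes the domain of integration independent of the parameters. -/
lemma primitiveAt_eq (h : P × ℝ → ℝ) (z : P × ℝ) :
    primitiveAt h z = ∫ σ in Ioc (0 : ℝ) 1, (1 : ℝ) • (z.2 * h (z.1, z.2 * σ)) := by
  unfold primitiveAt
  have := intervalIntegral.smul_integral_comp_mul_left (a := 0) (b := 1)
    (fun s => h (z.1, s)) z.2
  simp only [mul_zero, mul_one] at this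
  rw [← this, intervalIntegral.integral_of_le zero_le_one]
  simp [integral_const_mul]

lemma contDiff_primitiveAt {m : ℕ} {h : P × ℝ → ℝ} (hh : ContDiff ℝ m h) :
    ContDiff ℝ m (primitiveAt h) := by
  have := contDiff_weighted_integral (P := P × ℝ) (ν := volume.restrict (Ioc (0 : ℝ) 1))
    (ρ := fun _ => (1 : ℝ)) (integrable_const 1) (isCompact_Icc (a := (0 : ℝ)) (b := 1))
    (by
      filter_upwards [ae_restrict_mem measurableSet_Ioc] with y hy _
      exact Ioc_subset_Icc_self hy) m
    (h := fun z => z.1.2 * h (z.1.1, z.1.2 * z.2)) (by fun_prop)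
  have e : primitiveAt h = fun z => _ := funext (primitiveAt_eq h)
  rw [e]
  exact this

lemma dirDeriv_primitiveAt {h : P × ℝ → ℝ} (hh : ContDiff ℝ 1 h) (v : P) (r : ℝ) (z : P × ℝ) :
    dirDeriv (v, r) (primitiveAt h) z = primitiveAt (dirDeriv (v, 0) h) z + r * h z := by
  have hC : ContDiff ℝ 1 (primitiveAt h) := contDiff_primitiveAt (m := 1) hh
  have hd : DifferentiableAt ℝ (primitiveAt h) z := hC.differentiable one_ne_zero z
  have h0 : ((v, r) : P × ℝ) = (v, 0) + r • (0, 1) := by simp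
  rw [h0, dirDeriv_add_dir, dirDeriv_smul_dir]
  congr 1
  · have e1 : (fun p => primitiveAt h (p, z.2))
        = fun p => ∫ s in Ioc (min 0 z.2) (max 0 z.2), (if 0 ≤ z.2 then (1 : ℝ) else -1) * h (p, s) := by
      funext p
      simp only [primitiveAt]
      split_ifs with hz
      · rw [intervalIntegral.integral_of_le hz, min_eq_left hz, max_eq_right hz]; simp
      · have hz' : z.2 ≤ 0 := (not_le.1 hz).le
        rw [intervalIntegral.integral_of_ge hz', min_eq_right hz', max_eq_left hz',
          integral_const_mul]; simp
    have e2 : primitiveAt (dirDeriv (v, 0) h) z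
        = ∫ s in Ioc (min 0 z.2) (max 0 z.2),
          (if 0 ≤ z.2 then (1 : ℝ) else -1) * dirDeriv (v, 0) h (z.1, s) := by
      simp only [primitiveAt]
      split_ifs with hz
      · rw [intervalIntegral.integral_of_le hz, min_eq_left hz, max_eq_right hz]; simp
      · have hz' : z.2 ≤ 0 := (not_le.1 hz).le
        rw [intervalIntegral.integral_of_ge hz', min_eq_right hz', max_eq_left hz',
          integral_const_mul]; simp
    have e3 := dirDeriv_weighted_integral
      (ν := volume.restrict (Ioc (min 0 z.2) (max 0 z.2)))
      (ρ := fun _ => if 0 ≤ z.2 then (1 : ℝ) else -1) (integrable_const _)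
      (isCompact_Icc (a := min 0 z.2) (b := max 0 z.2))
      (by
        filter_upwards [ae_restrict_mem measurableSet_Ioc] with y hy _
        exact Ioc_subset_Icc_self hy) hh v z.1
    rw [e2, ← e3, ← e1]
    have := hd.hasFDerivAt.comp z.1 (hasFDerivAt_prodMk_left (𝕜 := ℝ) z.1 z.2)
    have this' : HasFDerivAt (fun p => primitiveAt h (p, z.2)) _ z.1 := this
    simp only [dirDeriv]
    rw [this'.fderiv]
    simp
  · congr 1
    have h1 : HasDerivAt (fun τ => primitiveAt h (z.1, τ)) (dirDeriv (0, 1) (primitiveAt h) z) z.2 := by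
      have := hd.hasFDerivAt.comp z.2 (hasFDerivAt_prodMk_right (𝕜 := ℝ) z.1 z.2)
      have h' := this.hasDerivAt
      simp only [ContinuousLinearMap.comp_apply, ContinuousLinearMap.inr_apply] at h'
      exact h'
    have hcont : Continuous fun s => h (z.1, s) := by
      have := hh.continuous; fun_prop
    have h2 : HasDerivAt (fun τ => primitiveAt h (z.1, τ)) (h (z.1, z.2)) z.2 :=
      intervalIntegral.integral_hasDerivAt_right (hcont.intervalIntegrable _ _)
        hcont.stronglyMeasurable.stronglyMeasurableAtFilter hcont.continuousAt
    exact h1.unique h2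

/-- Leibniz' rule for an integrand that is differentiable in the parameter, but only continuous
in the variable of integration. -/
lemma hasFDerivAt_integral_variable_limit {F : Type} [NormedAddCommGroup F] [NormedSpace ℝ F]
    [CompleteSpace F] {G : P → ℝ → F} {G' : P → ℝ → P →L[ℝ] F}
    (hc : Continuous (fun z : P × ℝ => G z.1 z.2))
    (hc' : Continuous (fun z : P × ℝ => G' z.1 z.2))
    (hd : ∀ p b, HasFDerivAt (fun p => G p b) (G' p b) p) (l : P →L[ℝ] ℝ) (p₀ : P) :
    HasFDerivAt (fun p => ∫ b in (0 : ℝ)..(l p), G p b)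
      ((∫ b in (0 : ℝ)..(l p₀), G' p₀ b) + l.smulRight (G p₀ (l p₀))) p₀ := by
  set τ := l p₀ with hτ
  have hint : ∀ p a b, IntervalIntegrable (G p) volume a b := fun p a b =>
    (hc.comp (f := fun s => (p, s)) (by fun_prop)).intervalIntegrable _ _
  -- The integral over `[0, l p₀]` has a fixed domain; only the value of `G` at `(p₀, l p₀)` matters
  -- for the derivative of the remaining integral over `[l p₀, l p]`.
  have split : (fun p => ∫ b in (0 : ℝ)..(l p), G p b)
      = fun p => (∫ b in (0 : ℝ)..τ, G p b) + ∫ b in τ..(l p), G p b := by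
    funext p
    rw [intervalIntegral.integral_add_adjacent_intervals (hint _ _ _) (hint _ _ _)]
  rw [split]
  refine HasFDerivAt.add ?_ ?_
  · have key : ∀ a b : ℝ, a ≤ b → HasFDerivAt (fun p => ∫ s in Ioc a b, G p s)
        (∫ s in Ioc a b, G' p₀ s) p₀ := by
      intro a b _
      have := hasFDerivAt_weighted_integral
        (ν := volume.restrict (Ioc a b)) (ρ := fun _ => (1 : ℝ)) (integrable_const _)
        (isCompact_Icc (a := a) (b := b))
        (by
          filter_upwards [ae_restrict_mem measurableSet_Ioc] with y hy _
          exact Ioc_subset_Icc_self hy) isOpen_univ (h := G) (h' := G') hc.continuousOn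
        hc'.continuousOn (fun p _ y => hd p y) (mem_univ p₀)
      simpa using this
    rcases le_total 0 τ with h | h
    · simpa only [intervalIntegral.integral_of_le h] using key 0 τ h
    · simpa only [intervalIntegral.integral_of_ge h] using (key τ 0 h).fun_neg
  · rw [hasFDerivAt_iff_isLittleO]
    simp only [← hτ, intervalIntegral.integral_same, sub_zero]
    rw [Asymptotics.isLittleO_iff]
    intro c hc0
    have hcont : ContinuousAt (fun z : P × ℝ => G z.1 z.2) (p₀, τ) := hc.continuousAt
    obtain ⟨C, hC0, hC⟩ : ∃ C > 0, ∀ p, ‖l p‖ ≤ C * ‖p‖ :=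
      ⟨‖l‖ + 1, by positivity, fun p => (l.le_opNorm p).trans (by gcongr; linarith)⟩
    have hev : ∀ᶠ z : P × ℝ in 𝓝 (p₀, τ), ‖G z.1 z.2 - G p₀ τ‖ ≤ c / C := by
      have := Metric.tendsto_nhds.1 hcont (c / C) (by positivity)
      filter_upwards [this] with z hz
      rw [dist_eq_norm] at hz
      exact hz.le
    rw [nhds_prod_eq] at hev
    obtain ⟨U, hU, W, hW, hUW⟩ := Filter.mem_prod_iff.1 hev
    obtain ⟨ε, hε, hεW⟩ := Metric.mem_nhds_iff.1 hW
    have hl : ∀ᶠ p in 𝓝 p₀, l p ∈ Metric.ball τ ε :=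
      l.continuous.continuousAt.eventually_mem (Metric.ball_mem_nhds _ hε)
    filter_upwards [hU, hl] with p hp hlp
    have e : (∫ b in τ..(l p), G p b) - (l.smulRight (G p₀ τ)) (p - p₀)
        = ∫ b in τ..(l p), (G p b - G p₀ τ) := by
      rw [intervalIntegral.integral_sub (hint _ _ _) (by simp)]
      simp [hτ]
    rw [e]
    have hb := intervalIntegral.norm_integral_le_of_norm_le_const (a := τ) (b := l p)
      (f := fun b => G p b - G p₀ τ) (C := c / C) (by
        intro b hb
        refine hUW (a := (p, b)) ⟨hp, hεW ?_⟩
        rw [Metric.mem_ball, Real.dist_eq] at hlp ⊢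
        refine lt_of_le_of_lt ?_ hlp
        exact abs_sub_left_of_mem_uIcc (uIoc_subset_uIcc hb))
    refine hb.trans ?_
    have : |l p - τ| ≤ C * ‖p - p₀‖ := by
      have := hC (p - p₀)
      simpa [hτ] using this
    calc c / C * |l p - τ| ≤ c / C * (C * ‖p - p₀‖) := by gcongr
      _ = c * ‖p - p₀‖ := by field_simp

end IntegralsWithVariableLimit

/-! ### Approximation of the inverse square root -/

section Weights

lemma hasDerivAt_max_zero_sq (σ : ℝ) :
    HasDerivAt (fun σ : ℝ => max σ 0 ^ 2) (2 * max σ 0) σ := by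
  rcases lt_trichotomy σ 0 with h | h | h
  · rw [max_eq_right h.le, mul_zero]
    refine (hasDerivAt_const σ (0 : ℝ)).congr_of_eventuallyEq ?_
    filter_upwards [Iio_mem_nhds h] with s hs
    rw [max_eq_right (le_of_lt hs)]; simp
  · subst h
    rw [max_self, mul_zero, hasDerivAt_iff_isLittleO]
    simp only [max_self, sub_zero, smul_zero]
    have h1 : (fun x : ℝ => x ^ 2) =o[𝓝 0] fun x => x := by
      simpa using (Asymptotics.isLittleO_pow_pow (𝕜 := ℝ) (m := 1) (n := 2) one_lt_two)
    refine Asymptotics.IsBigO.trans_isLittleO ?_ h1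
    refine Asymptotics.IsBigO.of_bound 1 (Eventually.of_forall fun x => ?_)
    rcases le_total x 0 with hx | hx
    · simp [max_eq_right hx]; positivity
    · simp [max_eq_left hx]
  · rw [max_eq_left h.le]
    have : HasDerivAt (fun σ : ℝ => σ ^ 2) (2 * σ) σ := by simpa using hasDerivAt_pow 2 σ
    refine this.congr_of_eventuallyEq ?_
    filter_upwards [Ioi_mem_nhds h] with s hs
    rw [max_eq_left (le_of_lt hs)]

/-- A `C¹` approximation of `σ ↦ σ^{-1/2}` that vanishes for `σ ≤ 0`. The exponents are chosen so that
it is bounded by `σ^{-1/2}`, and `σ` times its derivative by a multiple of `σ^{-1/2}`, uniformly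
in `ε`. -/
noncomputable def approxWeight (ε σ : ℝ) : ℝ := max σ 0 ^ 2 * (σ ^ 2 + ε) ^ (-5 / 4 : ℝ)

/-- The derivative of `approxWeight ε`. -/
noncomputable def approxWeightDeriv (ε σ : ℝ) : ℝ :=
  2 * max σ 0 * (σ ^ 2 + ε) ^ (-5 / 4 : ℝ)
    - 5 / 2 * (σ * max σ 0 ^ 2 * (σ ^ 2 + ε) ^ (-9 / 4 : ℝ))

lemma hasDerivAt_approxWeight {ε : ℝ} (hε : 0 < ε) (σ : ℝ) :
    HasDerivAt (approxWeight ε) (approxWeightDeriv ε σ) σ := by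
  have h1 : HasDerivAt (fun σ : ℝ => σ ^ 2 + ε) (2 * σ) σ := by
    simpa using (hasDerivAt_pow 2 σ).add_const ε
  have h2 := h1.rpow_const (p := -5 / 4) (Or.inl (by positivity))
  refine ((hasDerivAt_max_zero_sq σ).fun_mul h2).congr_deriv ?_
  unfold approxWeightDeriv
  norm_num
  ring

lemma continuous_approxWeightDeriv {ε : ℝ} (hε : 0 < ε) : Continuous (approxWeightDeriv ε) := by
  unfold approxWeightDeriv
  have hp : ∀ p : ℝ, Continuous fun σ : ℝ => (σ ^ 2 + ε) ^ p := fun p =>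
    Continuous.rpow_const (by fun_prop) fun σ => Or.inl (by positivity)
  have := hp (-5 / 4)
  have := hp (-9 / 4)
  fun_prop

lemma approxWeight_of_nonpos {ε σ : ℝ} (hσ : σ ≤ 0) : approxWeight ε σ = 0 := by
  simp [approxWeight, max_eq_right hσ]

lemma rpow_sq_eq {σ : ℝ} (hσ : 0 < σ) (j : ℕ) (p : ℝ) (hp : 2 * p + j = -1 / 2) :
    σ ^ j * (σ ^ 2) ^ p = 1 / √σ := by
  rw [← Real.rpow_natCast σ j, ← Real.rpow_natCast σ 2, ← Real.rpow_mul hσ.le,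
    ← Real.rpow_add hσ, Real.sqrt_eq_rpow, one_div, ← Real.rpow_neg hσ.le]
  congr 1
  push_cast
  linarith

/-- The condition on the exponents says that the left-hand side is `σ^{-1/2}` for `ε = 0`. -/
lemma power_weight_bound {ε σ : ℝ} (hε : 0 < ε) (hσ : 0 < σ) (j : ℕ) (p : ℝ) (hp0 : p ≤ 0)
    (hp : 2 * p + j = -1 / 2) : σ ^ j * (σ ^ 2 + ε) ^ p ≤ 1 / √σ := by
  rw [← rpow_sq_eq hσ j p hp]
  refine mul_le_mul_of_nonneg_left ?_ (by positivity)
  exact Real.rpow_le_rpow_of_nonpos (by positivity) (by linarith) hp0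

lemma power_weight_tendsto {σ : ℝ} (hσ : 0 < σ) (j : ℕ) (p : ℝ)
    (hp : 2 * p + j = -1 / 2) :
    Tendsto (fun i : ℕ => σ ^ j * (σ ^ 2 + 1 / ((i : ℝ) + 1)) ^ p) atTop (𝓝 (1 / √σ)) := by
  rw [← rpow_sq_eq hσ j p hp]
  refine Tendsto.const_mul _ ?_
  have h1 : Tendsto (fun i : ℕ => σ ^ 2 + 1 / ((i : ℝ) + 1)) atTop (𝓝 (σ ^ 2)) := by
    simpa using (tendsto_one_div_add_atTop_nhds_zero_nat (𝕜 := ℝ)).const_add (σ ^ 2)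
  exact h1.rpow_const (Or.inl (by positivity))

lemma approxWeight_bound {ε : ℝ} (hε : 0 < ε) (σ : ℝ) : |approxWeight ε σ| ≤ 1 / √σ := by
  rcases le_or_gt σ 0 with h | h
  · rw [approxWeight_of_nonpos h]; simp
  · have := power_weight_bound hε h 2 (-5 / 4) (by norm_num) (by norm_num)
    unfold approxWeight
    rw [max_eq_left h.le, abs_of_nonneg (by positivity)]
    exact this

lemma approxWeight_tendsto (σ : ℝ) :
    Tendsto (fun i : ℕ => approxWeight (1 / ((i : ℝ) + 1)) σ) atTop (𝓝 (1 / √σ)) := by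
  rcases le_or_gt σ 0 with h | h
  · simp [approxWeight_of_nonpos h, Real.sqrt_eq_zero_of_nonpos h]
  · unfold approxWeight
    rw [max_eq_left h.le]
    exact power_weight_tendsto h 2 (-5 / 4) (by norm_num)

lemma mul_approxWeightDeriv_of_pos {ε σ : ℝ} (hσ : 0 < σ) :
    σ * approxWeightDeriv ε σ = 2 * (σ ^ 2 * (σ ^ 2 + ε) ^ (-5 / 4 : ℝ))
      - 5 / 2 * (σ ^ 4 * (σ ^ 2 + ε) ^ (-9 / 4 : ℝ)) := by
  unfold approxWeightDeriv
  rw [max_eq_left hσ.le]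
  ring

lemma mul_approxWeightDeriv_of_nonpos {ε σ : ℝ} (hσ : σ ≤ 0) :
    σ * approxWeightDeriv ε σ = 0 := by
  simp [approxWeightDeriv, max_eq_right hσ]

lemma mul_approxWeightDeriv_bound {ε : ℝ} (hε : 0 < ε) (σ : ℝ) :
    |σ * approxWeightDeriv ε σ| ≤ 5 * (1 / √σ) := by
  rcases le_or_gt σ 0 with h | h
  · rw [mul_approxWeightDeriv_of_nonpos h]; simp
  · have h1 := power_weight_bound hε h 2 (-5 / 4) (by norm_num) (by norm_num)
    have h2 := power_weight_bound hε h 4 (-9 / 4) (by norm_num) (by norm_num)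
    have h3 : 0 ≤ σ ^ 2 * (σ ^ 2 + ε) ^ (-5 / 4 : ℝ) := by positivity
    have h4 : 0 ≤ σ ^ 4 * (σ ^ 2 + ε) ^ (-9 / 4 : ℝ) := by positivity
    rw [mul_approxWeightDeriv_of_pos h, abs_le]
    constructor <;> linarith

lemma mul_approxWeightDeriv_tendsto (σ : ℝ) :
    Tendsto (fun i : ℕ => σ * approxWeightDeriv (1 / ((i : ℝ) + 1)) σ) atTop
      (𝓝 (-(1 / 2) * (1 / √σ))) := by
  rcases le_or_gt σ 0 with h | h
  · simp [mul_approxWeightDeriv_of_nonpos h, Real.sqrt_eq_zero_of_nonpos h]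
  · have h1 := power_weight_tendsto h 2 (-5 / 4) (by norm_num)
    have h2 := power_weight_tendsto h 4 (-9 / 4) (by norm_num)
    have := (h1.const_mul 2).sub (h2.const_mul (5 / 2))
    simp only [mul_approxWeightDeriv_of_pos h]
    convert this using 2
    ring

end Weights

/-! ### The weight of the ball means -/

section DescentWeight

variable {n : ℕ}

local notation "E" => EuclideanSpace ℝ (Fin n)

/-- The weight `(1 - |y|²)^{-1/2}` of the unit ball. Outside of the ball it is zero, because the root
of a nonpositive number and the inverse of zero are zero. -/
noncomputable def descentWeight (y : E) : ℝ := 1 / √(1 - ‖y‖ ^ 2)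

lemma descentWeight_ne_zero {y : E} (hy : descentWeight y ≠ 0) :
    y ∈ Metric.closedBall (0 : E) 1 := by
  rw [mem_closedBall_zero_iff]
  by_contra h
  apply hy
  have : 1 - ‖y‖ ^ 2 ≤ 0 := by nlinarith
  simp [descentWeight, Real.sqrt_eq_zero_of_nonpos this]

lemma integrableOn_inv_sqrt (j : ℕ) :
    IntegrableOn (fun r : ℝ => r ^ j * (1 / √(1 - r ^ 2))) (Ioc 0 1) := by
  have h1 : IntervalIntegrable (fun x : ℝ => x ^ (-1 / 2 : ℝ)) volume (1 - 0) (1 - 1) :=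
    intervalIntegral.intervalIntegrable_rpow' (by norm_num)
  have h2 := h1.comp_sub_left 1
  simp only [sub_sub_cancel] at h2
  rw [intervalIntegrable_iff_integrableOn_Ioc_of_le zero_le_one] at h2
  refine Integrable.mono' h2 (by fun_prop) ?_
  filter_upwards [ae_restrict_mem measurableSet_Ioc] with r hr
  obtain ⟨hr0, hr1⟩ := hr
  rw [Real.norm_of_nonneg (by positivity)]
  rcases hr1.eq_or_lt with rfl | hr1
  · simp
  have hp : 0 < 1 - r := by linarith
  have e : (1 - r) ^ (-1 / 2 : ℝ) = 1 / √(1 - r) := by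
    rw [Real.sqrt_eq_rpow, one_div (_ ^ _), ← Real.rpow_neg hp.le]; norm_num
  rw [e]
  calc r ^ j * (1 / √(1 - r ^ 2)) ≤ 1 * (1 / √(1 - r)) := by
        gcongr
        · exact pow_le_one₀ hr0.le hr1.le
        · nlinarith
    _ = _ := one_mul _

lemma indicator_radial_weight (j : ℕ) (r : ℝ) (hr : r ∈ Ioi (0 : ℝ)) :
    r ^ j * (1 / √(1 - r ^ 2)) = (Ioc 0 1).indicator (fun r : ℝ => r ^ j * (1 / √(1 - r ^ 2))) r := by
  by_cases h : r ∈ Ioc (0 : ℝ) 1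
  · rw [indicator_of_mem h]
  · rw [indicator_of_notMem h]
    have : 1 < r := by
      by_contra h'
      exact h ⟨hr, not_lt.1 h'⟩
    have : 1 - r ^ 2 ≤ 0 := by nlinarith
    simp [Real.sqrt_eq_zero_of_nonpos this]

lemma integrable_descentWeight (hn : 0 < n) : Integrable (descentWeight (n := n)) := by
  have : Nontrivial E := by
    have : Nonempty (Fin n) := ⟨⟨0, hn⟩⟩
    infer_instance
  unfold descentWeight
  rw [integrable_fun_norm_addHaar (μ := (volume : Measure E)) (f := fun r => 1 / √(1 - r ^ 2))]
  simp only [smul_eq_mul]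
  have := (integrableOn_inv_sqrt (Module.finrank ℝ E - 1)).integrable_indicator measurableSet_Ioc
  refine IntegrableOn.congr_fun this.integrableOn (fun r hr => ?_) measurableSet_Ioi
  exact (indicator_radial_weight _ r hr).symm

/-- The integral `∫_0^1 r^{2k+1} (1 - r²)^{-1/2} dr`, by recursion on `k`. -/
lemma integral_inv_sqrt_odd (k : ℕ) :
    ∫ r in Ioc (0 : ℝ) 1, r ^ (2 * k + 1) * (1 / √(1 - r ^ 2))
      = ((2 * k).doubleFactorial : ℝ) / (2 * k + 1).doubleFactorial := by
  have hs : ∀ r ∈ Ioo (0 : ℝ) 1, HasDerivAt (fun r : ℝ => √(1 - r ^ 2)) (-r / √(1 - r ^ 2)) r := by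
    intro r hr
    have hp : 0 < 1 - r ^ 2 := by nlinarith [hr.1, hr.2]
    have h1 : HasDerivAt (fun r : ℝ => 1 - r ^ 2) (-(2 * r)) r := by
      simpa using (hasDerivAt_pow 2 r).const_sub 1
    refine (h1.sqrt hp.ne').congr_deriv ?_
    field_simp
  induction k with
  | zero =>
    have := intervalIntegral.integral_eq_sub_of_hasDerivAt_of_le (a := 0) (b := 1) zero_le_one
      (f := fun r : ℝ => -√(1 - r ^ 2)) (f' := fun r => r ^ (2 * 0 + 1) * (1 / √(1 - r ^ 2)))
      (by fun_prop) (fun r hr => (hs r hr).fun_neg.congr_deriv (by ring))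
      (by
        rw [intervalIntegrable_iff_integrableOn_Ioc_of_le zero_le_one]
        exact integrableOn_inv_sqrt _)
    rw [intervalIntegral.integral_of_le zero_le_one] at this
    rw [this]
    simp [Nat.doubleFactorial]
  | succ k ih =>
    have hi : ∀ j, IntervalIntegrable (fun r : ℝ => r ^ j * (1 / √(1 - r ^ 2))) volume 0 1 := by
      intro j
      rw [intervalIntegrable_iff_integrableOn_Ioc_of_le zero_le_one]
      exact integrableOn_inv_sqrt _
    -- the recursion comes from a function that vanishes at both ends
    have := intervalIntegral.integral_eq_sub_of_hasDerivAt_of_le (a := 0) (b := 1) zero_le_one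
      (f := fun r : ℝ => r ^ (2 * k + 2) * √(1 - r ^ 2))
      (f' := fun r => (2 * k + 2) * (r ^ (2 * k + 1) * (1 / √(1 - r ^ 2)))
        - (2 * k + 3) * (r ^ (2 * (k + 1) + 1) * (1 / √(1 - r ^ 2))))
      (by fun_prop) (fun r hr => by
        have hp : 0 < 1 - r ^ 2 := by nlinarith [hr.1, hr.2]
        have hq : √(1 - r ^ 2) ^ 2 = 1 - r ^ 2 := Real.sq_sqrt hp.le
        have hq0 : √(1 - r ^ 2) ≠ 0 := (Real.sqrt_pos.2 hp).ne'
        refine ((hasDerivAt_pow (2 * k + 2) r).fun_mul (hs r hr)).congr_deriv ?_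
        rw [show 2 * k + 2 - 1 = 2 * k + 1 by omega]
        push_cast
        field_simp
        rw [hq]
        ring)
      (((hi _).const_mul _).sub ((hi _).const_mul _))
    rw [intervalIntegral.integral_sub ((hi _).const_mul _) ((hi _).const_mul _),
      intervalIntegral.integral_const_mul, intervalIntegral.integral_const_mul,
      intervalIntegral.integral_of_le zero_le_one, intervalIntegral.integral_of_le zero_le_one,
      ih] at this
    simp only [one_pow, sub_self, Real.sqrt_zero, mul_zero, ne_eq, Nat.add_eq_zero_iff,
      OfNat.ofNat_ne_zero, and_false, not_false_eq_true, zero_pow, zero_mul] at this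
    rw [show 2 * (k + 1) + 1 = 2 * k + 1 + 2 by ring, show 2 * (k + 1) = 2 * k + 2 by ring,
      Nat.doubleFactorial_add_two, Nat.doubleFactorial_add_two]
    rw [show 2 * (k + 1) + 1 = 2 * k + 1 + 2 by ring] at this
    have h0 : ((2 * k + 1).doubleFactorial : ℝ) ≠ 0 := by
      exact_mod_cast (Nat.doubleFactorial_pos _).ne'
    push_cast
    field_simp
    field_simp at this
    linear_combination -this

/-- The mean value of the weight over the unit ball in even dimension. -/
lemma integral_descentWeight {k : ℕ} (hn : n = 2 * k + 2) :
    (volume (Metric.ball (0 : E) 1)).toReal⁻¹ * ∫ y : E, descentWeight y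
      = (n.doubleFactorial : ℝ) / (n - 1).doubleFactorial := by
  have : Nontrivial E := by
    have : Nonempty (Fin n) := ⟨⟨0, by omega⟩⟩
    infer_instance
  unfold descentWeight
  rw [integral_fun_norm_addHaar (volume : Measure E) (fun r => 1 / √(1 - r ^ 2))]
  simp only [smul_eq_mul, finrank_euclideanSpace, Fintype.card_fin, nsmul_eq_mul]
  have e : ∫ r in Ioi (0 : ℝ), r ^ (n - 1) * (1 / √(1 - r ^ 2))
      = ∫ r in Ioc (0 : ℝ) 1, r ^ (n - 1) * (1 / √(1 - r ^ 2)) := by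
    rw [setIntegral_congr_fun measurableSet_Ioi (indicator_radial_weight (n - 1)),
      setIntegral_indicator measurableSet_Ioc]
    congr 2
    ext r
    simp +contextual
  rw [e, hn, show 2 * k + 2 - 1 = 2 * k + 1 by omega, integral_inv_sqrt_odd,
    Nat.doubleFactorial_add_two, measureReal_def]
  have h0 : (volume (Metric.ball (0 : EuclideanSpace ℝ (Fin (2 * k + 2))) 1)).toReal ≠ 0 := by
    refine (ENNReal.toReal_pos ?_ ?_).ne'
    · exact (Metric.measure_ball_pos _ _ one_pos).ne'
    · exact measure_ball_lt_top.ne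
  field_simp
  push_cast
  ring

end DescentWeight

/-! ### Divergence identities on the unit ball -/

section IntegrationByParts

variable {n : ℕ}

local notation "E" => EuclideanSpace ℝ (Fin n)

/-- The standard basis of Euclidean space. -/
noncomputable abbrev basisVec (i : Fin n) : E := EuclideanSpace.single i (1 : ℝ)

lemma sum_mul_basisVec (y : E) : ∑ i, y i • basisVec i = y := by
  ext j
  simp [basisVec, Finset.sum_apply, Pi.single_apply]

lemma sum_mul_dirDeriv_basisVec (y : E) (f : E → ℝ) (p : E) :
    ∑ i, y i * dirDeriv (basisVec i) f p = dirDeriv y f p := by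
  conv_rhs => rw [← sum_mul_basisVec y]
  simp [dirDeriv]

lemma integral_mul_dirDeriv {a b : E → ℝ} (ha : ContDiff ℝ 1 a) (hac : HasCompactSupport a)
    (hb : ContDiff ℝ 1 b) (v : E) :
    ∫ y, a y * dirDeriv v b y = -∫ y, dirDeriv v a y * b y := by
  have hda : HasCompactSupport (dirDeriv v a) := by
    have := hac.fderiv_apply (𝕜 := ℝ) v
    exact this
  refine integral_mul_fderiv_eq_neg_fderiv_mul_of_integrable ?_ ?_ ?_
    (fun x _ => ha.differentiable one_ne_zero x)
    (fun x _ => hb.differentiable one_ne_zero x)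
  · exact ((continuous_dirDeriv ha v).mul hb.continuous).integrable_of_hasCompactSupport
      hda.mul_right
  · exact (ha.continuous.mul (continuous_dirDeriv hb v)).integrable_of_hasCompactSupport
      hac.mul_right
  · exact (ha.continuous.mul hb.continuous).integrable_of_hasCompactSupport hac.mul_right

lemma dirDeriv_radial {η η' : ℝ → ℝ} (hη : ∀ σ, HasDerivAt η (η' σ) σ) (v y : E) :
    dirDeriv v (fun y : E => η (1 - ‖y‖ ^ 2)) y = -2 * η' (1 - ‖y‖ ^ 2) * inner ℝ y v := by
  have h1 : HasFDerivAt (fun y : E => 1 - ‖y‖ ^ 2) (-(2 • innerSL ℝ y)) y :=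
    ((hasStrictFDerivAt_norm_sq y).hasFDerivAt).const_sub 1
  have h2 := (hη (1 - ‖y‖ ^ 2)).comp_hasFDerivAt y h1
  have h3 : HasFDerivAt (fun y : E => η (1 - ‖y‖ ^ 2)) _ y := h2
  simp only [dirDeriv]
  rw [h3.fderiv]
  simp
  ring

lemma contDiff_radial {η η' : ℝ → ℝ} (hη : ∀ σ, HasDerivAt η (η' σ) σ) (hη' : Continuous η') :
    ContDiff ℝ 1 (fun y : E => η (1 - ‖y‖ ^ 2)) := by
  have h : ContDiff ℝ 1 η := by
    rw [contDiff_one_iff_deriv]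
    refine ⟨fun σ => (hη σ).differentiableAt, ?_⟩
    have : deriv η = η' := funext fun σ => (hη σ).deriv
    rwa [this]
  exact h.comp (contDiff_const.sub (contDiff_norm_sq ℝ))

lemma contDiff_euler {g : E → ℝ} (hg : ContDiff ℝ 2 g) : ContDiff ℝ 1 (fun y => dirDeriv y g y) := by
  have : ContDiff ℝ 1 (fderiv ℝ g) := hg.fderiv_right (by norm_num)
  exact this.clm_apply contDiff_id

/-- The derivative of the radial derivative `y·∇g` in the radial direction. -/
lemma dirDeriv_euler {g : E → ℝ} (hg : ContDiff ℝ 2 g) (y : E) :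
    dirDeriv y (fun y => dirDeriv y g y) y = dirDeriv y g y + fderiv ℝ (fderiv ℝ g) y y y := by
  have hd : DifferentiableAt ℝ (fderiv ℝ g) y :=
    ((hg.fderiv_right (m := 1) (by norm_num)).differentiable one_ne_zero) y
  have : HasFDerivAt (fun y => dirDeriv y g y) _ y := hd.hasFDerivAt.clm_apply (hasFDerivAt_id y)
  rw [dirDeriv, this.fderiv]
  simp [dirDeriv]

/-- The divergence theorem for the field `η(1 - |y|²) (∇g - (y·∇g) y)` on the unit ball. -/
lemma integral_radial_divergence {η η' : ℝ → ℝ} (hη : ∀ σ, HasDerivAt η (η' σ) σ)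
    (hη' : Continuous η') (hη0 : ∀ σ ≤ 0, η σ = 0) {g : E → ℝ} (hg : ContDiff ℝ 2 g) :
    ∫ y, (η (1 - ‖y‖ ^ 2) * (dirLap basisVec g y - fderiv ℝ (fderiv ℝ g) y y y
        - (n + 1) * dirDeriv y g y)
      - 2 * ((1 - ‖y‖ ^ 2) * η' (1 - ‖y‖ ^ 2)) * dirDeriv y g y) = 0 := by
  set W : E → ℝ := fun y => η (1 - ‖y‖ ^ 2) with hW
  set R : E → ℝ := fun y => dirDeriv y g y with hR
  have hWc : ContDiff ℝ 1 W := contDiff_radial hη hη'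
  have hRc : ContDiff ℝ 1 R := contDiff_euler hg
  have hWs : HasCompactSupport W := by
    refine HasCompactSupport.intro (isCompact_closedBall (0 : E) 1) fun y hy => hη0 _ ?_
    rw [mem_closedBall_zero_iff, not_le] at hy
    nlinarith
  have hη's : ∀ σ < 0, η' σ = 0 := by
    intro σ hσ
    refine (hη σ).unique ((hasDerivAt_const σ (0 : ℝ)).congr_of_eventuallyEq ?_)
    filter_upwards [Iio_mem_nhds hσ] with s hs using hη0 s (le_of_lt hs)
  have hW' : Continuous fun y : E => η' (1 - ‖y‖ ^ 2) := hη'.comp (by fun_prop)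
  have hW's : HasCompactSupport fun y : E => η' (1 - ‖y‖ ^ 2) := by
    refine HasCompactSupport.intro (isCompact_closedBall (0 : E) 1) fun y hy => hη's _ ?_
    rw [mem_closedBall_zero_iff, not_le] at hy
    nlinarith
  have hgi : ∀ i, ContDiff ℝ 1 (dirDeriv (basisVec i) g) := fun i =>
    contDiff_dirDeriv (m := 1) hg _
  have hyi : ∀ i : Fin n, ContDiff ℝ 1 fun y : E => y i := fun i => by fun_prop
  have hdyi : ∀ (i : Fin n) (y : E), dirDeriv (basisVec i) (fun y : E => y i) y = 1 := by
    intro i y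
    have : HasFDerivAt (fun y : E => y i) (EuclideanSpace.proj i : E →L[ℝ] ℝ) y :=
      (EuclideanSpace.proj i : E →L[ℝ] ℝ).hasFDerivAt
    rw [dirDeriv, this.fderiv]
    simp
  have inner_basis : ∀ (i : Fin n) (y : E), inner ℝ y (basisVec i) = y i := by
    intro i y
    simp [EuclideanSpace.inner_single_right]
  have int1 : ∀ a : E → ℝ, Continuous a → Integrable fun y => W y * a y := fun a ha =>
    (hWc.continuous.mul ha).integrable_of_hasCompactSupport hWs.mul_right
  have int2 : ∀ a : E → ℝ, Continuous a → Integrable fun y => η' (1 - ‖y‖ ^ 2) * a y := fun a ha =>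
    (hW'.mul ha).integrable_of_hasCompactSupport hW's.mul_right
  have hlapc : Continuous (dirLap (basisVec (n := n)) g) :=
    (contDiff_dirLap (m := 0) hg _).continuous
  have hgc : Continuous fun y : E => fderiv ℝ (fderiv ℝ g) y y y := by
    have h1 : ContDiff ℝ 1 (fderiv ℝ g) := hg.fderiv_right (by norm_num)
    have := h1.continuous_fderiv one_ne_zero
    fun_prop
  -- the part of the field along the gradient
  have A : ∫ y, W y * dirLap basisVec g y = ∫ y, η' (1 - ‖y‖ ^ 2) * (2 * R y) := by
    have e1 : ∀ i, ∫ y, W y * dirDeriv (basisVec i) (dirDeriv (basisVec i) g) y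
        = ∫ y, η' (1 - ‖y‖ ^ 2) * (2 * (y i * dirDeriv (basisVec i) g y)) := by
      intro i
      rw [integral_mul_dirDeriv hWc hWs (hgi i), ← integral_neg]
      refine integral_congr_ae (ae_of_all _ fun y => ?_)
      simp only
      rw [hW, dirDeriv_radial hη, inner_basis]
      ring
    calc ∫ y, W y * dirLap basisVec g y
        = ∑ i, ∫ y, W y * dirDeriv (basisVec i) (dirDeriv (basisVec i) g) y := by
          rw [← integral_finsetSum]
          · simp only [dirLap, Finset.mul_sum]
          · exact fun i _ => int1 _ (continuous_dirDeriv (hgi i) _)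
      _ = _ := by
          rw [Finset.sum_congr rfl fun i _ => e1 i, ← integral_finsetSum]
          · refine integral_congr_ae (ae_of_all _ fun y => ?_)
            simp only
            rw [← Finset.mul_sum, ← Finset.mul_sum, sum_mul_dirDeriv_basisVec]
          · intro i _
            refine int2 _ ?_
            have := (hgi i).continuous
            have := (hyi i).continuous
            fun_prop
  -- the radial part of the field
  have B : ∫ y, W y * (R y + fderiv ℝ (fderiv ℝ g) y y y)
      = ∫ y, (η' (1 - ‖y‖ ^ 2) * (2 * (‖y‖ ^ 2 * R y)) - W y * (n * R y)) := by
    have e1 : ∀ i, ∫ y, (W y * y i) * dirDeriv (basisVec i) R y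
        = ∫ y, (η' (1 - ‖y‖ ^ 2) * (2 * ((y i * y i) * R y)) - W y * R y) := by
      intro i
      rw [integral_mul_dirDeriv (hWc.mul (hyi i)) hWs.mul_right hRc, ← integral_neg]
      refine integral_congr_ae (ae_of_all _ fun y => ?_)
      simp only
      rw [dirDeriv_mul (hWc.differentiable one_ne_zero _) ((hyi i).differentiable one_ne_zero _),
        hdyi, hW, dirDeriv_radial hη, inner_basis]
      ring
    calc ∫ y, W y * (R y + fderiv ℝ (fderiv ℝ g) y y y)
        = ∑ i, ∫ y, (W y * y i) * dirDeriv (basisVec i) R y := by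
          rw [← integral_finsetSum]
          · refine integral_congr_ae (ae_of_all _ fun y => ?_)
            simp only [mul_assoc]
            rw [← Finset.mul_sum, sum_mul_dirDeriv_basisVec, hR, dirDeriv_euler hg]
          · intro i _
            simp only [mul_assoc]
            refine int1 _ ?_
            have := continuous_dirDeriv hRc (basisVec i)
            have := (hyi i).continuous
            fun_prop
      _ = _ := by
          rw [Finset.sum_congr rfl fun i _ => e1 i, ← integral_finsetSum]
          · refine integral_congr_ae (ae_of_all _ fun y => ?_)
            simp only
            rw [Finset.sum_sub_distrib, ← Finset.mul_sum, ← Finset.mul_sum, ← Finset.sum_mul,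
              EuclideanSpace.norm_sq_eq]
            simp [pow_two]
            ring
          · intro i _
            have h1 := hRc.continuous
            have h2 := (hyi i).continuous
            exact (int2 _ (by fun_prop)).sub (int1 _ h1)
  have hRk := hRc.continuous
  have I1 := int1 _ hlapc
  have I2 := int1 _ (hRk.fun_add hgc)
  have I3 := int2 (fun y => 2 * R y) (by fun_prop)
  have I4 := int2 (fun y => 2 * (‖y‖ ^ 2 * R y)) (by fun_prop)
  have I5 := int1 (fun y => n * R y) (by fun_prop)
  have key : ∀ y, (W y * (dirLap basisVec g y - fderiv ℝ (fderiv ℝ g) y y y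
        - (n + 1) * R y) - 2 * ((1 - ‖y‖ ^ 2) * η' (1 - ‖y‖ ^ 2)) * R y)
      = (W y * dirLap basisVec g y - W y * (R y + fderiv ℝ (fderiv ℝ g) y y y))
        - (η' (1 - ‖y‖ ^ 2) * (2 * R y)
          - (η' (1 - ‖y‖ ^ 2) * (2 * (‖y‖ ^ 2 * R y)) - W y * (n * R y))) := by
    intro y; ring
  rw [integral_congr_ae (ae_of_all _ key), integral_sub (I1.sub' I2) (I3.sub' (I4.sub' I5)),
    integral_sub I1 I2, integral_sub I3 (I4.sub' I5), A, B]
  ring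

/-- The weighted mean over the unit ball annihilates the operator
`Δg - D²g(y,y) - n y·∇g`, the Laplacian of the unit sphere of `ℝⁿ⁺¹` in the projected
coordinates `y`. -/
lemma integral_descentWeight_mul (hn : 0 < n) {g : E → ℝ} (hg : ContDiff ℝ 2 g) :
    ∫ y, descentWeight y * (dirLap basisVec g y - fderiv ℝ (fderiv ℝ g) y y y
        - n * dirDeriv y g y) = 0 := by
  have hlapc : Continuous (dirLap (basisVec (n := n)) g) :=
    (contDiff_dirLap (m := 0) hg _).continuous
  have hgc : Continuous fun y : E => fderiv ℝ (fderiv ℝ g) y y y := by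
    have h1 : ContDiff ℝ 1 (fderiv ℝ g) := hg.fderiv_right (by norm_num)
    have := h1.continuous_fderiv one_ne_zero
    fun_prop
  have hRk : Continuous fun y : E => dirDeriv y g y := (contDiff_euler hg).continuous
  set A : E → ℝ := fun y => dirLap basisVec g y - fderiv ℝ (fderiv ℝ g) y y y
        - (n + 1) * dirDeriv y g y with hA
  have hAc : Continuous A := by fun_prop
  set R : E → ℝ := fun y => dirDeriv y g y with hR
  have hi : ∀ a : E → ℝ, Continuous a → Integrable fun y => descentWeight y * a y := fun a ha =>
    integrable_weighted (integrable_descentWeight hn) (isCompact_closedBall (0 : E) 1)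
      (ae_of_all _ fun y => descentWeight_ne_zero) ha
  -- In the limit `σ η'(σ)` becomes `-η(σ)/2` for `η(σ) = σ^{-1/2}`, which turns `n + 1` into `n`.
  have hlim := tendsto_integral_of_dominated_convergence
    (μ := (volume : Measure E))
    (F := fun (j : ℕ) y => approxWeight (1 / ((j : ℝ) + 1)) (1 - ‖y‖ ^ 2) * A y
      - 2 * ((1 - ‖y‖ ^ 2) * approxWeightDeriv (1 / ((j : ℝ) + 1)) (1 - ‖y‖ ^ 2)) * R y)
    (f := fun y => descentWeight y * A y - 2 * (-(1 / 2) * descentWeight y) * R y)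
    (bound := fun y => descentWeight y * |A y| + 10 * (descentWeight y * |R y|))
    (fun j => by
      have hε : (0 : ℝ) < 1 / ((j : ℝ) + 1) := by positivity
      have h1 : Continuous (approxWeight (1 / ((j : ℝ) + 1))) :=
        continuous_iff_continuousAt.2 fun σ => (hasDerivAt_approxWeight hε σ).continuousAt
      have h2 := continuous_approxWeightDeriv hε
      exact Continuous.aestronglyMeasurable (by fun_prop))
    ((hi _ hAc.abs).add ((hi _ hRk.abs).const_mul 10))
    (fun j => ae_of_all _ fun y => by
      have hε : (0 : ℝ) < 1 / ((j : ℝ) + 1) := by positivity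
      have h1 := approxWeight_bound hε (1 - ‖y‖ ^ 2)
      have h2 := mul_approxWeightDeriv_bound hε (1 - ‖y‖ ^ 2)
      rw [Real.norm_eq_abs]
      refine (abs_sub _ _).trans ?_
      rw [abs_mul, abs_mul, abs_mul]
      have h3 := mul_le_mul_of_nonneg_right h1 (abs_nonneg (A y))
      have h4 := mul_le_mul_of_nonneg_right h2 (abs_nonneg (R y))
      simp only [descentWeight]
      rw [abs_of_pos (two_pos : (0 : ℝ) < 2)]
      linarith)
    (ae_of_all _ fun y => by
      have h1 := approxWeight_tendsto (1 - ‖y‖ ^ 2)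
      have h2 := mul_approxWeightDeriv_tendsto (1 - ‖y‖ ^ 2)
      exact (h1.mul_const _).sub ((h2.const_mul 2).mul_const _))
  have hz : ∀ j : ℕ, ∫ y, (approxWeight (1 / ((j : ℝ) + 1)) (1 - ‖y‖ ^ 2) * A y
      - 2 * ((1 - ‖y‖ ^ 2) * approxWeightDeriv (1 / ((j : ℝ) + 1)) (1 - ‖y‖ ^ 2)) * R y) = 0 := by
    intro j
    have hε : (0 : ℝ) < 1 / ((j : ℝ) + 1) := by positivity
    exact integral_radial_divergence (hasDerivAt_approxWeight hε) (continuous_approxWeightDeriv hε)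
      (fun σ hσ => approxWeight_of_nonpos hσ) hg
  simp only [hz] at hlim
  have := tendsto_nhds_unique hlim tendsto_const_nhds
  rw [← this]
  refine integral_congr_ae (ae_of_all _ fun y => ?_)
  simp only [hA, hR]
  ring

end IntegrationByParts

/-! ### Weighted ball means -/

section BallMeans

variable {n : ℕ}

local notation "E" => EuclideanSpace ℝ (Fin n)

/-- The direction of the time variable in the space of points `(β, t, x)`. -/
noncomputable abbrev timeDir : ℝ × ℝ × E := (0, 1, 0)

/-- The directions of the space variables in the space of points `(β, t, x)`. -/
noncomputable abbrev spaceDir (i : Fin n) : ℝ × ℝ × E := (0, 0, basisVec i)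

/-- The mean of `φ(β, x + t y)` over `|y| < 1` with weight `(1 - |y|²)^{-1/2}`, as a function of
`(β, t, x)`; here `β` is an additional parameter. -/
noncomputable def descentMean (φ : ℝ × E → ℝ) (p : ℝ × ℝ × E) : ℝ :=
  (volume (Metric.ball (0 : E) 1)).toReal⁻¹ *
    ∫ y, descentWeight y * φ (p.1, p.2.2 + p.2.1 • y)

lemma contDiff_descentMean (hn : 0 < n) {m : ℕ} {φ : ℝ × E → ℝ} (hφ : ContDiff ℝ m φ) :
    ContDiff ℝ m (descentMean φ) := by
  unfold descentMean
  refine contDiff_const.mul ?_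
  exact contDiff_weighted_integral (integrable_descentWeight hn)
    (isCompact_closedBall (0 : E) 1) (ae_of_all _ fun y => descentWeight_ne_zero) m
    (h := fun z : (ℝ × ℝ × E) × E => φ (z.1.1, z.1.2.2 + z.1.2.1 • z.2)) (by fun_prop)

/-- The linear map `(β, t, x) ↦ (β, x + t y)`. -/
noncomputable def rayMap (y : E) : ℝ × ℝ × E →L[ℝ] ℝ × E :=
  (ContinuousLinearMap.fst ℝ ℝ (ℝ × E)).prod
    (((ContinuousLinearMap.snd ℝ ℝ E).comp (ContinuousLinearMap.snd ℝ ℝ (ℝ × E)))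
      + ((ContinuousLinearMap.fst ℝ ℝ E).comp (ContinuousLinearMap.snd ℝ ℝ (ℝ × E))).smulRight y)

@[simp] lemma rayMap_apply (y : E) (p : ℝ × ℝ × E) :
    rayMap y p = (p.1, p.2.2 + p.2.1 • y) := by
  simp [rayMap]

lemma dirDeriv_descentMean (hn : 0 < n) {φ : ℝ × E → ℝ} (hφ : ContDiff ℝ 1 φ)
    (v p : ℝ × ℝ × E) :
    dirDeriv v (descentMean φ) p = (volume (Metric.ball (0 : E) 1)).toReal⁻¹ *
      ∫ y, descentWeight y * dirDeriv (rayMap y v) φ (rayMap y p) := by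
  have hh : ContDiff ℝ 1 (fun z : (ℝ × ℝ × E) × E => φ (z.1.1, z.1.2.2 + z.1.2.1 • z.2)) := by
    fun_prop
  have h1 := dirDeriv_weighted_integral (integrable_descentWeight hn)
    (isCompact_closedBall (0 : E) 1) (ae_of_all _ fun y => descentWeight_ne_zero) hh v p
  have hd := (contDiff_weighted_integral (integrable_descentWeight hn)
    (isCompact_closedBall (0 : E) 1) (ae_of_all _ fun y => descentWeight_ne_zero) 1
    hh).differentiable (by simp) p
  unfold descentMean
  simp only [smul_eq_mul] at hd
  rw [dirDeriv_const_mul hd, h1]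
  congr 1
  refine integral_congr_ae (ae_of_all _ fun y => ?_)
  simp only
  congr 1
  have h2 := (hasFDerivAt_slice (hh.differentiable one_ne_zero) p y).fderiv
  have h3 := dirDeriv_comp_affine (f := φ) (rayMap y) 0 (p := p)
    (hφ.differentiable one_ne_zero _) v
  simp only [zero_add] at h3
  rw [← h3]
  simp only [dirDeriv, rayMap_apply]
  rw [h2]
  simp

lemma dirDeriv_dirDeriv_descentMean (hn : 0 < n) {φ : ℝ × E → ℝ} (hφ : ContDiff ℝ 2 φ)
    (v p : ℝ × ℝ × E) :
    dirDeriv v (dirDeriv v (descentMean φ)) p = (volume (Metric.ball (0 : E) 1)).toReal⁻¹ *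
      ∫ y, descentWeight y * dirDeriv (rayMap y v) (dirDeriv (rayMap y v) φ) (rayMap y p) := by
  have hf1 : ContDiff ℝ 1 (fderiv ℝ φ) := hφ.fderiv_right (by norm_num)
  have hh : ContDiff ℝ 1 (fun z : (ℝ × ℝ × E) × E =>
      fderiv ℝ φ (z.1.1, z.1.2.2 + z.1.2.1 • z.2) (v.1, v.2.2 + v.2.1 • z.2)) := by
    fun_prop
  have e : dirDeriv v (descentMean φ) = fun p => (volume (Metric.ball (0 : E) 1)).toReal⁻¹ *
      ∫ y, descentWeight y * fderiv ℝ φ (p.1, p.2.2 + p.2.1 • y) (v.1, v.2.2 + v.2.1 • y) := by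
    funext p
    rw [dirDeriv_descentMean hn (hφ.of_le (by norm_num))]
    simp [dirDeriv]
  have h1 := dirDeriv_weighted_integral (integrable_descentWeight hn)
    (isCompact_closedBall (0 : E) 1) (ae_of_all _ fun y => descentWeight_ne_zero) hh v p
  have hd := (contDiff_weighted_integral (integrable_descentWeight hn)
    (isCompact_closedBall (0 : E) 1) (ae_of_all _ fun y => descentWeight_ne_zero) 1
    hh).differentiable (by simp) p
  rw [e]
  simp only [smul_eq_mul] at hd
  rw [dirDeriv_const_mul hd, h1]
  congr 1
  refine integral_congr_ae (ae_of_all _ fun y => ?_)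
  simp only
  congr 1
  have h2 := (hasFDerivAt_slice (hh.differentiable one_ne_zero) p y).fderiv
  have h3 := dirDeriv_comp_affine (f := dirDeriv (rayMap y v) φ) (rayMap y) 0 (p := p)
    ((contDiff_dirDeriv (m := 1) hφ _).differentiable one_ne_zero _) v
  simp only [zero_add] at h3
  rw [← h3]
  simp only [dirDeriv, rayMap_apply]
  rw [h2]
  simp

/-- The Euler–Poisson–Darboux equation for the weighted ball means. -/
lemma descentMean_epd (hn : 0 < n) {φ : ℝ × E → ℝ} (hφ : ContDiff ℝ 2 φ) (p : ℝ × ℝ × E) :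
    p.2.1 * (dirDeriv timeDir (dirDeriv timeDir (descentMean φ)) p
        - dirLap spaceDir (descentMean φ) p)
      + n * dirDeriv timeDir (descentMean φ) p = 0 := by
  have hM : ContDiff ℝ 2 (descentMean φ) := contDiff_descentMean hn (m := 2) hφ
  have hi : ∀ a : E → ℝ, Continuous a → Integrable fun y => descentWeight y * a y := fun a ha =>
    integrable_weighted (integrable_descentWeight hn) (isCompact_closedBall (0 : E) 1)
      (ae_of_all _ fun y => descentWeight_ne_zero) ha
  -- for `t ≠ 0` the equation is the identity for the weighted mean of `y ↦ φ(β, x + t y)`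
  have main : ∀ p : ℝ × ℝ × E, p.2.1 ≠ 0 →
      p.2.1 * (dirDeriv timeDir (dirDeriv timeDir (descentMean φ)) p
        - dirLap spaceDir (descentMean φ) p)
      + n * dirDeriv timeDir (descentMean φ) p = 0 := by
    rintro ⟨β, t, x⟩ ht
    simp only at ht ⊢
    set L : E →L[ℝ] ℝ × E := t • (ContinuousLinearMap.inr ℝ ℝ E) with hL
    have hLv : ∀ v, L v = t • (0, v) := by intro v; simp [hL]
    set g : E → ℝ := fun y => φ ((β, x) + L y) with hg
    have hgc : ContDiff ℝ 2 g := by fun_prop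
    have hpt : ∀ y, (β, x) + L y = rayMap y (β, t, x) := by intro y; simp [hL]
    have g1 : ∀ v y, dirDeriv v g y = t * dirDeriv (0, v) φ (rayMap y (β, t, x)) := by
      intro v y
      rw [hg, dirDeriv_comp_affine L _ (hφ.differentiable two_ne_zero _), hLv, dirDeriv_smul_dir,
        hpt]
    have g2 : ∀ v y, dirDeriv v (dirDeriv v g) y
        = t * (t * dirDeriv (0, v) (dirDeriv (0, v) φ) (rayMap y (β, t, x))) := by
      intro v y
      have e : dirDeriv v g = fun y => t * dirDeriv (0, v) φ ((β, x) + L y) := by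
        funext y; rw [g1, hpt]
      have hd : Differentiable ℝ (dirDeriv (0, v) φ) :=
        (contDiff_dirDeriv (m := 1) hφ _).differentiable one_ne_zero
      rw [e, dirDeriv_const_mul (by fun_prop), dirDeriv_comp_affine L _ (hd _), hLv,
        dirDeriv_smul_dir, hpt]
    have hf1 : ContDiff ℝ 1 (fderiv ℝ φ) := hφ.fderiv_right (by norm_num)
    have hf2 := hf1.continuous_fderiv one_ne_zero
    have hf0 := hf1.continuous
    have T1 : dirDeriv timeDir (descentMean φ) (β, t, x) = (volume (Metric.ball (0 : E) 1)).toReal⁻¹ *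
        ∫ y, descentWeight y * dirDeriv (0, y) φ (rayMap y (β, t, x)) := by
      rw [dirDeriv_descentMean hn (hφ.of_le (by norm_num))]
      simp
    have T2 : dirDeriv timeDir (dirDeriv timeDir (descentMean φ)) (β, t, x)
        = (volume (Metric.ball (0 : E) 1)).toReal⁻¹ *
        ∫ y, descentWeight y * dirDeriv (0, y) (dirDeriv (0, y) φ) (rayMap y (β, t, x)) := by
      rw [dirDeriv_dirDeriv_descentMean hn hφ]
      simp
    have c2 : ∀ v w : E → ℝ × E, Continuous v → Continuous w → Continuous fun y =>
        fderiv ℝ (fderiv ℝ φ) (rayMap y (β, t, x)) (v y) (w y) := by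
      intro v w hv hw
      simp only [rayMap_apply]
      fun_prop
    have T3 : dirLap spaceDir (descentMean φ) (β, t, x)
        = (volume (Metric.ball (0 : E) 1)).toReal⁻¹ *
        ∫ y, descentWeight y * dirLap (fun i => (0, basisVec i)) φ (rayMap y (β, t, x)) := by
      unfold dirLap
      simp only [Finset.mul_sum]
      rw [integral_finsetSum, Finset.mul_sum]
      · refine Finset.sum_congr rfl fun i _ => ?_
        rw [dirDeriv_dirDeriv_descentMean hn hφ]
        simp
      · intro i _
        refine hi _ ?_
        simp only [dirDeriv_dirDeriv_eq hφ]
        exact c2 _ _ continuous_const continuous_const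
    have key := integral_descentWeight_mul hn hgc
    have e : ∀ y, dirLap basisVec g y - fderiv ℝ (fderiv ℝ g) y y y - n * dirDeriv y g y
        = t * (t * dirLap (fun i => (0, basisVec i)) φ (rayMap y (β, t, x))
          - t * dirDeriv (0, y) (dirDeriv (0, y) φ) (rayMap y (β, t, x))
          - n * dirDeriv (0, y) φ (rayMap y (β, t, x))) := by
      intro y
      rw [← dirDeriv_dirDeriv_eq hgc, g2, g1]
      unfold dirLap
      simp only [g2, ← Finset.mul_sum]
      ring
    simp only [e] at key
    have J1 := hi (fun y => dirLap (fun i => (0, basisVec i)) φ (rayMap y (β, t, x))) (by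
      unfold dirLap
      simp only [dirDeriv_dirDeriv_eq hφ]
      exact continuous_finsetSum _ fun i _ => c2 _ _ continuous_const continuous_const)
    have J2 := hi (fun y => dirDeriv (0, y) (dirDeriv (0, y) φ) (rayMap y (β, t, x))) (by
      simp only [dirDeriv_dirDeriv_eq hφ]
      exact c2 _ _ (by fun_prop) (by fun_prop))
    have J3 := hi (fun y => dirDeriv (0, y) φ (rayMap y (β, t, x))) (by
      simp only [dirDeriv, rayMap_apply]
      fun_prop)
    have e2 : ∀ y : E, descentWeight y * (t * (t * dirLap (fun i => (0, basisVec i)) φ (rayMap y (β, t, x))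
          - t * dirDeriv (0, y) (dirDeriv (0, y) φ) (rayMap y (β, t, x))
          - n * dirDeriv (0, y) φ (rayMap y (β, t, x))))
        = t * (t * (descentWeight y * dirLap (fun i => (0, basisVec i)) φ (rayMap y (β, t, x)))
          - t * (descentWeight y * dirDeriv (0, y) (dirDeriv (0, y) φ) (rayMap y (β, t, x)))
          - n * (descentWeight y * dirDeriv (0, y) φ (rayMap y (β, t, x)))) := by
      intro y; ring
    simp only [e2] at key
    rw [integral_const_mul, integral_sub ((J1.const_mul t).sub' (J2.const_mul t)) (J3.const_mul _),
      integral_sub (J1.const_mul t) (J2.const_mul t), integral_const_mul, integral_const_mul,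
      integral_const_mul] at key
    have key' := (mul_eq_zero.1 key).resolve_left ht
    rw [T1, T2, T3]
    linear_combination (-(volume (Metric.ball (0 : E) 1)).toReal⁻¹) * key'
  -- for `t = 0` it follows by continuity
  obtain ⟨β, t, x⟩ := p
  have hcont : Continuous fun t : ℝ =>
      t * (dirDeriv timeDir (dirDeriv timeDir (descentMean φ)) (β, t, x)
        - dirLap spaceDir (descentMean φ) (β, t, x))
      + n * dirDeriv timeDir (descentMean φ) (β, t, x) := by
    have c1 : Continuous (dirDeriv timeDir (descentMean φ)) :=
      continuous_dirDeriv (hM.of_le (by norm_num)) _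
    have c2 : Continuous (dirDeriv timeDir (dirDeriv timeDir (descentMean φ))) :=
      continuous_dirDeriv (contDiff_dirDeriv (m := 1) hM _) _
    have c3 : Continuous (dirLap spaceDir (descentMean φ)) :=
      (contDiff_dirLap (m := 0) hM _).continuous
    fun_prop
  have := Continuous.ext_on (dense_compl_singleton (0 : ℝ)) hcont continuous_const
    (fun t ht => main (β, t, x) ht)
  exact congrFun this t

end BallMeans

/-! ### The Euler–Poisson–Darboux equation and the wave equation -/

section EulerPoissonDarboux

variable {n : ℕ}

local notation "E" => EuclideanSpace ℝ (Fin n)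

lemma contDiff_timeCoord {m : WithTop ℕ∞} : ContDiff ℝ m (fun p : ℝ × ℝ × E => p.2.1) := by
  fun_prop

lemma dirDeriv_timeCoord (v p : ℝ × ℝ × E) :
    dirDeriv v (fun p : ℝ × ℝ × E => p.2.1) p = v.2.1 := by
  have : HasFDerivAt (fun p : ℝ × ℝ × E => p.2.1)
      ((ContinuousLinearMap.fst ℝ ℝ E).comp (ContinuousLinearMap.snd ℝ ℝ (ℝ × E))) p :=
    ((ContinuousLinearMap.fst ℝ ℝ E).comp (ContinuousLinearMap.snd ℝ ℝ (ℝ × E))).hasFDerivAt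
  rw [dirDeriv, this.fderiv]
  simp

lemma dirDeriv_time_mul {f : ℝ × ℝ × E → ℝ} (hf : Differentiable ℝ f) (p : ℝ × ℝ × E) :
    dirDeriv timeDir (fun p => p.2.1 * f p) p = f p + p.2.1 * dirDeriv timeDir f p := by
  rw [dirDeriv_mul (by fun_prop) (hf p), dirDeriv_timeCoord, one_mul]

lemma dirLap_time_mul {f : ℝ × ℝ × E → ℝ} (hf : ContDiff ℝ 2 f) (p : ℝ × ℝ × E) :
    dirLap spaceDir (fun p => p.2.1 * f p) p = p.2.1 * dirLap spaceDir f p :=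
  dirLap_mul_of_const contDiff_timeCoord hf _ (fun _ _ => dirDeriv_timeCoord _ _) p

/-- The Euler–Poisson–Darboux equation `t (P_tt - Δ P) + a P_t = 0`. -/
def SatisfiesEPD (a : ℝ) (P : ℝ × ℝ × E → ℝ) : Prop :=
  ∀ p, p.2.1 * (dirDeriv timeDir (dirDeriv timeDir P) p - dirLap spaceDir P p)
    + a * dirDeriv timeDir P p = 0

/-- The operator `P ↦ (a - 1) P + t P_t` lowers the parameter of the Euler–Poisson–Darboux
equation by two, and turns the time derivative into `t Δ P`. -/
lemma SatisfiesEPD.lower {a : ℝ} {P : ℝ × ℝ × E → ℝ} (hP : ContDiff ℝ 3 P)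
    (h : SatisfiesEPD a P) :
    SatisfiesEPD (a - 2) (fun p => (a - 1) * P p + p.2.1 * dirDeriv timeDir P p) := by
  have hP1 : ContDiff ℝ 2 (dirDeriv timeDir P) := contDiff_dirDeriv (m := 2) hP _
  have hP2 : ContDiff ℝ 1 (dirDeriv timeDir (dirDeriv timeDir P)) :=
    contDiff_dirDeriv (m := 1) hP1 _
  have hL : ContDiff ℝ 1 (dirLap spaceDir P) := contDiff_dirLap (m := 1) hP _
  have hPd := hP.differentiable (by norm_num)
  have hPd1 := hP1.differentiable (by norm_num)
  have hQt : dirDeriv timeDir (fun p => (a - 1) * P p + p.2.1 * dirDeriv timeDir P p)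
      = fun p => p.2.1 * dirLap spaceDir P p := by
    funext p
    rw [dirDeriv_add (by fun_prop) (by fun_prop), dirDeriv_const_mul (hPd p),
      dirDeriv_time_mul hPd1]
    -- `∂_t ((a - 1) P + t P_t) = a P_t + t P_tt`
    linear_combination h p
  intro p
  rw [hQt, dirDeriv_time_mul (hL.differentiable one_ne_zero),
    dirLap_add (contDiff_const.mul (hP.of_le (by norm_num))) (contDiff_timeCoord.mul hP1),
    dirLap_mul_of_const contDiff_const (hP.of_le (by norm_num)) _
      (fun i p => by simp [dirDeriv]),
    dirLap_time_mul hP1, dirDeriv_dirLap hP]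
  ring

/-- The functions `P_j` with `((1/t) ∂_t)^j (t^{2k-1} M) = t^{2k-1-2j} P_j`, where `M` is the
weighted ball mean of `φ`. -/
noncomputable def waveSeq (k : ℕ) (φ : ℝ × E → ℝ) : ℕ → ℝ × ℝ × E → ℝ
  | 0 => descentMean φ
  | j + 1 => fun p => (2 * k - 2 * j - 1) * waveSeq k φ j p
      + p.2.1 * dirDeriv timeDir (waveSeq k φ j) p

lemma contDiff_waveSeq (hn : 0 < n) (k : ℕ) {φ : ℝ × E → ℝ} (j : ℕ) :
    ∀ {m : ℕ}, ContDiff ℝ ((m + j : ℕ) : WithTop ℕ∞) φ → ContDiff ℝ m (waveSeq k φ j) := by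
  induction j with
  | zero => exact fun h => contDiff_descentMean hn h
  | succ j ih =>
    intro m h
    have h1 : ContDiff ℝ ((m + 1 : ℕ) : WithTop ℕ∞) (waveSeq k φ j) :=
      ih (by rwa [add_right_comm])
    have h2 := contDiff_dirDeriv h1 timeDir
    have h3 : ContDiff ℝ m (waveSeq k φ j) := h1.of_le (by exact_mod_cast Nat.le_succ m)
    exact (contDiff_const.mul h3).add (contDiff_timeCoord.mul h2)

/-- Each step lowers the parameter of the Euler–Poisson–Darboux equation by two, starting
from `n = 2k`. -/
lemma waveSeq_epd {k : ℕ} (hk : 0 < k) (hn : n = 2 * k) {φ : ℝ × E → ℝ} (j : ℕ)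
    (hφ : ContDiff ℝ ((2 + j : ℕ) : WithTop ℕ∞) φ) :
    SatisfiesEPD (2 * k - 2 * j) (waveSeq k φ j) := by
  have hn0 : 0 < n := by omega
  induction j with
  | zero =>
    intro p
    have := descentMean_epd hn0 (φ := φ) (by simpa using hφ) p
    have hc : (n : ℝ) = 2 * k := by exact_mod_cast hn
    simpa [waveSeq, hc] using this
  | succ j ih =>
    have h1 : ContDiff ℝ 3 (waveSeq k φ j) := contDiff_waveSeq hn0 k j (m := 3) (by
      convert hφ using 2; ring)
    have := (ih (hφ.of_le (by exact_mod_cast Nat.le_succ (2 + j)))).lower h1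
    have e : (2 * (k : ℝ) - 2 * ((j + 1 : ℕ) : ℝ)) = 2 * k - 2 * j - 2 := by push_cast; ring
    rw [e]
    exact this

/-- The solution `V` of `V_tt = ΔV`, `V(0) = 0`, `V_t(0) = φ` in dimension `n = 2k`. -/
noncomputable def waveSol (k : ℕ) (φ : ℝ × E → ℝ) : ℝ × ℝ × E → ℝ :=
  fun p => (Nat.doubleFactorial n : ℝ)⁻¹ * (p.2.1 * waveSeq k φ (k - 1) p)

variable {k : ℕ}

lemma contDiff_waveSol (hk : 0 < k) (hn : n = 2 * k) {φ : ℝ × E → ℝ} {m : ℕ}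
    (hφ : ContDiff ℝ ((m + (k - 1) : ℕ) : WithTop ℕ∞) φ) : ContDiff ℝ m (waveSol k φ) :=
  contDiff_const.mul (contDiff_timeCoord.mul (contDiff_waveSeq (by omega) k _ hφ))

lemma dirDeriv_waveSol (hk : 0 < k) (hn : n = 2 * k) {φ : ℝ × E → ℝ}
    (hφ : ContDiff ℝ (k : WithTop ℕ∞) φ) (p : ℝ × ℝ × E) :
    dirDeriv timeDir (waveSol k φ) p = (Nat.doubleFactorial n : ℝ)⁻¹ * waveSeq k φ k p := by
  have h1 : ContDiff ℝ ((1 : ℕ) : WithTop ℕ∞) (waveSeq k φ (k - 1)) :=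
    contDiff_waveSeq (by omega) k _ (by rwa [Nat.add_sub_cancel' hk])
  have hd := h1.differentiable (by simp)
  unfold waveSol
  rw [dirDeriv_const_mul (by fun_prop), dirDeriv_time_mul hd]
  congr 1
  obtain ⟨k, rfl⟩ : ∃ k', k = k' + 1 := ⟨k - 1, by omega⟩
  simp only [Nat.add_sub_cancel]
  rw [waveSeq]
  push_cast
  ring

lemma waveSol_zero (k : ℕ) (φ : ℝ × E → ℝ) (β : ℝ) (x : E) : waveSol k φ (β, 0, x) = 0 := by
  simp [waveSol]

/-- The function `P_{k-1}` satisfies the Euler–Poisson–Darboux equation with parameter `2`, which is the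
wave equation for `t P_{k-1}`. -/
lemma waveSol_wave (hk : 0 < k) (hn : n = 2 * k) {φ : ℝ × E → ℝ}
    (hφ : ContDiff ℝ ((k + 1 : ℕ) : WithTop ℕ∞) φ) (p : ℝ × ℝ × E) :
    dirDeriv timeDir (dirDeriv timeDir (waveSol k φ)) p = dirLap spaceDir (waveSol k φ) p := by
  have hφ' : ContDiff ℝ ((2 + (k - 1) : ℕ) : WithTop ℕ∞) φ := by
    convert hφ using 2; omega
  set P := waveSeq k φ (k - 1) with hP
  have hPc : ContDiff ℝ 2 P := contDiff_waveSeq (by omega) k _ (m := 2) hφ'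
  have hPc1 : ContDiff ℝ 1 (dirDeriv timeDir P) := contDiff_dirDeriv (m := 1) hPc _
  have hd := hPc.differentiable two_ne_zero
  have hd1 := hPc1.differentiable one_ne_zero
  have h := waveSeq_epd hk hn (k - 1) hφ' p
  rw [← hP, Nat.cast_sub hk, Nat.cast_one] at h
  have e1 : dirDeriv timeDir (waveSol k φ) = fun p => (Nat.doubleFactorial n : ℝ)⁻¹ *
      (P p + p.2.1 * dirDeriv timeDir P p) := by
    funext p
    exact (dirDeriv_const_mul ((by fun_prop : Differentiable ℝ fun p : ℝ × ℝ × E => p.2.1 * P p) p)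
      _ _).trans (congrArg _ (dirDeriv_time_mul hd p))
  rw [e1, dirDeriv_const_mul (by fun_prop), dirDeriv_add (by fun_prop) (by fun_prop),
    dirDeriv_time_mul hd1]
  unfold waveSol
  rw [dirLap_mul_of_const contDiff_const (contDiff_timeCoord.mul hPc) _
      (fun i p => by simp [dirDeriv]), dirLap_time_mul hPc]
  linear_combination (Nat.doubleFactorial n : ℝ)⁻¹ * h

/-- At `t = 0` the functions `P_j` are multiples of `φ`. The factor `(2(k - j) - 1)‼` on the left avoids a
division; the double factorial is `1` for `j = k`, where the truncated subtraction gives `0‼`. -/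
lemma waveSeq_initial (hk : 0 < k) (hn : n = 2 * k) (φ : ℝ × E → ℝ) (β : ℝ) (x : E) (j : ℕ)
    (hj : j ≤ k) : waveSeq k φ j (β, 0, x) * (2 * (k - j) - 1).doubleFactorial
      = Nat.doubleFactorial n * φ (β, x) := by
  induction j with
  | zero =>
    have h := integral_descentWeight (n := n) (k := k - 1) (by omega)
    have h0 : ((n - 1).doubleFactorial : ℝ) ≠ 0 := by
      exact_mod_cast (Nat.doubleFactorial_pos _).ne'
    simp only [waveSeq, descentMean, zero_smul, add_zero, integral_mul_const, Nat.sub_zero]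
    rw [← mul_assoc, h, ← hn]
    field_simp
  | succ j ih =>
    rw [← ih (by omega)]
    simp only [waveSeq, zero_mul, add_zero]
    have e : ((2 * (k - j) - 1).doubleFactorial : ℝ)
        = (2 * k - 2 * j - 1) * (2 * (k - (j + 1)) - 1).doubleFactorial := by
      obtain ⟨d, rfl⟩ : ∃ d, k = j + 1 + d := ⟨k - (j + 1), by omega⟩
      rw [show 2 * (j + 1 + d - j) - 1 = 2 * d + 1 by omega,
        show 2 * (j + 1 + d - (j + 1)) - 1 = 2 * d - 1 by omega]
      cases d with
      | zero => simp [Nat.doubleFactorial]; ring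
      | succ d =>
        rw [show 2 * (d + 1) + 1 = 2 * d + 1 + 2 by ring, Nat.doubleFactorial_add_two,
          show 2 * (d + 1) - 1 = 2 * d + 1 by omega]
        push_cast
        ring
    rw [e]
    ring

lemma dirDeriv_waveSol_zero (hk : 0 < k) (hn : n = 2 * k) {φ : ℝ × E → ℝ}
    (hφ : ContDiff ℝ (k : WithTop ℕ∞) φ) (β : ℝ) (x : E) :
    dirDeriv timeDir (waveSol k φ) (β, 0, x) = φ (β, x) := by
  have h := waveSeq_initial hk hn φ β x k le_rfl
  have h0 : (n.doubleFactorial : ℝ) ≠ 0 := by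
    exact_mod_cast (Nat.doubleFactorial_pos _).ne'
  simp only [Nat.sub_self, mul_zero, Nat.zero_sub, Nat.doubleFactorial, Nat.cast_one,
    mul_one] at h
  rw [dirDeriv_waveSol hk hn hφ, h]
  field_simp

end EulerPoissonDarboux

/-! ### The operator `w` as the velocity of a wave -/

section EvenWaveOp

variable {n k : ℕ}

local notation "E" => EuclideanSpace ℝ (Fin n)

lemma div_sqrt_eq_descentWeight (φ : E → ℝ) (x : E) {t : ℝ} (ht : 0 < t) (z : E) :
    φ z / √(t ^ 2 - ‖z - x‖ ^ 2)
      = t⁻¹ * (descentWeight (t⁻¹ • (z - x)) * φ (x + t • (t⁻¹ • (z - x)))) := by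
  have e : t ^ 2 - ‖z - x‖ ^ 2 = t ^ 2 * (1 - ‖t⁻¹ • (z - x)‖ ^ 2) := by
    rw [norm_smul, norm_inv, Real.norm_of_nonneg ht.le]
    field_simp
  rw [e, Real.sqrt_mul (by positivity), Real.sqrt_sq ht.le, smul_inv_smul₀ ht.ne',
    add_sub_cancel, descentWeight]
  ring

lemma integrable_div_sqrt (hn : 0 < n) {φ : E → ℝ} (hφ : Continuous φ) (x : E) {t : ℝ}
    (ht : 0 < t) : Integrable fun z => φ z / √(t ^ 2 - ‖z - x‖ ^ 2) := by
  simp only [div_sqrt_eq_descentWeight φ x ht]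
  have h1 := integrable_weighted (integrable_descentWeight hn) (isCompact_closedBall (0 : E) 1)
      (ae_of_all _ fun y => descentWeight_ne_zero) (g := fun y => φ (x + t • y)) (by fun_prop)
  exact ((h1.comp_smul (inv_ne_zero ht.ne')).comp_sub_right x).const_mul _

lemma weightedBallMean_eq (hn : 0 < n) (φ : ℝ × E → ℝ) (β : ℝ) (x : E) {t : ℝ} (ht : 0 < t) :
    weightedBallMean n (fun z => φ (β, z)) x t = t ^ (n - 1) * descentMean φ (β, t, x) := by
  unfold weightedBallMean descentMean
  rw [setAverage_eq, setIntegral_eq_integral_of_forall_compl_eq_zero]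
  · simp only [div_sqrt_eq_descentWeight (fun z => φ (β, z)) x ht]
    rw [integral_const_mul,
      integral_sub_right_eq_self
        (fun z : E => descentWeight (t⁻¹ • z) * φ (β, x + t • (t⁻¹ • z))) x,
      Measure.integral_comp_smul volume (fun y : E => descentWeight y * φ (β, x + t • y)) t⁻¹,
      measureReal_def, Measure.addHaar_ball_of_pos _ _ ht, ENNReal.toReal_mul,
      ENNReal.toReal_ofReal (by positivity), finrank_euclideanSpace, Fintype.card_fin]
    have hv : (volume (Metric.ball (0 : E) 1)).toReal ≠ 0 := by
      refine (ENNReal.toReal_pos ?_ ?_).ne'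
      · exact (Metric.measure_ball_pos _ _ one_pos).ne'
      · exact measure_ball_lt_top.ne
    obtain ⟨m, rfl⟩ : ∃ m, n = m + 1 := ⟨n - 1, by omega⟩
    simp only [smul_eq_mul, Nat.add_sub_cancel, inv_pow, inv_inv]
    rw [abs_of_pos (by positivity)]
    field_simp
    ring
  -- outside of the ball the root is zero, and so is the quotient
  · intro z hz
    rw [mem_ball_iff_norm, not_lt] at hz
    have : t ^ 2 - ‖z - x‖ ^ 2 ≤ 0 := by nlinarith
    simp [Real.sqrt_eq_zero_of_nonpos this]

lemma hasDerivAt_waveSeq (hn : 0 < n) {φ : ℝ × E → ℝ} {j : ℕ}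
    (hφ : ContDiff ℝ ((1 + j : ℕ) : WithTop ℕ∞) φ) (β : ℝ) (x : E) (t : ℝ) :
    HasDerivAt (fun t => waveSeq k φ j (β, t, x)) (dirDeriv timeDir (waveSeq k φ j) (β, t, x)) t := by
  have h1 : ContDiff ℝ ((1 : ℕ) : WithTop ℕ∞) (waveSeq k φ j) := contDiff_waveSeq hn k j hφ
  have := hasDerivAt_dirDeriv (f := waveSeq k φ j) (p := (β, 0, x)) (v := timeDir) (r := t)
    (h1.differentiable (by simp) _)
  simpa using this

lemma hasDerivAt_pow_mul_waveSeq (hn : 0 < n) {φ : ℝ × E → ℝ} {j : ℕ}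
    (hφ : ContDiff ℝ ((1 + j : ℕ) : WithTop ℕ∞) φ) (β : ℝ) (x : E) (t : ℝ) (hj : j < k) :
    HasDerivAt (fun t => t ^ (2 * k - 2 * j - 1) * waveSeq k φ j (β, t, x))
      (t ^ (2 * k - 2 * j - 2) * waveSeq k φ (j + 1) (β, t, x)) t := by
  refine ((hasDerivAt_pow (2 * k - 2 * j - 1) t).fun_mul
    (hasDerivAt_waveSeq hn hφ β x t)).congr_deriv ?_
  obtain ⟨d, rfl⟩ : ∃ d, k = j + 1 + d := ⟨k - (j + 1), by omega⟩
  rw [show 2 * (j + 1 + d) - 2 * j - 1 = 2 * d + 1 by omega,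
    show 2 * (j + 1 + d) - 2 * j - 2 = 2 * d by omega, waveSeq]
  push_cast
  ring

/-- The powers of `(1/t) ∂_t` applied to `t^n` times the ball mean, in terms of the functions `P_j`. -/
lemma iterate_radialDeriv (hk : 0 < k) (hn : n = 2 * k) {φ : ℝ × E → ℝ} (β : ℝ) (x : E)
    (j : ℕ) (hj : j < k) (hφ : ContDiff ℝ (k : WithTop ℕ∞) φ) (t : ℝ) (ht : 0 < t) :
    (radialDeriv^[j] (weightedBallMean n (fun z => φ (β, z)) x)) t
      = t ^ (2 * k - 2 * j - 1) * waveSeq k φ j (β, t, x) := by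
  induction j generalizing t with
  | zero =>
    simp only [Function.iterate_zero, id]
    rw [weightedBallMean_eq (by omega) φ β x ht]
    simp [waveSeq, hn]
  | succ j ih =>
    rw [Function.iterate_succ_apply']
    have hev : (radialDeriv^[j] (weightedBallMean n (fun z => φ (β, z)) x)) =ᶠ[𝓝 t]
        fun t => t ^ (2 * k - 2 * j - 1) * waveSeq k φ j (β, t, x) := by
      filter_upwards [Ioi_mem_nhds ht] with s hs using ih (by omega) s hs
    have hd := hasDerivAt_pow_mul_waveSeq (k := k) (by omega : 0 < n) (φ := φ) (j := j)
      (hφ.of_le (by exact_mod_cast (by omega : 1 + j ≤ k))) β x t (by omega)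
    rw [radialDeriv, hev.deriv_eq, hd.deriv, ← mul_assoc]
    congr 1
    rw [show 2 * k - 2 * j - 2 = 2 * k - 2 * (j + 1) - 1 + 1 by omega, pow_succ]
    field_simp

lemma iterate_radialDeriv_eventuallyEq (hk : 0 < k) (hn : n = 2 * k) {φ : ℝ × E → ℝ} (β : ℝ)
    (x : E) (j : ℕ) (hj : j < k) (hφ : ContDiff ℝ (k : WithTop ℕ∞) φ) (t : ℝ) (ht : 0 < t) :
    (radialDeriv^[j] (weightedBallMean n (fun z => φ (β, z)) x)) =ᶠ[𝓝 t]
      fun t => t ^ (2 * k - 2 * j - 1) * waveSeq k φ j (β, t, x) := by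
  filter_upwards [Ioi_mem_nhds ht] with s hs using iterate_radialDeriv hk hn β x j hj hφ s hs

/-- The operator `w` is the time derivative of the solution with initial velocity `φ`. -/
lemma evenWaveOp_eq (hk : 0 < k) (hn : n = 2 * k) {φ : ℝ × E → ℝ}
    (hφ : ContDiff ℝ (k : WithTop ℕ∞) φ) (β : ℝ) (x : E) {t : ℝ} (ht : 0 < t) :
    evenWaveOp n (fun z => φ (β, z)) t x = dirDeriv timeDir (waveSol k φ) (β, t, x) := by
  rw [dirDeriv_waveSol hk hn hφ, evenWaveOp, show (n - 2) / 2 = k - 1 by omega,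
    (iterate_radialDeriv_eventuallyEq hk hn β x (k - 1) (by omega) hφ t ht).deriv_eq,
    (hasDerivAt_pow_mul_waveSeq (by omega : 0 < n) (hφ.of_le
      (by exact_mod_cast (by omega : 1 + (k - 1) ≤ k))) β x t (by omega)).deriv, one_div,
    show 2 * k - 2 * (k - 1) - 2 = 0 by omega, pow_zero, one_mul, Nat.sub_add_cancel hk]

lemma evenWaveOpWellDefined_of_contDiff (hk : 0 < k) (hn : n = 2 * k) {φ : ℝ × E → ℝ}
    (hφ : ContDiff ℝ (k : WithTop ℕ∞) φ) (β : ℝ) (x : E) {t : ℝ} (ht : 0 < t) :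
    EvenWaveOpWellDefined n (fun z => φ (β, z)) t x := by
  refine ⟨(integrable_div_sqrt (by omega) ?_ x ht).integrableOn, fun j hj => ?_⟩
  · have := hφ.continuous
    fun_prop
  · have hjk : j < k := by omega
    have hd := hasDerivAt_pow_mul_waveSeq (k := k) (by omega : 0 < n) (φ := φ) (j := j)
      (hφ.of_le (by exact_mod_cast (by omega : 1 + j ≤ k))) β x t hjk
    exact hd.differentiableAt.congr_of_eventuallyEq
      (iterate_radialDeriv_eventuallyEq hk hn β x j hjk hφ t ht)

end EvenWaveOp

/-! ### The hypergeometric function and the profile of the kernel -/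

section Hypergeometric

open scoped ENNReal in
/-- Termwise differentiation of a power series in terms of the coefficients. -/
lemma exists_hasFPowerSeriesOnBall_deriv {f : ℂ → ℂ} {p : FormalMultilinearSeries ℂ ℂ ℂ}
    {r : ℝ≥0∞} (h : HasFPowerSeriesOnBall f p 0 r) :
    ∃ q : FormalMultilinearSeries ℂ ℂ ℂ, HasFPowerSeriesOnBall (deriv f) q 0 r ∧
      ∀ n, q.coeff n = (n + 1) * p.coeff (n + 1) := by
  refine ⟨_, (ContinuousLinearMap.apply ℂ ℂ (1 : ℂ)).comp_hasFPowerSeriesOnBall h.fderiv,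
    fun n => ?_⟩
  have := p.derivSeries_coeff_one n
  simp only [FormalMultilinearSeries.coeff,
    ContinuousLinearMap.compFormalMultilinearSeries_apply] at this ⊢
  rw [nsmul_eq_mul] at this
  push_cast at this
  exact this

lemma hasSum_of_forall_eq {f g : ℕ → ℂ} {s : ℂ} (hf : HasSum f s) (h : ∀ n, f n = g n) : HasSum g s := by
  rwa [← funext h]

lemma hasSum_coeff {f : ℂ → ℂ} {p : FormalMultilinearSeries ℂ ℂ ℂ}
    (h : HasFPowerSeriesOnBall f p 0 1) {z : ℂ} (hz : ‖z‖ < 1) :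
    HasSum (fun n => p.coeff n * z ^ n) (f z) := by
  have hz' : ‖z‖₊ < 1 := NNReal.coe_lt_coe.1 (by simpa using hz)
  have := h.hasSum (y := z) (by simpa [enorm_eq_nnnorm] using hz')
  simp only [zero_add] at this
  refine hasSum_of_forall_eq this fun n => ?_
  rw [p.apply_eq_pow_smul_coeff, smul_eq_mul, mul_comm]

lemma hasSum_of_succ {g : ℕ → ℂ} {s : ℂ} (h : HasSum (fun n => g (n + 1)) s) (h0 : g 0 = 0) :
    HasSum g s := by
  have := (hasSum_nat_add_iff (f := g) 1).1 h
  simpa [h0] using this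

/-- The radius is infinite if `-a` is a natural number, and one otherwise. -/
lemma one_le_radius_ordinaryHypergeometricSeries (a : ℂ) :
    1 ≤ (ordinaryHypergeometricSeries ℂ a a (1 : ℂ)).radius := by
  by_cases h : ∃ k : ℕ, (k : ℂ) = -a
  · obtain ⟨k, hk⟩ := h
    have : a = -(k : ℂ) := by rw [hk, neg_neg]
    rw [this, ordinaryHypergeometric_radius_top_of_neg_nat₁]
    exact le_top
  · push Not at h
    rw [ordinaryHypergeometricSeries_radius_eq_one]
    intro k
    refine ⟨h k, h k, fun hk => ?_⟩
    have : ((k : ℂ) + 1) = 0 := by rw [hk]; ring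
    exact Nat.cast_add_one_ne_zero k this

lemma hasFPowerSeriesOnBall_hypergeometric (a : ℂ) :
    HasFPowerSeriesOnBall (₂F₁ a a (1 : ℂ)) (ordinaryHypergeometricSeries ℂ a a (1 : ℂ)) 0 1 :=
  ((ordinaryHypergeometricSeries ℂ a a (1 : ℂ)).hasFPowerSeriesOnBall
    (lt_of_lt_of_le one_pos (one_le_radius_ordinaryHypergeometricSeries a))).mono one_pos
    (one_le_radius_ordinaryHypergeometricSeries a)

/-- The recursion for the coefficients of `₂F₁(a, a; 1; ·)`. -/
lemma coeff_hypergeometric_succ (a : ℂ) (n : ℕ) :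
    ((n : ℂ) + 1) ^ 2 * (ordinaryHypergeometricSeries ℂ a a (1 : ℂ)).coeff (n + 1)
      = (a + n) ^ 2 * (ordinaryHypergeometricSeries ℂ a a (1 : ℂ)).coeff n := by
  simp only [ordinaryHypergeometricSeries, FormalMultilinearSeries.coeff_ofScalars,
    ordinaryHypergeometricCoefficient, ascPochhammer_succ_eval, Nat.factorial_succ]
  have h0 : ((n : ℂ) + 1) ≠ 0 := Nat.cast_add_one_ne_zero n
  have h1 : ((n.factorial : ℕ) : ℂ) ≠ 0 := by exact_mod_cast n.factorial_ne_zero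
  have h2 : Polynomial.eval (1 : ℂ) (ascPochhammer ℂ n) ≠ 0 := by
    rw [ascPochhammer_eval_one]; exact h1
  push_cast
  rw [add_comm (1 : ℂ) (n : ℂ)]
  field_simp

/-- The hypergeometric equation for `₂F₁(a, a; 1; ·)` in the unit disc. -/
lemma hypergeometric_ode (a : ℂ) {z : ℂ} (hz : ‖z‖ < 1) :
    z * (1 - z) * deriv (deriv (₂F₁ a a (1 : ℂ))) z + (1 - (2 * a + 1) * z) * deriv (₂F₁ a a (1 : ℂ)) z
      - a ^ 2 * ₂F₁ a a (1 : ℂ) z = 0 := by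
  have H0 := hasFPowerSeriesOnBall_hypergeometric a
  obtain ⟨q1, H1, hq1⟩ := exists_hasFPowerSeriesOnBall_deriv H0
  obtain ⟨q2, H2, hq2⟩ := exists_hasFPowerSeriesOnBall_deriv H1
  have hrec := coeff_hypergeometric_succ a
  -- comparison of coefficients, with the recursion for the coefficients
  generalize (ordinaryHypergeometricSeries ℂ a a (1 : ℂ)) = p at *
  have S0 := hasSum_coeff H0 hz
  have S1 := hasSum_coeff H1 hz
  have S2 := hasSum_coeff H2 hz
  have T1 : HasSum (fun n : ℕ => (n : ℂ) * p.coeff n * z ^ n) (z * deriv (₂F₁ a a (1 : ℂ)) z) := by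
    refine hasSum_of_succ ?_ (by simp)
    refine hasSum_of_forall_eq (S1.mul_left z) fun n => ?_
    rw [hq1]; push_cast; ring
  have T2 : HasSum (fun n : ℕ => (n : ℂ) * ((n + 1) * p.coeff (n + 1)) * z ^ n)
      (z * deriv (deriv (₂F₁ a a (1 : ℂ))) z) := by
    refine hasSum_of_succ ?_ (by simp)
    refine hasSum_of_forall_eq (S2.mul_left z) fun n => ?_
    rw [hq2, hq1]; push_cast; ring
  have T3 : HasSum (fun n : ℕ => (n : ℂ) * ((n - 1) * p.coeff n) * z ^ n)
      (z * (z * deriv (deriv (₂F₁ a a (1 : ℂ))) z)) := by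
    refine hasSum_of_succ ?_ (by simp)
    refine hasSum_of_forall_eq (T2.mul_left z) fun n => ?_
    push_cast; ring
  have key := ((T2.sub T3).add (S1.sub (T1.mul_left (2 * a + 1)))).sub (S0.mul_left (a ^ 2))
  have hz0 : HasSum (fun _ : ℕ => (0 : ℂ)) 0 := hasSum_zero
  have := key.unique (hasSum_of_forall_eq hz0 fun n => by
    rw [hq1]
    linear_combination (-z ^ n) * hrec n)
  linear_combination this

/-- The profile `h(ζ) = (1 - ζ)^{-a} ₂F₁(a, a; 1; ζ / (ζ - 1))`; it is the Legendre-type function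
`₂F₁(a, 1 - a; 1; ζ)`. The power is written with the real logarithm of `1 - ζ`. -/
noncomputable def profile (a : ℂ) (ζ : ℝ) : ℂ :=
  Complex.exp (-a * (Real.log (1 - ζ) : ℂ)) * ₂F₁ a a (1 : ℂ) ((ζ / (ζ - 1) : ℝ) : ℂ)

lemma profile_zero (a : ℂ) : profile a 0 = 1 := by simp [profile]

lemma abs_div_sub_one_lt {ζ : ℝ} (hζ : ζ < 1 / 2) : |ζ / (ζ - 1)| < 1 := by
  have h1 : ζ - 1 < 0 := by linarith
  rw [abs_div, div_lt_one (abs_pos.2 h1.ne), abs_of_neg h1, abs_lt]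
  constructor <;> linarith

lemma norm_ofReal_div_sub_one_lt {ζ : ℝ} (hζ : ζ < 1 / 2) :
    ‖((ζ / (ζ - 1) : ℝ) : ℂ)‖ < 1 := by
  rw [Complex.norm_real]
  exact abs_div_sub_one_lt hζ

lemma analyticAt_hypergeometric (a : ℂ) {z : ℂ} (hz : ‖z‖ < 1) :
    AnalyticAt ℂ (₂F₁ a a (1 : ℂ)) z :=
  (hasFPowerSeriesOnBall_hypergeometric a).analyticOnNhd z
    (by
      have hz' : ‖z‖₊ < 1 := NNReal.coe_lt_coe.1 (by simpa using hz)
      simpa [enorm_eq_nnnorm, Metric.mem_eball] using hz')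

lemma hasDerivAt_div_sub_one {ζ : ℝ} (hζ : ζ < 1 / 2) :
    HasDerivAt (fun ζ : ℝ => ζ / (ζ - 1)) (-(1 / (1 - ζ)) ^ 2) ζ := by
  have h1 : ζ - 1 ≠ 0 := by linarith
  have h2 : 1 - ζ ≠ 0 := by linarith
  refine ((hasDerivAt_id ζ).fun_div ((hasDerivAt_id ζ).sub_const 1) h1).congr_deriv ?_
  simp only [id]
  field_simp
  ring

lemma hasDerivAt_comp_div_sub_one {G : ℂ → ℂ} {ζ : ℝ} (hζ : ζ < 1 / 2)
    (hG : AnalyticAt ℂ G ((ζ / (ζ - 1) : ℝ) : ℂ)) :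
    HasDerivAt (fun ζ : ℝ => G ((ζ / (ζ - 1) : ℝ) : ℂ))
      (-((1 / (1 - ζ) : ℝ) : ℂ) ^ 2 * deriv G ((ζ / (ζ - 1) : ℝ) : ℂ)) ζ := by
  have h1 := hG.differentiableAt.hasDerivAt
  have h2 := (hasDerivAt_div_sub_one hζ).ofReal_comp
  have h3 := HasDerivAt.comp ζ h1 h2
  refine HasDerivAt.congr_deriv h3 ?_
  push_cast
  ring

lemma hasDerivAt_exp_log {a : ℂ} {ζ : ℝ} (hζ : ζ < 1 / 2) :
    HasDerivAt (fun ζ : ℝ => Complex.exp (-a * (Real.log (1 - ζ) : ℂ)))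
      (a * ((1 / (1 - ζ) : ℝ) : ℂ) * Complex.exp (-a * (Real.log (1 - ζ) : ℂ))) ζ := by
  have h0 : 1 - ζ ≠ 0 := by linarith
  have h1 : HasDerivAt (fun ζ : ℝ => Real.log (1 - ζ)) (-1 / (1 - ζ)) ζ :=
    ((hasDerivAt_id ζ).const_sub 1).log h0
  have h2 := ((h1.ofReal_comp).const_mul (-a)).cexp
  refine h2.congr_deriv ?_
  push_cast
  ring

lemma hasDerivAt_one_div_one_sub {ζ : ℝ} (hζ : ζ < 1 / 2) :
    HasDerivAt (fun ζ : ℝ => ((1 / (1 - ζ) : ℝ) : ℂ)) (((1 / (1 - ζ) : ℝ) : ℂ) ^ 2) ζ := by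
  have h0 : 1 - ζ ≠ 0 := by linarith
  have h1 : HasDerivAt (fun ζ : ℝ => 1 / (1 - ζ)) ((1 / (1 - ζ)) ^ 2) ζ := by
    refine ((hasDerivAt_const ζ (1 : ℝ)).fun_div ((hasDerivAt_id ζ).const_sub 1) h0).congr_deriv ?_
    simp
  refine h1.ofReal_comp.congr_deriv ?_
  push_cast
  ring

/-- The equation `ζ (1 - ζ) h'' + (1 - 2ζ) h' - a (1 - a) h = 0` for the profile. Contrary to the
hypergeometric equation its coefficients are real in all cases of interest. -/
lemma profile_ode (a : ℂ) : ∃ h₁ h₂ : ℝ → ℂ, ∀ ζ < (1 / 2 : ℝ),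
    HasDerivAt (profile a) (h₁ ζ) ζ ∧ HasDerivAt h₁ (h₂ ζ) ζ ∧
      (ζ * (1 - ζ) : ℂ) * h₂ ζ + (1 - 2 * ζ) * h₁ ζ - a * (1 - a) * profile a ζ = 0 := by
  set F : ℂ → ℂ := ₂F₁ a a (1 : ℂ) with hF
  set e : ℝ → ℂ := fun ζ => Complex.exp (-a * (Real.log (1 - ζ) : ℂ)) with he
  set y : ℝ → ℂ := fun ζ => ((1 / (1 - ζ) : ℝ) : ℂ) with hy
  set z : ℝ → ℂ := fun ζ => ((ζ / (ζ - 1) : ℝ) : ℂ) with hz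
  refine ⟨fun ζ => e ζ * (a * y ζ * F (z ζ) - y ζ ^ 2 * deriv F (z ζ)),
    fun ζ => e ζ * (a * y ζ * (a * y ζ * F (z ζ) - y ζ ^ 2 * deriv F (z ζ))
      + (a * y ζ ^ 2 * F (z ζ) - a * y ζ ^ 3 * deriv F (z ζ) - 2 * y ζ ^ 3 * deriv F (z ζ)
        + y ζ ^ 4 * deriv (deriv F) (z ζ))), fun ζ hζ => ?_⟩
  have hzn := norm_ofReal_div_sub_one_lt hζ
  have hFa : AnalyticAt ℂ F (z ζ) := analyticAt_hypergeometric a hzn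
  have de : HasDerivAt e (a * y ζ * e ζ) ζ := hasDerivAt_exp_log hζ
  have dy : HasDerivAt y (y ζ ^ 2) ζ := hasDerivAt_one_div_one_sub hζ
  have dF : HasDerivAt (fun ζ => F (z ζ)) (-y ζ ^ 2 * deriv F (z ζ)) ζ :=
    hasDerivAt_comp_div_sub_one hζ hFa
  have dF1 : HasDerivAt (fun ζ => deriv F (z ζ)) (-y ζ ^ 2 * deriv (deriv F) (z ζ)) ζ :=
    hasDerivAt_comp_div_sub_one hζ hFa.deriv
  refine ⟨?_, ?_, ?_⟩
  · refine (de.fun_mul dF).congr_deriv ?_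
    ring
  · refine (de.fun_mul (((dy.const_mul a).fun_mul dF).fun_sub ((dy.fun_pow 2).fun_mul dF1))).congr_deriv ?_
    push_cast
    ring
  · have hode := hypergeometric_ode a hzn
    rw [← hF] at hode
    change z ζ * (1 - z ζ) * deriv (deriv F) (z ζ) + (1 - (2 * a + 1) * z ζ) * deriv F (z ζ)
      - a ^ 2 * F (z ζ) = 0 at hode
    have h0 : 1 - ζ ≠ 0 := by linarith
    have h0' : ζ - 1 ≠ 0 := by linarith
    have h0c : (1 - ζ : ℂ) ≠ 0 := by exact_mod_cast h0
    -- with `y = 1/(1 - ζ)` all terms are rational in `y`, and `z = 1 - y`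
    have hyz : (ζ : ℂ) * y ζ = y ζ - 1 := by
      simp only [hy]; push_cast; field_simp; ring
    have hzy : z ζ = 1 - y ζ := by
      simp only [hy, hz]
      rw [← Complex.ofReal_one, ← Complex.ofReal_sub]
      congr 1
      field_simp; ring
    have hy0 : y ζ ≠ 0 := by
      simp only [hy]; push_cast; exact one_div_ne_zero h0c
    have hζy : (ζ : ℂ) = 1 - (y ζ)⁻¹ := by
      field_simp; linear_combination hyz
    rw [hzy] at hode
    have hp : profile a ζ = e ζ * F (1 - y ζ) := by
      rw [← hzy]; rfl
    rw [hp]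
    simp only [hzy]
    rw [hζy]
    field_simp
    linear_combination (-e ζ * y ζ) * hode

lemma contDiffOn_profile (a : ℂ) : ContDiffOn ℝ (⊤ : ℕ∞) (profile a) (Iio (1 / 2)) := by
  intro ζ hζ
  have hζ : ζ < 1 / 2 := hζ
  refine ContDiffAt.contDiffWithinAt ?_
  have h0 : 1 - ζ ≠ 0 := by linarith
  have h0' : ζ - 1 ≠ 0 := by linarith
  have hofR : ∀ g : ℝ → ℝ, ContDiffAt ℝ (⊤ : ℕ∞) g ζ → ContDiffAt ℝ (⊤ : ℕ∞) (fun r => (g r : ℂ)) ζ :=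
    fun g hg => Complex.ofRealCLM.contDiff.contDiffAt.comp ζ hg
  refine ContDiffAt.mul ?_ ?_
  · refine ContDiffAt.cexp (contDiffAt_const.mul (hofR _ ?_))
    exact (contDiffAt_const.sub contDiffAt_id).log h0
  · have h1 : ContDiffAt ℝ (⊤ : ℕ∞) (₂F₁ a a (1 : ℂ)) ((ζ / (ζ - 1) : ℝ) : ℂ) :=
      ((analyticAt_hypergeometric a (norm_ofReal_div_sub_one_lt hζ)).contDiffAt).restrict_scalars ℝ
    exact h1.comp ζ (hofR _ (contDiffAt_id.div (contDiffAt_id.sub contDiffAt_const) h0'))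

end Hypergeometric

/-! ### Real solutions of the profile equation -/

section RealProfiles

/-- A smooth real function on the line that solves the equation of the profile near `(-∞, 0]`,
with the value `c` at the singular point `0`. -/
structure IsRealProfile (m c : ℝ) (q : ℝ → ℝ) : Prop where
  smooth : ContDiff ℝ (⊤ : ℕ∞) q
  ode : ∀ ζ < (1 / 8 : ℝ), ζ * (1 - ζ) * deriv (deriv q) ζ + (1 - 2 * ζ) * deriv q ζ - m * q ζ = 0
  at_zero : q 0 = c

/-- The composition of the profile with a real linear functional, cut off away from the region
`ζ < 1/8`, so as to be defined and smooth everywhere. -/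
noncomputable def cutProfile (L : ℂ →L[ℝ] ℝ) (a : ℂ) (ζ : ℝ) : ℝ :=
  Real.smoothTransition (2 - 8 * ζ) * L (profile a ζ)

lemma cutProfile_eq (L : ℂ →L[ℝ] ℝ) (a : ℂ) {ζ : ℝ} (hζ : ζ ≤ 1 / 8) :
    cutProfile L a ζ = L (profile a ζ) := by
  rw [cutProfile, Real.smoothTransition.one_of_one_le (by linarith), one_mul]

/-- A real linear functional commutes with the profile equation, since its coefficients are real if
`a (1 - a)` is. -/
lemma isRealProfile_cutProfile (L : ℂ →L[ℝ] ℝ) {a : ℂ} {m : ℝ} (hm : a * (1 - a) = m) :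
    IsRealProfile m (L 1) (cutProfile L a) := by
  refine ⟨?_, ?_, ?_⟩
  · rw [contDiff_iff_contDiffAt]
    intro ζ
    by_cases h : ζ < 1 / 2
    · refine ContDiffAt.mul ?_ ?_
      · exact Real.smoothTransition.contDiff.contDiffAt.comp ζ (by fun_prop)
      · exact L.contDiff.contDiffAt.comp ζ
          ((contDiffOn_profile a).contDiffAt (Iio_mem_nhds h))
    · have : cutProfile L a =ᶠ[𝓝 ζ] fun _ => 0 := by
        filter_upwards [Ioi_mem_nhds (show (1 / 4 : ℝ) < ζ by linarith)] with r hr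
        have hr : 1 / 4 < r := hr
        rw [cutProfile, Real.smoothTransition.zero_of_nonpos (by linarith), zero_mul]
      exact contDiffAt_const.congr_of_eventuallyEq this
  · intro ζ hζ
    obtain ⟨h₁, h₂, H⟩ := profile_ode a
    have hd : ∀ r < (1 / 8 : ℝ), HasDerivAt (cutProfile L a) (L (h₁ r)) r := by
      intro r hr
      have := L.hasFDerivAt.comp_hasDerivAt r (H r (by linarith)).1
      refine this.congr_of_eventuallyEq ?_
      filter_upwards [Iio_mem_nhds hr] with s hs using cutProfile_eq L a (le_of_lt hs)
    have hd2 : HasDerivAt (deriv (cutProfile L a)) (L (h₂ ζ)) ζ := by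
      have := L.hasFDerivAt.comp_hasDerivAt ζ (H ζ (by linarith)).2.1
      refine this.congr_of_eventuallyEq ?_
      filter_upwards [Iio_mem_nhds hζ] with s hs using (hd s hs).deriv
    rw [hd2.deriv, (hd ζ hζ).deriv, cutProfile_eq L a hζ.le]
    have := congrArg L (H ζ (by linarith)).2.2
    rw [hm, ← Complex.ofReal_one, ← Complex.ofReal_sub, ← Complex.ofReal_mul,
      ← Complex.ofReal_ofNat, ← Complex.ofReal_mul, ← Complex.ofReal_sub,
      map_sub, map_add, ← Complex.real_smul, ← Complex.real_smul, ← Complex.real_smul, map_smul,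
      map_smul, map_smul, map_zero] at this
    simpa using this
  · rw [cutProfile_eq L a (by norm_num), profile_zero]

lemma IsRealProfile.deriv_zero {m c : ℝ} {q : ℝ → ℝ} (h : IsRealProfile m c q) :
    deriv q 0 = m * c := by
  have := h.ode 0 (by norm_num)
  rw [h.at_zero] at this
  linarith

end RealProfiles

/-! ### The reduced kernel -/

section Kernel

/-- A smooth positive function on the line that equals `1 + t` for `t ≥ -1/2`. Times slightly below
zero are included because the kernel is differentiated in `b` at `b = 0`. -/
noncomputable def posTime (t : ℝ) : ℝ :=
  Real.smoothTransition (4 * t + 3) * (1 + t) + (1 - Real.smoothTransition (4 * t + 3))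

lemma posTime_eq {t : ℝ} (ht : -1 / 2 ≤ t) : posTime t = 1 + t := by
  rw [posTime, Real.smoothTransition.one_of_one_le (by linarith)]; ring

lemma posTime_pos (t : ℝ) : 0 < posTime t := by
  unfold posTime
  have h0 := Real.smoothTransition.nonneg (4 * t + 3)
  have h1 := Real.smoothTransition.le_one (4 * t + 3)
  rcases le_or_gt t (-3 / 4) with h | h
  · rw [Real.smoothTransition.zero_of_nonpos (by linarith)]; norm_num
  · nlinarith

lemma contDiff_posTime {m : ℕ∞} : ContDiff ℝ m posTime := by
  unfold posTime
  have h : ContDiff ℝ m fun t : ℝ => Real.smoothTransition (4 * t + 3) :=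
    Real.smoothTransition.contDiff.comp (by fun_prop)
  fun_prop

lemma contDiff_posTime_rpow {m : ℕ∞} (r : ℝ) : ContDiff ℝ m fun t => posTime t ^ r :=
  contDiff_posTime.rpow_const_of_ne fun t => (posTime_pos t).ne'

/-- The argument `(s² - (t - b)²) / (4 (1 + t) (1 + b))` of the kernel. Points of the domain of
the kernel are written `(t, b, s)`. -/
noncomputable def zeta (p : ℝ × ℝ × ℝ) : ℝ :=
  (p.2.2 ^ 2 - (posTime p.1 - posTime p.2.1) ^ 2) / (4 * posTime p.1 * posTime p.2.1)

lemma contDiff_zeta {m : ℕ∞} : ContDiff ℝ m zeta := by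
  unfold zeta
  have h1 : ContDiff ℝ m fun p : ℝ × ℝ × ℝ => posTime p.1 := contDiff_posTime.comp (by fun_prop)
  have h2 : ContDiff ℝ m fun p : ℝ × ℝ × ℝ => posTime p.2.1 := contDiff_posTime.comp (by fun_prop)
  refine ContDiff.div (by fun_prop) (by fun_prop) fun p => ?_
  have := posTime_pos p.1
  have := posTime_pos p.2.1
  positivity

lemma zeta_eq {t b : ℝ} (ht : -1 / 2 ≤ t) (hb : -1 / 2 ≤ b) (s : ℝ) :
    zeta (t, b, s) = (s ^ 2 - (t - b) ^ 2) / (4 * (1 + t) * (1 + b)) := by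
  simp only [zeta, posTime_eq ht, posTime_eq hb]
  congr 2
  ring

/-- The reduced kernel `q(ζ)`. -/
noncomputable def kappa (q : ℝ → ℝ) (p : ℝ × ℝ × ℝ) : ℝ := q (zeta p)

/-- The direction of `t` in the space of points `(t, b, s)`. -/
abbrev dirT : ℝ × ℝ × ℝ := (1, 0, 0)

/-- The direction of `b` in the space of points `(t, b, s)`. -/
abbrev dirB : ℝ × ℝ × ℝ := (0, 1, 0)

/-- The direction of `s` in the space of points `(t, b, s)`. -/
abbrev dirS : ℝ × ℝ × ℝ := (0, 0, 1)

lemma hasDerivAt_dirT {f : ℝ × ℝ × ℝ → ℝ} (hf : Differentiable ℝ f) (t b s : ℝ) :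
    HasDerivAt (fun t => f (t, b, s)) (dirDeriv dirT f (t, b, s)) t := by
  have := hasDerivAt_dirDeriv (f := f) (p := (0, b, s)) (v := dirT) (r := t) (hf _)
  simpa using this

lemma hasDerivAt_dirB {f : ℝ × ℝ × ℝ → ℝ} (hf : Differentiable ℝ f) (t b s : ℝ) :
    HasDerivAt (fun b => f (t, b, s)) (dirDeriv dirB f (t, b, s)) b := by
  have := hasDerivAt_dirDeriv (f := f) (p := (t, 0, s)) (v := dirB) (r := b) (hf _)
  simpa using this

lemma hasDerivAt_dirS {f : ℝ × ℝ × ℝ → ℝ} (hf : Differentiable ℝ f) (t b s : ℝ) :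
    HasDerivAt (fun s => f (t, b, s)) (dirDeriv dirS f (t, b, s)) s := by
  have := hasDerivAt_dirDeriv (f := f) (p := (t, b, 0)) (v := dirS) (r := s) (hf _)
  simpa using this

lemma dirDeriv_zeta_T {t b : ℝ} (ht : -1 / 2 < t) (hb : -1 / 2 < b) (s : ℝ) :
    dirDeriv dirT zeta (t, b, s)
      = -s ^ 2 / (4 * (1 + t) ^ 2 * (1 + b)) - 1 / (4 * (1 + b)) + (1 + b) / (4 * (1 + t) ^ 2) := by
  have ht0 : 1 + t ≠ 0 := by linarith
  have hb0 : 1 + b ≠ 0 := by linarith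
  refine (hasDerivAt_dirT (contDiff_zeta (m := 1).differentiable one_ne_zero) t b s).unique ?_
  have h1 : HasDerivAt (fun t : ℝ => (s ^ 2 - (t - b) ^ 2) / (4 * (1 + t) * (1 + b)))
      (-s ^ 2 / (4 * (1 + t) ^ 2 * (1 + b)) - 1 / (4 * (1 + b)) + (1 + b) / (4 * (1 + t) ^ 2)) t := by
    refine (((((hasDerivAt_id t).sub_const b).fun_pow 2).const_sub (s ^ 2)).fun_div
      ((((hasDerivAt_id t).const_add 1).const_mul 4).mul_const (1 + b)) (by positivity)).congr_deriv ?_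
    simp only [id]
    field_simp
    ring
  refine h1.congr_of_eventuallyEq ?_
  filter_upwards [Ioi_mem_nhds ht] with r hr using zeta_eq (le_of_lt hr) hb.le s

lemma dirDeriv_zeta_S {t b : ℝ} (ht : -1 / 2 < t) (hb : -1 / 2 < b) (s : ℝ) :
    dirDeriv dirS zeta (t, b, s) = s / (2 * (1 + t) * (1 + b)) := by
  have ht0 : 1 + t ≠ 0 := by linarith
  have hb0 : 1 + b ≠ 0 := by linarith
  refine (hasDerivAt_dirS (contDiff_zeta (m := 1).differentiable one_ne_zero) t b s).unique ?_
  have h1 : HasDerivAt (fun s : ℝ => (s ^ 2 - (t - b) ^ 2) / (4 * (1 + t) * (1 + b)))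
      (s / (2 * (1 + t) * (1 + b))) s := by
    refine (((hasDerivAt_pow 2 s).sub_const _).div_const _).congr_deriv ?_
    field_simp
    norm_num
    ring
  exact h1.congr_of_eventuallyEq (Eventually.of_forall fun r => zeta_eq ht.le hb.le r)

lemma dirDeriv_zeta_B {t b : ℝ} (ht : -1 / 2 < t) (hb : -1 / 2 < b) (s : ℝ) :
    dirDeriv dirB zeta (t, b, s)
      = -s ^ 2 / (4 * (1 + t) * (1 + b) ^ 2) + (1 + t) / (4 * (1 + b) ^ 2) - 1 / (4 * (1 + t)) := by
  have ht0 : 1 + t ≠ 0 := by linarith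
  have hb0 : 1 + b ≠ 0 := by linarith
  refine (hasDerivAt_dirB (contDiff_zeta (m := 1).differentiable one_ne_zero) t b s).unique ?_
  have h1 : HasDerivAt (fun b : ℝ => (s ^ 2 - (t - b) ^ 2) / (4 * (1 + t) * (1 + b)))
      (-s ^ 2 / (4 * (1 + t) * (1 + b) ^ 2) + (1 + t) / (4 * (1 + b) ^ 2) - 1 / (4 * (1 + t))) b := by
    refine (((((hasDerivAt_id b).const_sub t).fun_pow 2).const_sub (s ^ 2)).fun_div
      (((hasDerivAt_id b).const_add 1).const_mul (4 * (1 + t))) (by positivity)).congr_deriv ?_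
    simp only [id]
    field_simp
    ring
  refine h1.congr_of_eventuallyEq ?_
  filter_upwards [Ioi_mem_nhds hb] with r hr using zeta_eq ht.le (le_of_lt hr) s

lemma dirDeriv_zeta_TT {t b : ℝ} (ht : -1 / 2 < t) (hb : -1 / 2 < b) (s : ℝ) :
    dirDeriv dirT (dirDeriv dirT zeta) (t, b, s)
      = s ^ 2 / (2 * (1 + t) ^ 3 * (1 + b)) - (1 + b) / (2 * (1 + t) ^ 3) := by
  have ht0 : 1 + t ≠ 0 := by linarith
  have hb0 : 1 + b ≠ 0 := by linarith
  refine (hasDerivAt_dirT ((contDiff_dirDeriv (m := 1) (contDiff_zeta (m := 2)) _).differentiable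
    (by simp)) t b s).unique ?_
  have hp : HasDerivAt (fun t : ℝ => (1 + t) ^ 2) (2 * (1 + t)) t := by
    simpa using ((hasDerivAt_id t).const_add 1).fun_pow 2
  have h1 : HasDerivAt (fun t : ℝ => -s ^ 2 / (4 * (1 + t) ^ 2 * (1 + b)) - 1 / (4 * (1 + b))
        + (1 + b) / (4 * (1 + t) ^ 2))
      (s ^ 2 / (2 * (1 + t) ^ 3 * (1 + b)) - (1 + b) / (2 * (1 + t) ^ 3)) t := by
    refine ((((hasDerivAt_const t (-s ^ 2)).fun_div ((hp.const_mul 4).mul_const (1 + b))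
      (by positivity)).sub_const _).fun_add ((hasDerivAt_const t (1 + b)).fun_div
      (hp.const_mul 4) (by positivity))).congr_deriv ?_
    field_simp
    ring
  refine h1.congr_of_eventuallyEq ?_
  filter_upwards [Ioi_mem_nhds ht] with r hr using dirDeriv_zeta_T hr hb s

lemma dirDeriv_zeta_SS {t b : ℝ} (ht : -1 / 2 < t) (hb : -1 / 2 < b) (s : ℝ) :
    dirDeriv dirS (dirDeriv dirS zeta) (t, b, s) = 1 / (2 * (1 + t) * (1 + b)) := by
  refine (hasDerivAt_dirS ((contDiff_dirDeriv (m := 1) (contDiff_zeta (m := 2)) _).differentiable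
    (by simp)) t b s).unique ?_
  have h1 : HasDerivAt (fun s : ℝ => s / (2 * (1 + t) * (1 + b)))
      (1 / (2 * (1 + t) * (1 + b))) s := (hasDerivAt_id s).div_const _
  exact h1.congr_of_eventuallyEq (Eventually.of_forall fun r => dirDeriv_zeta_S ht hb r)

/-- The part of the space of points `(t, b, s)` in which the reduced kernel solves its equation. -/
def kernelDomain : Set (ℝ × ℝ × ℝ) := {p | -1 / 2 < p.1 ∧ -1 / 2 < p.2.1 ∧ zeta p < 1 / 8}

lemma isOpen_kernelDomain : IsOpen kernelDomain := by
  have h := (contDiff_zeta (m := 0)).continuous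
  exact (isOpen_lt continuous_const continuous_fst).inter
    ((isOpen_lt continuous_const (continuous_fst.comp continuous_snd)).inter (isOpen_lt h continuous_const))

/-- Inside of the characteristic triangle `ζ ≤ 0`. -/
lemma mem_kernelDomain {t b s : ℝ} (hb : 0 ≤ b) (hs : 0 ≤ s) (hst : s ≤ t - b) :
    (t, b, s) ∈ kernelDomain := by
  refine ⟨by simp only; linarith, by simp only; linarith, ?_⟩
  rw [zeta_eq (by linarith) (by linarith)]
  have : (s ^ 2 - (t - b) ^ 2) / (4 * (1 + t) * (1 + b)) ≤ 0 := by
    refine div_nonpos_of_nonpos_of_nonneg (by nlinarith) ?_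
    have : 0 < 1 + t := by linarith
    have : 0 < 1 + b := by linarith
    positivity
  linarith

/-- The equation `k_tt - k_ss + m (1 + t)⁻² k = 0` at a point. -/
def KernelEquation (m : ℝ) (k : ℝ × ℝ × ℝ → ℝ) (p : ℝ × ℝ × ℝ) : Prop :=
  dirDeriv dirT (dirDeriv dirT k) p - dirDeriv dirS (dirDeriv dirS k) p
    + m / posTime p.1 ^ 2 * k p = 0

variable {m c : ℝ} {q : ℝ → ℝ}

lemma IsRealProfile.contDiff_kappa (hq : IsRealProfile m c q) {j : ℕ∞} :
    ContDiff ℝ j (kappa q) :=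
  (hq.smooth.of_le (by exact_mod_cast le_top)).comp contDiff_zeta

lemma dirDeriv_comp_real {P : Type} [NormedAddCommGroup P] [NormedSpace ℝ P] {g : ℝ → ℝ}
    {f : P → ℝ} {p : P} (hg : DifferentiableAt ℝ g (f p)) (hf : DifferentiableAt ℝ f p) (v : P) :
    dirDeriv v (fun p => g (f p)) p = deriv g (f p) * dirDeriv v f p := by
  have h := hg.hasDerivAt.comp_hasFDerivAt p hf.hasFDerivAt
  have h' : HasFDerivAt (fun p => g (f p)) _ p := h
  simp [dirDeriv, h'.fderiv]

lemma IsRealProfile.dirDeriv_kappa (hq : IsRealProfile m c q) (v p : ℝ × ℝ × ℝ) :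
    dirDeriv v (kappa q) p = deriv q (zeta p) * dirDeriv v zeta p :=
  dirDeriv_comp_real (hq.smooth.differentiable (by simp) _)
    ((contDiff_zeta (m := 1)).differentiable one_ne_zero _) v

lemma IsRealProfile.contDiff_deriv (hq : IsRealProfile m c q) : ContDiff ℝ (⊤ : ℕ∞) (deriv q) :=
  (contDiff_infty_iff_deriv.1 hq.smooth).2

lemma IsRealProfile.dirDeriv_dirDeriv_kappa (hq : IsRealProfile m c q) (v p : ℝ × ℝ × ℝ) :
    dirDeriv v (dirDeriv v (kappa q)) p = deriv (deriv q) (zeta p) * dirDeriv v zeta p ^ 2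
      + deriv q (zeta p) * dirDeriv v (dirDeriv v zeta) p := by
  have e : dirDeriv v (kappa q) = fun p => deriv q (zeta p) * dirDeriv v zeta p :=
    funext (hq.dirDeriv_kappa v)
  have h1 : Differentiable ℝ zeta := (contDiff_zeta (m := 1)).differentiable one_ne_zero
  have h2 : Differentiable ℝ (deriv q) := hq.contDiff_deriv.differentiable (by simp)
  have h3 : Differentiable ℝ (dirDeriv v zeta) :=
    (contDiff_dirDeriv (m := 1) (contDiff_zeta (m := 2)) _).differentiable (by simp)
  rw [e, dirDeriv_mul (by fun_prop) (h3 p), dirDeriv_comp_real (h2 _) (h1 p)]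
  ring

/-- By the chain rule this is the profile equation multiplied by `-(1 + t)⁻²`. -/
lemma IsRealProfile.kernelEquation_kappa (hq : IsRealProfile m c q) {p : ℝ × ℝ × ℝ}
    (hp : p ∈ kernelDomain) : KernelEquation m (kappa q) p := by
  obtain ⟨t, b, s⟩ := p
  obtain ⟨ht, hb, hz⟩ := hp
  simp only at ht hb
  have hode := hq.ode _ hz
  have ht0 : 1 + t ≠ 0 := by linarith
  have hb0 : 1 + b ≠ 0 := by linarith
  rw [KernelEquation, hq.dirDeriv_dirDeriv_kappa, hq.dirDeriv_dirDeriv_kappa,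
    dirDeriv_zeta_T ht hb, dirDeriv_zeta_TT ht hb, dirDeriv_zeta_S ht hb, dirDeriv_zeta_SS ht hb,
    posTime_eq ht.le, kappa]
  generalize hQ : q (zeta (t, b, s)) = Q at *
  generalize deriv q (zeta (t, b, s)) = Q1 at *
  generalize deriv (deriv q) (zeta (t, b, s)) = Q2 at *
  rw [zeta_eq ht.le hb.le] at hode
  -- `ζ_t² - ζ_s² = -ζ (1 - ζ) (1 + t)⁻²` and `ζ_tt - ζ_ss = -(1 - 2ζ) (1 + t)⁻²`
  have key : ∀ z : ℝ, z = (s ^ 2 - (t - b) ^ 2) / (4 * (1 + t) * (1 + b)) →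
      (-s ^ 2 / (4 * (1 + t) ^ 2 * (1 + b)) - 1 / (4 * (1 + b)) + (1 + b) / (4 * (1 + t) ^ 2)) ^ 2
        - (s / (2 * (1 + t) * (1 + b))) ^ 2 = -(z * (1 - z)) / (1 + t) ^ 2 := by
    rintro z rfl
    field_simp
    ring
  have key2 : ∀ z : ℝ, z = (s ^ 2 - (t - b) ^ 2) / (4 * (1 + t) * (1 + b)) →
      s ^ 2 / (2 * (1 + t) ^ 3 * (1 + b)) - (1 + b) / (2 * (1 + t) ^ 3)
        - 1 / (2 * (1 + t) * (1 + b)) = -(1 - 2 * z) / (1 + t) ^ 2 := by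
    rintro z rfl
    field_simp
    ring
  linear_combination Q2 * key _ rfl + Q1 * key2 _ rfl - 1 / (1 + t) ^ 2 * hode

/-- Derivatives in `b` and `s` of solutions of the kernel equation are solutions. -/
lemma KernelEquation.dirDeriv {k : ℝ × ℝ × ℝ → ℝ} (hk : ContDiff ℝ 3 k) {U : Set (ℝ × ℝ × ℝ)}
    (hU : IsOpen U) (h : ∀ p ∈ U, KernelEquation m k p) {v : ℝ × ℝ × ℝ} (hv : v.1 = 0)
    {p : ℝ × ℝ × ℝ} (hp : p ∈ U) : KernelEquation m (dirDeriv v k) p := by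
  have hk2 : ContDiff ℝ 2 k := hk.of_le (by norm_num)
  have comm : ∀ w, ScaleInvariantWave.dirDeriv v (ScaleInvariantWave.dirDeriv w
      (ScaleInvariantWave.dirDeriv w k)) p = ScaleInvariantWave.dirDeriv w
      (ScaleInvariantWave.dirDeriv w (ScaleInvariantWave.dirDeriv v k)) p := by
    intro w
    rw [dirDeriv_comm (contDiff_dirDeriv (m := 2) hk _)]
    congr 1
    funext p'
    exact dirDeriv_comm hk2 _ _ _
  have d1 : ∀ w, Differentiable ℝ (ScaleInvariantWave.dirDeriv w
      (ScaleInvariantWave.dirDeriv w k)) := fun w =>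
    (contDiff_dirDeriv (m := 1) (contDiff_dirDeriv (m := 2) hk _) _).differentiable (by simp)
  have d2 : Differentiable ℝ k := hk.differentiable (by norm_num)
  have hc : ContDiff ℝ 1 fun p : ℝ × ℝ × ℝ => m / posTime p.1 ^ 2 := by
    have : ContDiff ℝ 1 fun p : ℝ × ℝ × ℝ => posTime p.1 :=
      (contDiff_posTime (m := 1)).comp (by fun_prop)
    exact contDiff_const.div (this.pow 2) fun p => (pow_pos (posTime_pos _) 2).ne'
  -- the coefficient depends on `t` only
  have hcv : ScaleInvariantWave.dirDeriv v (fun p : ℝ × ℝ × ℝ => m / posTime p.1 ^ 2) p = 0 := by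
    have hd := hasDerivAt_dirDeriv (f := fun p : ℝ × ℝ × ℝ => m / posTime p.1 ^ 2) (p := p)
      (v := v) (r := 0) (hc.differentiable one_ne_zero _)
    simp only [zero_smul, add_zero, Prod.fst_add, Prod.smul_fst, hv, smul_zero] at hd
    exact hd.unique (hasDerivAt_const _ _)
  have hz : ScaleInvariantWave.dirDeriv v (fun p => ScaleInvariantWave.dirDeriv dirT
      (ScaleInvariantWave.dirDeriv dirT k) p + (-1) * ScaleInvariantWave.dirDeriv dirS
      (ScaleInvariantWave.dirDeriv dirS k) p + m / posTime p.1 ^ 2 * k p) p = 0 := by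
    have hev : (fun p => ScaleInvariantWave.dirDeriv dirT
      (ScaleInvariantWave.dirDeriv dirT k) p + (-1) * ScaleInvariantWave.dirDeriv dirS
      (ScaleInvariantWave.dirDeriv dirS k) p + m / posTime p.1 ^ 2 * k p) =ᶠ[𝓝 p] fun _ => 0 := by
      filter_upwards [hU.mem_nhds hp] with p' hp'
      have := h p' hp'
      rw [KernelEquation] at this
      linarith
    rw [ScaleInvariantWave.dirDeriv, hev.fderiv_eq]
    simp
  have hcd := hc.differentiable one_ne_zero
  rw [dirDeriv_add ((d1 _ p).fun_add ((d1 _ p).const_mul _)) ((hcd p).fun_mul (d2 p)),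
    dirDeriv_add (d1 _ p) ((d1 _ p).const_mul _), dirDeriv_const_mul (d1 _ p),
    dirDeriv_mul (hcd p) (d2 p), hcv, comm, comm] at hz
  rw [KernelEquation]
  linarith

end Kernel

/-! ### Transmutation of waves -/

section Transmutation

variable {n : ℕ}

local notation "E" => EuclideanSpace ℝ (Fin n)

lemma dirDeriv_primitiveAt_comp {P : Type} [NormedAddCommGroup P] [NormedSpace ℝ P]
    [FiniteDimensional ℝ P] {h : P × ℝ → ℝ} (hh : ContDiff ℝ 1 h) (l : P →L[ℝ] ℝ) (v p : P) :
    dirDeriv v (fun p => primitiveAt h (p, l p)) p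
      = primitiveAt (dirDeriv (v, 0) h) (p, l p) + l v * h (p, l p) := by
  have hd : Differentiable ℝ (primitiveAt h) :=
    (contDiff_primitiveAt (m := 1) hh).differentiable (by simp)
  have := dirDeriv_comp_affine (f := primitiveAt h) ((ContinuousLinearMap.id ℝ P).prod l) 0
    (p := p) (hd _) v
  simp only [zero_add, ContinuousLinearMap.prod_apply, ContinuousLinearMap.id_apply] at this
  rw [this, dirDeriv_primitiveAt hh]

/-- The direction of `t` in the space of points `(β, b, t, x)`. -/
noncomputable abbrev timeDir₄ : ℝ × ℝ × ℝ × E := (0, 0, 1, 0)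

/-- The directions of `x` in the space of points `(β, b, t, x)`. -/
noncomputable abbrev spaceDir₄ (i : Fin n) : ℝ × ℝ × ℝ × E := (0, 0, 0, basisVec i)

/-- The elapsed time `(β, b, t, x) ↦ t - b`. -/
noncomputable def elapsed : ℝ × ℝ × ℝ × E →L[ℝ] ℝ :=
  (ContinuousLinearMap.fst ℝ ℝ E).comp ((ContinuousLinearMap.snd ℝ ℝ (ℝ × E)).comp
      (ContinuousLinearMap.snd ℝ ℝ (ℝ × ℝ × E)))
    - (ContinuousLinearMap.fst ℝ ℝ (ℝ × E)).comp (ContinuousLinearMap.snd ℝ ℝ (ℝ × ℝ × E))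

@[simp] lemma elapsed_apply (p : ℝ × ℝ × ℝ × E) : elapsed p = p.2.2.1 - p.2.1 := by
  simp [elapsed]

/-- The linear map `(β, b, t, x) ↦ (β, t - b, x)`. -/
noncomputable def wavePoint : ℝ × ℝ × ℝ × E →L[ℝ] ℝ × ℝ × E :=
  (ContinuousLinearMap.fst ℝ ℝ (ℝ × ℝ × E)).prod (elapsed.prod
    ((ContinuousLinearMap.snd ℝ ℝ E).comp ((ContinuousLinearMap.snd ℝ ℝ (ℝ × E)).comp
      (ContinuousLinearMap.snd ℝ ℝ (ℝ × ℝ × E)))))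

@[simp] lemma wavePoint_apply (p : ℝ × ℝ × ℝ × E) :
    wavePoint p = (p.1, p.2.2.1 - p.2.1, p.2.2.2) := by
  simp [wavePoint]

/-- The linear map `(β, b, t, x) ↦ (t, b, t - b)`. -/
noncomputable def diagPoint : ℝ × ℝ × ℝ × E →L[ℝ] ℝ × ℝ × ℝ :=
  ((ContinuousLinearMap.fst ℝ ℝ E).comp ((ContinuousLinearMap.snd ℝ ℝ (ℝ × E)).comp
      (ContinuousLinearMap.snd ℝ ℝ (ℝ × ℝ × E)))).prod
    (((ContinuousLinearMap.fst ℝ ℝ (ℝ × E)).comp (ContinuousLinearMap.snd ℝ ℝ (ℝ × ℝ × E))).prod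
      elapsed)

@[simp] lemma diagPoint_apply (p : ℝ × ℝ × ℝ × E) :
    diagPoint p = (p.2.2.1, p.2.1, p.2.2.1 - p.2.1) := by
  simp [diagPoint]

/-- The linear map `((β, b, t, x), s) ↦ (β, s, x)`. -/
noncomputable def innerWavePoint : (ℝ × ℝ × ℝ × E) × ℝ →L[ℝ] ℝ × ℝ × E :=
  ((ContinuousLinearMap.fst ℝ ℝ (ℝ × ℝ × E)).comp (ContinuousLinearMap.fst ℝ _ ℝ)).prod
    ((ContinuousLinearMap.snd ℝ (ℝ × ℝ × ℝ × E) ℝ).prod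
    (((ContinuousLinearMap.snd ℝ ℝ E).comp ((ContinuousLinearMap.snd ℝ ℝ (ℝ × E)).comp
      (ContinuousLinearMap.snd ℝ ℝ (ℝ × ℝ × E)))).comp (ContinuousLinearMap.fst ℝ _ ℝ)))

@[simp] lemma innerWavePoint_apply (z : (ℝ × ℝ × ℝ × E) × ℝ) :
    innerWavePoint z = (z.1.1, z.2, z.1.2.2.2) := by
  simp [innerWavePoint]

/-- The linear map `((β, b, t, x), s) ↦ (t, b, s)`. -/
noncomputable def innerKernelPoint : (ℝ × ℝ × ℝ × E) × ℝ →L[ℝ] ℝ × ℝ × ℝ :=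
  (((ContinuousLinearMap.fst ℝ ℝ E).comp ((ContinuousLinearMap.snd ℝ ℝ (ℝ × E)).comp
      (ContinuousLinearMap.snd ℝ ℝ (ℝ × ℝ × E)))).comp (ContinuousLinearMap.fst ℝ _ ℝ)).prod
    ((((ContinuousLinearMap.fst ℝ ℝ (ℝ × E)).comp (ContinuousLinearMap.snd ℝ ℝ (ℝ × ℝ × E))).comp
      (ContinuousLinearMap.fst ℝ _ ℝ)).prod (ContinuousLinearMap.snd ℝ (ℝ × ℝ × ℝ × E) ℝ))

@[simp] lemma innerKernelPoint_apply (z : (ℝ × ℝ × ℝ × E) × ℝ) :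
    innerKernelPoint z = (z.1.2.2.1, z.1.2.1, z.2) := by
  simp [innerKernelPoint]

/-- The integrand `V(β, s, x) k(t, b, s)` as a function of `((β, b, t, x), s)`. -/
noncomputable def transmuteIntegrand (V : ℝ × ℝ × E → ℝ) (k : ℝ × ℝ × ℝ → ℝ) :
    (ℝ × ℝ × ℝ × E) × ℝ → ℝ :=
  fun z => V (innerWavePoint z) * k (innerKernelPoint z)

/-- The transmutation `c V(t - b, x) + ∫_0^{t-b} V(s, x) k(t, b, s) ds` of a solution `V` of the
wave equation, as a function of `(β, b, t, x)`. -/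
noncomputable def transmute (c : ℝ) (V : ℝ × ℝ × E → ℝ) (k : ℝ × ℝ × ℝ → ℝ) :
    ℝ × ℝ × ℝ × E → ℝ :=
  fun p => c * V (wavePoint p) + primitiveAt (transmuteIntegrand V k) (p, elapsed p)

variable {c m : ℝ} {V : ℝ × ℝ × EuclideanSpace ℝ (Fin n) → ℝ} {k : ℝ × ℝ × ℝ → ℝ}

lemma contDiff_transmuteIntegrand {j : ℕ} (hV : ContDiff ℝ j V) (hk : ContDiff ℝ j k) :
    ContDiff ℝ j (transmuteIntegrand V k) :=
  (hV.comp innerWavePoint.contDiff).mul (hk.comp innerKernelPoint.contDiff)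

lemma contDiff_transmute {j : ℕ} (hV : ContDiff ℝ j V) (hk : ContDiff ℝ j k) :
    ContDiff ℝ j (transmute c V k) := by
  refine (contDiff_const.mul (hV.comp wavePoint.contDiff)).add ?_
  exact (contDiff_primitiveAt (contDiff_transmuteIntegrand hV hk)).comp
    (contDiff_id.prodMk elapsed.contDiff)

lemma dirDeriv_transmuteIntegrand (hV : ContDiff ℝ 1 V) (hk : ContDiff ℝ 1 k)
    (v : ℝ × ℝ × ℝ × E) (r : ℝ) (z : (ℝ × ℝ × ℝ × E) × ℝ) :
    dirDeriv (v, r) (transmuteIntegrand V k) z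
      = dirDeriv (innerWavePoint (v, r)) V (innerWavePoint z) * k (innerKernelPoint z)
        + V (innerWavePoint z) * dirDeriv (innerKernelPoint (v, r)) k (innerKernelPoint z) := by
  have hVd := hV.differentiable one_ne_zero
  have hkd := hk.differentiable one_ne_zero
  have h1 := dirDeriv_comp_affine innerWavePoint 0 (p := z) (hVd _) (v, r)
  have h2 := dirDeriv_comp_affine innerKernelPoint 0 (p := z) (hkd _) (v, r)
  simp only [zero_add] at h1 h2
  unfold transmuteIntegrand
  rw [dirDeriv_mul (by fun_prop) (by fun_prop), h1, h2]

/-- Leibniz' rule for the transmutation; the last term is the boundary term at `s = t - b`. -/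
lemma dirDeriv_transmute (hV : ContDiff ℝ 1 V) (hk : ContDiff ℝ 1 k)
    (v p : ℝ × ℝ × ℝ × E) :
    dirDeriv v (transmute c V k) p = c * dirDeriv (wavePoint v) V (wavePoint p)
      + (primitiveAt (dirDeriv (v, 0) (transmuteIntegrand V k)) (p, elapsed p)
        + elapsed v * (V (wavePoint p) * k (diagPoint p))) := by
  have hVd := hV.differentiable one_ne_zero
  have hI : ContDiff ℝ 1 (transmuteIntegrand V k) := contDiff_transmuteIntegrand (j := 1) hV hk
  have h1 := dirDeriv_comp_affine (f := V) wavePoint 0 (p := p) (hVd _) v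
  simp only [zero_add] at h1
  have hpd : Differentiable ℝ fun p : ℝ × ℝ × ℝ × E =>
      primitiveAt (transmuteIntegrand V k) (p, elapsed p) :=
    ((contDiff_primitiveAt (m := 1) hI).comp
      (contDiff_id.prodMk elapsed.contDiff)).differentiable (by simp)
  unfold transmute
  rw [dirDeriv_add (by fun_prop) (hpd p), dirDeriv_const_mul (by fun_prop), h1,
    dirDeriv_primitiveAt_comp hI]
  simp [transmuteIntegrand]

lemma dirDeriv_space_transmute (hV : ContDiff ℝ 1 V) (hk : ContDiff ℝ 1 k) (i : Fin n) :
    dirDeriv (spaceDir₄ i) (transmute c V k) = transmute c (dirDeriv (spaceDir i) V) k := by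
  funext p
  rw [dirDeriv_transmute hV hk, transmute]
  have e : dirDeriv (spaceDir₄ i, (0 : ℝ)) (transmuteIntegrand V k)
      = transmuteIntegrand (dirDeriv (spaceDir i) V) k := by
    funext z
    rw [dirDeriv_transmuteIntegrand hV hk]
    simp [transmuteIntegrand, dirDeriv, Prod.mk_zero_zero]
  rw [e]
  simp

lemma innerWavePoint_timeDir₄ : innerWavePoint ((timeDir₄ : ℝ × ℝ × ℝ × E), (0 : ℝ)) = 0 := by
  simp [Prod.mk_zero_zero]

lemma innerKernelPoint_timeDir₄ :
    innerKernelPoint ((timeDir₄ : ℝ × ℝ × ℝ × E), (0 : ℝ)) = dirT := by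
  simp

lemma dirDeriv_time_transmute (hV : ContDiff ℝ 1 V) (hk : ContDiff ℝ 1 k) (p : ℝ × ℝ × ℝ × E) :
    dirDeriv timeDir₄ (transmute c V k) p = c * dirDeriv timeDir V (wavePoint p)
      + (primitiveAt (transmuteIntegrand V (dirDeriv dirT k)) (p, elapsed p)
        + V (wavePoint p) * k (diagPoint p)) := by
  rw [dirDeriv_transmute hV hk]
  have e : dirDeriv ((timeDir₄ : ℝ × ℝ × ℝ × E), (0 : ℝ)) (transmuteIntegrand V k)
      = transmuteIntegrand V (dirDeriv dirT k) := by
    funext z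
    rw [dirDeriv_transmuteIntegrand hV hk, innerWavePoint_timeDir₄, innerKernelPoint_timeDir₄]
    simp [transmuteIntegrand, dirDeriv]
  rw [e]
  simp

lemma primitiveAt_transmuteIntegrand (β b t : ℝ) (x : E) :
    primitiveAt (transmuteIntegrand V k) ((β, b, t, x), elapsed (β, b, t, x))
      = ∫ s in (0 : ℝ)..(t - b), V (β, s, x) * k (t, b, s) := by
  simp [primitiveAt, transmuteIntegrand]

lemma dirLap_transmute (hV : ContDiff ℝ 2 V) (hk : ContDiff ℝ 1 k) (β b t : ℝ) (x : E) :
    dirLap spaceDir₄ (transmute c V k) (β, b, t, x) = c * dirLap spaceDir V (β, t - b, x)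
      + ∫ s in (0 : ℝ)..(t - b), dirLap spaceDir V (β, s, x) * k (t, b, s) := by
  have h1 : ∀ i, dirDeriv (spaceDir₄ i) (dirDeriv (spaceDir₄ i) (transmute c V k))
      = transmute c (dirDeriv (spaceDir i) (dirDeriv (spaceDir i) V)) k := by
    intro i
    rw [dirDeriv_space_transmute (hV.of_le (by norm_num)) hk,
      dirDeriv_space_transmute (contDiff_dirDeriv (m := 1) hV _) hk]
  have hkc := hk.continuous
  have hc2 : ∀ i : Fin n, Continuous (dirDeriv (spaceDir i) (dirDeriv (spaceDir i) V)) := fun i =>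
    continuous_dirDeriv (contDiff_dirDeriv (m := 1) hV _) _
  unfold dirLap
  simp only [h1, transmute, primitiveAt_transmuteIntegrand, wavePoint_apply, Finset.sum_mul]
  rw [intervalIntegral.integral_finsetSum, Finset.sum_add_distrib, Finset.mul_sum]
  intro i _
  have := hc2 i
  exact Continuous.intervalIntegrable (by fun_prop) _ _

lemma hasDerivAt_wave_time (hV : Differentiable ℝ V) (β s : ℝ) (x : E) :
    HasDerivAt (fun s => V (β, s, x)) (dirDeriv timeDir V (β, s, x)) s := by
  have := hasDerivAt_dirDeriv (f := V) (p := (β, 0, x)) (v := timeDir) (r := s) (hV _)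
  simpa using this

/-- The transmutation of a solution of the wave equation solves
`T_tt - ΔT + m (1 + t)⁻² T = 0`, if the kernel solves the corresponding equation in `(t, s)` and
satisfies one condition on the characteristic `s = t - b` and one on `s = 0`. -/
lemma transmute_equation (hV : ContDiff ℝ 2 V) (hk : ContDiff ℝ 2 k)
    (hwave : ∀ p, dirDeriv timeDir (dirDeriv timeDir V) p = dirLap spaceDir V p)
    {β b t : ℝ} {x : E} (hkern : ∀ s ∈ uIcc 0 (t - b), KernelEquation m k (t, b, s))
    (hdiag : 2 * dirDeriv (dirT + dirS) k (t, b, t - b) + m / posTime t ^ 2 * c = 0)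
    (hbd : dirDeriv timeDir V (β, 0, x) * k (t, b, 0) - V (β, 0, x) * dirDeriv dirS k (t, b, 0) = 0) :
    dirDeriv timeDir₄ (dirDeriv timeDir₄ (transmute c V k)) (β, b, t, x)
      - dirLap spaceDir₄ (transmute c V k) (β, b, t, x)
      + m / posTime t ^ 2 * transmute c V k (β, b, t, x) = 0 := by
  have hV1 : ContDiff ℝ 1 V := hV.of_le (by norm_num)
  have hk1 : ContDiff ℝ 1 k := hk.of_le (by norm_num)
  have hVt : ContDiff ℝ 1 (dirDeriv timeDir V) := contDiff_dirDeriv (m := 1) hV _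
  have hkt : ContDiff ℝ 1 (dirDeriv dirT k) := contDiff_dirDeriv (m := 1) hk _
  have hks : ContDiff ℝ 1 (dirDeriv dirS k) := contDiff_dirDeriv (m := 1) hk _
  have dV := hV1.differentiable one_ne_zero
  have dk := hk1.differentiable one_ne_zero
  have dVt := hVt.differentiable one_ne_zero
  have dks := hks.differentiable one_ne_zero
  have cV := hV1.continuous
  have ck := hk1.continuous
  have cVtt := continuous_dirDeriv hVt timeDir
  have cktt := continuous_dirDeriv hkt dirT
  have ckss := continuous_dirDeriv hks dirS
  -- the second time derivative
  have e1 : dirDeriv timeDir₄ (transmute c V k) = fun p => c * dirDeriv timeDir V (wavePoint p)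
      + (primitiveAt (transmuteIntegrand V (dirDeriv dirT k)) (p, elapsed p)
        + V (wavePoint p) * k (diagPoint p)) := funext (dirDeriv_time_transmute hV1 hk1)
  have hI : ContDiff ℝ 1 (transmuteIntegrand V (dirDeriv dirT k)) :=
    contDiff_transmuteIntegrand (j := 1) hV1 hkt
  have hpd : Differentiable ℝ fun p : ℝ × ℝ × ℝ × E =>
      primitiveAt (transmuteIntegrand V (dirDeriv dirT k)) (p, elapsed p) :=
    ((contDiff_primitiveAt (m := 1) hI).comp
      (contDiff_id.prodMk elapsed.contDiff)).differentiable (by simp)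
  have e2 : dirDeriv timeDir₄ (dirDeriv timeDir₄ (transmute c V k)) (β, b, t, x)
      = c * dirDeriv timeDir (dirDeriv timeDir V) (β, t - b, x)
        + ((∫ s in (0 : ℝ)..(t - b), V (β, s, x) * dirDeriv dirT (dirDeriv dirT k) (t, b, s))
          + V (β, t - b, x) * dirDeriv dirT k (t, b, t - b)
          + (dirDeriv timeDir V (β, t - b, x) * k (t, b, t - b)
            + V (β, t - b, x) * dirDeriv (dirT + dirS) k (t, b, t - b))) := by
    have a1 := dirDeriv_comp_affine (f := dirDeriv timeDir V) wavePoint 0 (p := (β, b, t, x))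
      (dVt _) timeDir₄
    have a2 := dirDeriv_comp_affine (f := V) wavePoint 0 (p := (β, b, t, x)) (dV _) timeDir₄
    have a3 := dirDeriv_comp_affine (f := k) (diagPoint (n := n)) 0 (p := (β, b, t, x)) (dk _)
      timeDir₄
    simp only [zero_add] at a1 a2 a3
    have a4 : dirDeriv ((timeDir₄ : ℝ × ℝ × ℝ × E), (0 : ℝ))
        (transmuteIntegrand V (dirDeriv dirT k))
        = transmuteIntegrand V (dirDeriv dirT (dirDeriv dirT k)) := by
      funext z
      rw [dirDeriv_transmuteIntegrand hV1 hkt, innerWavePoint_timeDir₄, innerKernelPoint_timeDir₄]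
      simp [transmuteIntegrand, dirDeriv]
    rw [e1, dirDeriv_add (by fun_prop) ((hpd _).fun_add (by fun_prop)),
      dirDeriv_add (hpd _) (by fun_prop), dirDeriv_const_mul (by fun_prop),
      dirDeriv_mul (f := fun p => V (wavePoint p)) (by fun_prop) (by fun_prop),
      dirDeriv_primitiveAt_comp hI, a1, a2, a3, a4, primitiveAt_transmuteIntegrand]
    simp [transmuteIntegrand]
  -- two integrations by parts in `s`
  have e3 : ∫ s in (0 : ℝ)..(t - b), (dirDeriv timeDir (dirDeriv timeDir V) (β, s, x) * k (t, b, s)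
        - V (β, s, x) * dirDeriv dirS (dirDeriv dirS k) (t, b, s))
      = dirDeriv timeDir V (β, t - b, x) * k (t, b, t - b)
        - V (β, t - b, x) * dirDeriv dirS k (t, b, t - b) := by
    have := intervalIntegral.integral_eq_sub_of_hasDerivAt (a := 0) (b := t - b)
      (f := fun s => dirDeriv timeDir V (β, s, x) * k (t, b, s)
        - V (β, s, x) * dirDeriv dirS k (t, b, s))
      (f' := fun s => dirDeriv timeDir (dirDeriv timeDir V) (β, s, x) * k (t, b, s)
        - V (β, s, x) * dirDeriv dirS (dirDeriv dirS k) (t, b, s))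
      (fun s _ => by
        refine (((hasDerivAt_wave_time dVt β s x).fun_mul (hasDerivAt_dirS dk t b s)).fun_sub
          ((hasDerivAt_wave_time dV β s x).fun_mul (hasDerivAt_dirS dks t b s))).congr_deriv ?_
        ring)
      (Continuous.intervalIntegrable (by fun_prop) _ _)
    rw [this, hbd, sub_zero]
  have i1 : IntervalIntegrable (fun s => dirDeriv timeDir (dirDeriv timeDir V) (β, s, x)
      * k (t, b, s)) volume 0 (t - b) := Continuous.intervalIntegrable (by fun_prop) _ _
  have i2 : IntervalIntegrable (fun s => V (β, s, x) * dirDeriv dirS (dirDeriv dirS k) (t, b, s))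
      volume 0 (t - b) := Continuous.intervalIntegrable (by fun_prop) _ _
  have i3 : IntervalIntegrable (fun s => V (β, s, x) * dirDeriv dirT (dirDeriv dirT k) (t, b, s))
      volume 0 (t - b) := Continuous.intervalIntegrable (by fun_prop) _ _
  have i4 : IntervalIntegrable (fun s => V (β, s, x) * k (t, b, s))
      volume 0 (t - b) := Continuous.intervalIntegrable (by fun_prop) _ _
  have e4 : (∫ s in (0 : ℝ)..(t - b), V (β, s, x) * dirDeriv dirT (dirDeriv dirT k) (t, b, s))
      - (∫ s in (0 : ℝ)..(t - b), V (β, s, x) * dirDeriv dirS (dirDeriv dirS k) (t, b, s))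
      + m / posTime t ^ 2 * ∫ s in (0 : ℝ)..(t - b), V (β, s, x) * k (t, b, s) = 0 := by
    rw [← intervalIntegral.integral_const_mul, ← intervalIntegral.integral_sub i3 i2,
      ← intervalIntegral.integral_add (i3.sub i2) (i4.const_mul _)]
    rw [intervalIntegral.integral_congr (g := fun _ => (0 : ℝ))]
    · simp
    · intro s hs
      have := hkern s hs
      rw [KernelEquation] at this
      simp only at this ⊢
      linear_combination V (β, s, x) * this
  rw [intervalIntegral.integral_sub i1 i2] at e3
  have hdir := dirDeriv_add_dir dirT dirS k (t, b, t - b)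
  rw [e2, dirLap_transmute hV hk1, transmute, primitiveAt_transmuteIntegrand]
  simp only [← hwave, wavePoint_apply]
  rw [hdir] at hdiag ⊢
  linear_combination e4 - e3 + V (β, t - b, x) * hdiag

end Transmutation

/-! ### Integrals over the starting time -/

section OuterIntegral

variable {P F : Type} [NormedAddCommGroup P] [NormedSpace ℝ P] [FiniteDimensional ℝ P]
  [NormedAddCommGroup F] [NormedSpace ℝ F] [CompleteSpace F]

/-- The derivative of `Φ` in the variables of `P`. -/
noncomputable def innerDeriv (Φ : ℝ × ℝ × P → F) (z : ℝ × ℝ × P) : P →L[ℝ] F :=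
  (fderiv ℝ Φ z).comp ((ContinuousLinearMap.inr ℝ ℝ (ℝ × P)).comp (ContinuousLinearMap.inr ℝ ℝ P))

lemma hasFDerivAt_innerDeriv {Φ : ℝ × ℝ × P → F} (hΦ : Differentiable ℝ Φ) (β b : ℝ) (p : P) :
    HasFDerivAt (fun p => Φ (β, b, p)) (innerDeriv Φ (β, b, p)) p :=
  (hΦ (β, b, p)).hasFDerivAt.comp p
    ((hasFDerivAt_prodMk_right (𝕜 := ℝ) β (b, p)).comp p (hasFDerivAt_prodMk_right (𝕜 := ℝ) b p))

lemma contDiff_innerDeriv {m : ℕ} {Φ : ℝ × ℝ × P → F}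
    (hΦ : ContDiff ℝ ((m + 1 : ℕ) : WithTop ℕ∞) Φ) : ContDiff ℝ m (innerDeriv Φ) := by
  have : ContDiff ℝ m (fderiv ℝ Φ) := hΦ.fderiv_right (by push_cast; exact le_rfl)
  exact this.clm_comp contDiff_const

/-- The integral `∫_0^{l p} Φ(√b, b, p) db` over the starting times `b`, where `l p` is the final time.
The first variable of `Φ` carries the source, reparametrised by `b = β²`. -/
noncomputable def outerIntegral (l : P →L[ℝ] ℝ) (Φ : ℝ × ℝ × P → F) (p : P) : F :=
  ∫ b in (0 : ℝ)..(l p), Φ (√b, b, p)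

lemma hasFDerivAt_outerIntegral (l : P →L[ℝ] ℝ) {Φ : ℝ × ℝ × P → F} (hΦ : ContDiff ℝ 1 Φ) (p : P) :
    HasFDerivAt (outerIntegral l Φ)
      (outerIntegral l (innerDeriv Φ) p + l.smulRight (Φ (√(l p), l p, p))) p := by
  have hc := hΦ.continuous
  have hc' : Continuous (innerDeriv Φ) := (contDiff_innerDeriv (m := 0) hΦ).continuous
  exact hasFDerivAt_integral_variable_limit (G := fun p b => Φ (√b, b, p))
    (G' := fun p b => innerDeriv Φ (√b, b, p)) (by fun_prop) (by fun_prop)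
    (fun p b => hasFDerivAt_innerDeriv (hΦ.differentiable one_ne_zero) _ _ _) l p

lemma continuous_outerIntegral (l : P →L[ℝ] ℝ) {Φ : ℝ × ℝ × P → F} (hΦ : Continuous Φ) :
    Continuous (outerIntegral l Φ) :=
  intervalIntegral.continuous_parametric_intervalIntegral_of_continuous
    (f := fun p b => Φ (√b, b, p)) (by fun_prop) l.continuous

lemma contDiff_one_outerIntegral (l : P →L[ℝ] ℝ) {Φ : ℝ × ℝ × P → F} (hΦ : ContDiff ℝ 1 Φ) :
    ContDiff ℝ 1 (outerIntegral l Φ) := by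
  rw [show (1 : WithTop ℕ∞) = ((0 : ℕ) : WithTop ℕ∞) + 1 by simp, contDiff_succ_iff_hasFDerivAt]
  refine ⟨_, ?_, hasFDerivAt_outerIntegral l hΦ⟩
  rw [Nat.cast_zero, contDiff_zero]
  have hc := hΦ.continuous
  have hc' := continuous_outerIntegral l (contDiff_innerDeriv (m := 0) hΦ).continuous
  refine hc'.add ?_
  have : Continuous fun p => Φ (√(l p), l p, p) := by fun_prop
  exact ((ContinuousLinearMap.smulRightL ℝ P F l).continuous).comp this

/-- If the integrand vanishes at the upper limit, then the integral is of class `C²`, although the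
integrand is not differentiable in `b` at `b = 0`. -/
lemma contDiff_two_outerIntegral (l : P →L[ℝ] ℝ) {Φ : ℝ × ℝ × P → F} (hΦ : ContDiff ℝ 2 Φ)
    (h0 : ∀ p β, Φ (β, l p, p) = 0) : ContDiff ℝ 2 (outerIntegral l Φ) := by
  rw [show (2 : WithTop ℕ∞) = ((1 : ℕ) : WithTop ℕ∞) + 1 by norm_num, contDiff_succ_iff_hasFDerivAt]
  refine ⟨outerIntegral l (innerDeriv Φ),
    by simpa using contDiff_one_outerIntegral l (contDiff_innerDeriv (m := 1) hΦ), fun p => ?_⟩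
  have := hasFDerivAt_outerIntegral l (hΦ.of_le (by norm_num)) p
  simpa [h0] using this

lemma dirDeriv_outerIntegral (l : P →L[ℝ] ℝ) {Φ : ℝ × ℝ × P → ℝ} (hΦ : ContDiff ℝ 1 Φ) (v p : P) :
    dirDeriv v (outerIntegral l Φ) p = outerIntegral l (dirDeriv (0, 0, v) Φ) p
      + l v * Φ (√(l p), l p, p) := by
  have hc' : Continuous (innerDeriv Φ) := (contDiff_innerDeriv (m := 0) hΦ).continuous
  rw [dirDeriv, (hasFDerivAt_outerIntegral l hΦ p).fderiv]
  simp only [_root_.add_apply, ContinuousLinearMap.smulRight_apply, smul_eq_mul,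
    outerIntegral]
  rw [ContinuousLinearMap.intervalIntegral_apply]
  · simp [innerDeriv, dirDeriv]
  · exact Continuous.intervalIntegrable (by fun_prop) _ _

end OuterIntegral

/-! ### Derivatives of the reduced kernel -/

section DerivedKernels

variable {m c : ℝ} {q : ℝ → ℝ}

/-- The kernel `-∂_v q(ζ)`. With `v` the direction of `s` it belongs to the data `u₁` and `f`,
with `v` the direction of `b` to the data `u₀`. -/
noncomputable def derivedKernel (v : ℝ × ℝ × ℝ) (q : ℝ → ℝ) (p : ℝ × ℝ × ℝ) : ℝ :=
  (-1) * dirDeriv v (kappa q) p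

lemma IsRealProfile.contDiff_derivedKernel (hq : IsRealProfile m c q) (v : ℝ × ℝ × ℝ) {j : ℕ} :
    ContDiff ℝ j (derivedKernel v q) :=
  contDiff_const.mul (contDiff_dirDeriv (hq.contDiff_kappa (j := ((j + 1 : ℕ) : ℕ∞))) v)

lemma IsRealProfile.kernelEquation_derivedKernel (hq : IsRealProfile m c q) {v : ℝ × ℝ × ℝ}
    (hv : v.1 = 0) {p : ℝ × ℝ × ℝ} (hp : p ∈ kernelDomain) :
    KernelEquation m (derivedKernel v q) p := by
  have hk : ContDiff ℝ 3 (kappa q) := hq.contDiff_kappa (j := 3)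
  have h := KernelEquation.dirDeriv hk isOpen_kernelDomain
    (fun p hp => hq.kernelEquation_kappa hp) hv hp
  have h2 : ContDiff ℝ 2 (dirDeriv v (kappa q)) := contDiff_dirDeriv (m := 2) hk v
  have h1 : ∀ w, Differentiable ℝ (dirDeriv w (dirDeriv v (kappa q))) := fun w =>
    (contDiff_dirDeriv (m := 1) h2 w).differentiable (by simp)
  have e : ∀ w, dirDeriv w (dirDeriv w (derivedKernel v q)) p
      = (-1) * dirDeriv w (dirDeriv w (dirDeriv v (kappa q))) p := by
    intro w
    have : dirDeriv w (derivedKernel v q)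
        = fun p => (-1) * dirDeriv w (dirDeriv v (kappa q)) p := by
      funext p
      exact dirDeriv_const_mul (h2.differentiable (by simp) p) _ _
    rw [this, dirDeriv_const_mul (h1 w p)]
  rw [KernelEquation] at h ⊢
  rw [e, e, derivedKernel]
  linear_combination -h

/-- Both kernels have the same values on the characteristic `s = t - b`. -/
lemma IsRealProfile.derivedKernel_diag (hq : IsRealProfile m c q) {t b : ℝ} (ht : -1 / 2 < t)
    (hb : -1 / 2 < b) {v : ℝ × ℝ × ℝ} (hv : v = dirS ∨ v = dirB) :
    derivedKernel v q (t, b, t - b) = -(m * c) * (1 / (2 * (1 + b)) - 1 / (2 * (1 + t))) := by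
  have ht0 : 1 + t ≠ 0 := by linarith
  have hb0 : 1 + b ≠ 0 := by linarith
  have hz : zeta (t, b, t - b) = 0 := by rw [zeta_eq ht.le hb.le]; simp
  rw [derivedKernel, hq.dirDeriv_kappa, hz, hq.deriv_zero]
  rcases hv with rfl | rfl
  · rw [dirDeriv_zeta_S ht hb]
    field_simp
    ring
  · rw [dirDeriv_zeta_B ht hb]
    field_simp
    ring

/-- The condition of `transmute_equation` on the characteristic `s = t - b`, obtained by differentiating
the value there along the characteristic. -/
lemma IsRealProfile.derivedKernel_diag_deriv (hq : IsRealProfile m c q) {t b : ℝ}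
    (ht : -1 / 2 < t) (hb : -1 / 2 < b) {v : ℝ × ℝ × ℝ} (hv : v = dirS ∨ v = dirB) :
    2 * dirDeriv (dirT + dirS) (derivedKernel v q) (t, b, t - b) + m / posTime t ^ 2 * c = 0 := by
  have ht0 : 1 + t ≠ 0 := by linarith
  have h1 : HasDerivAt (fun r : ℝ => derivedKernel v q (r, b, r - b))
      (dirDeriv (dirT + dirS) (derivedKernel v q) (t, b, t - b)) t := by
    have := hasDerivAt_dirDeriv (f := derivedKernel v q) (p := (0, b, -b)) (v := dirT + dirS)
      (r := t) ((hq.contDiff_derivedKernel v (j := 1)).differentiable (by simp) _)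
    simpa [sub_eq_neg_add] using this
  have h2 : HasDerivAt (fun r : ℝ => -(m * c) * (1 / (2 * (1 + b)) - 1 / (2 * (1 + r))))
      (-(m * c) * (1 / (2 * (1 + t) ^ 2))) t := by
    refine ((((hasDerivAt_const t (1 : ℝ)).fun_div (((hasDerivAt_id t).const_add 1).const_mul 2)
      (by simpa using ht0)).const_sub _).const_mul _).congr_deriv ?_
    simp only [id]
    field_simp
    ring
  have h3 := h1.unique (h2.congr_of_eventuallyEq (by
    filter_upwards [Ioi_mem_nhds ht] with r hr using hq.derivedKernel_diag hr hb hv))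
  rw [h3, posTime_eq ht.le]
  field_simp
  ring

lemma IsRealProfile.derivedKernel_dirS_zero (hq : IsRealProfile m c q) {t b : ℝ} (ht : -1 / 2 < t)
    (hb : -1 / 2 < b) : derivedKernel dirS q (t, b, 0) = 0 := by
  rw [derivedKernel, hq.dirDeriv_kappa, dirDeriv_zeta_S ht hb]
  simp

/-- The kernel is an even function of `s`. -/
lemma IsRealProfile.dirDeriv_derivedKernel_dirB_zero (hq : IsRealProfile m c q) (t b : ℝ) :
    dirDeriv dirS (derivedKernel dirB q) (t, b, 0) = 0 := by
  have hd : Differentiable ℝ (kappa q) := (hq.contDiff_kappa (j := 1)).differentiable (by simp)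
  have heven : ∀ s, derivedKernel dirB q (t, b, -s) = derivedKernel dirB q (t, b, s) := by
    intro s
    have h1 := hasDerivAt_dirB hd t b (-s)
    have h2 := hasDerivAt_dirB hd t b s
    have : (fun b => kappa q (t, b, -s)) = fun b => kappa q (t, b, s) := by
      funext b; simp [kappa, zeta]
    rw [this] at h1
    rw [derivedKernel, derivedKernel, h1.unique h2]
  have h1 := hasDerivAt_dirS ((hq.contDiff_derivedKernel dirB (j := 1)).differentiable (by simp))
    t b 0
  have h2 : HasDerivAt (fun s => derivedKernel dirB q (t, b, -s))
      (-dirDeriv dirS (derivedKernel dirB q) (t, b, 0)) 0 := by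
    have h1' : HasDerivAt (fun s => derivedKernel dirB q (t, b, s))
      (dirDeriv dirS (derivedKernel dirB q) (t, b, 0)) (-0) := by simpa using h1
    simpa [Function.comp_def] using h1'.scomp (0 : ℝ) (hasDerivAt_neg (0 : ℝ))
  have h3 : (fun s => derivedKernel dirB q (t, b, -s)) = fun s => derivedKernel dirB q (t, b, s) :=
    funext heven
  rw [h3] at h2
  have := h1.unique h2
  linarith

end DerivedKernels

/-! ### Transmutation by the derived kernels -/

section TransmutedWaves

variable {n : ℕ} {m c : ℝ} {q : ℝ → ℝ}

local notation "E" => EuclideanSpace ℝ (Fin n)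

/-- A solution of the wave equation that vanishes at time zero is transmuted by the kernel
`-∂_s q(ζ)`. -/
lemma IsRealProfile.transmute_dirS_equation (hq : IsRealProfile m c q) {V : ℝ × ℝ × E → ℝ}
    (hV : ContDiff ℝ 2 V)
    (hwave : ∀ p, dirDeriv timeDir (dirDeriv timeDir V) p = dirLap spaceDir V p)
    {β b t : ℝ} {x : E} (h0 : V (β, 0, x) = 0) (hb : 0 ≤ b) (hbt : b ≤ t) :
    dirDeriv timeDir₄ (dirDeriv timeDir₄ (transmute c V (derivedKernel dirS q))) (β, b, t, x)
      - dirLap spaceDir₄ (transmute c V (derivedKernel dirS q)) (β, b, t, x)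
      + m / posTime t ^ 2 * transmute c V (derivedKernel dirS q) (β, b, t, x) = 0 := by
  refine transmute_equation hV (hq.contDiff_derivedKernel _ (j := 2)) hwave (fun s hs => ?_)
    (hq.derivedKernel_diag_deriv (by linarith) (by linarith) (Or.inl rfl)) ?_
  · rw [uIcc_of_le (by linarith)] at hs
    exact hq.kernelEquation_derivedKernel rfl (mem_kernelDomain hb hs.1 hs.2)
  · rw [h0, hq.derivedKernel_dirS_zero (by linarith) (by linarith)]
    ring

/-- A solution of the wave equation with vanishing initial velocity is transmuted by the kernel
`-∂_b q(ζ)`. -/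
lemma IsRealProfile.transmute_dirB_equation (hq : IsRealProfile m c q) {V : ℝ × ℝ × E → ℝ}
    (hV : ContDiff ℝ 2 V)
    (hwave : ∀ p, dirDeriv timeDir (dirDeriv timeDir V) p = dirLap spaceDir V p)
    {β b t : ℝ} {x : E} (h0 : dirDeriv timeDir V (β, 0, x) = 0) (hb : 0 ≤ b) (hbt : b ≤ t) :
    dirDeriv timeDir₄ (dirDeriv timeDir₄ (transmute c V (derivedKernel dirB q))) (β, b, t, x)
      - dirLap spaceDir₄ (transmute c V (derivedKernel dirB q)) (β, b, t, x)
      + m / posTime t ^ 2 * transmute c V (derivedKernel dirB q) (β, b, t, x) = 0 := by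
  refine transmute_equation hV (hq.contDiff_derivedKernel _ (j := 2)) hwave (fun s hs => ?_)
    (hq.derivedKernel_diag_deriv (by linarith) (by linarith) (Or.inr rfl)) ?_
  · rw [uIcc_of_le (by linarith)] at hs
    exact hq.kernelEquation_derivedKernel rfl (mem_kernelDomain hb hs.1 hs.2)
  · rw [h0, hq.dirDeriv_derivedKernel_dirB_zero]
    ring

lemma transmute_start (V : ℝ × ℝ × E → ℝ) (k : ℝ × ℝ × ℝ → ℝ) (β b : ℝ) (x : E) :
    transmute c V k (β, b, b, x) = c * V (β, 0, x) := by
  rw [transmute, primitiveAt_transmuteIntegrand]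
  simp

lemma dirDeriv_transmute_start {V : ℝ × ℝ × E → ℝ} {k : ℝ × ℝ × ℝ → ℝ} (hV : ContDiff ℝ 1 V)
    (hk : ContDiff ℝ 1 k) (β b : ℝ) (x : E) :
    dirDeriv timeDir₄ (transmute c V k) (β, b, b, x)
      = c * dirDeriv timeDir V (β, 0, x) + V (β, 0, x) * k (b, b, 0) := by
  rw [dirDeriv_time_transmute hV hk, primitiveAt_transmuteIntegrand]
  simp

variable {k : ℕ}

/-- The solution `w` of the wave equation with initial value `φ` and initial velocity zero. -/
noncomputable def waveVelocity (k : ℕ) (φ : ℝ × E → ℝ) : ℝ × ℝ × E → ℝ :=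
  dirDeriv timeDir (waveSol k φ)

lemma contDiff_waveVelocity (hk : 0 < k) (hn : n = 2 * k) {φ : ℝ × E → ℝ} {j : ℕ}
    (hφ : ContDiff ℝ ((j + k : ℕ) : WithTop ℕ∞) φ) : ContDiff ℝ j (waveVelocity k φ) := by
  refine contDiff_dirDeriv (contDiff_waveSol hk hn ?_) _
  rwa [show j + 1 + (k - 1) = j + k by omega]

lemma waveVelocity_wave (hk : 0 < k) (hn : n = 2 * k) {φ : ℝ × E → ℝ}
    (hφ : ContDiff ℝ ((k + 2 : ℕ) : WithTop ℕ∞) φ) (p : ℝ × ℝ × E) :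
    dirDeriv timeDir (dirDeriv timeDir (waveVelocity k φ)) p
      = dirLap spaceDir (waveVelocity k φ) p := by
  have hV : ContDiff ℝ ((3 : ℕ) : WithTop ℕ∞) (waveSol k φ) :=
    contDiff_waveSol hk hn (by rwa [show 3 + (k - 1) = k + 2 by omega])
  unfold waveVelocity
  rw [← dirDeriv_dirLap hV]
  congr 1
  funext p
  exact waveSol_wave hk hn (hφ.of_le (by exact_mod_cast Nat.le_succ _)) p

lemma dirLap_waveSol_zero (hk : 0 < k) (hn : n = 2 * k) {φ : ℝ × E → ℝ}
    (hφ : ContDiff ℝ ((k + 1 : ℕ) : WithTop ℕ∞) φ) (β : ℝ) (x : E) :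
    dirLap spaceDir (waveSol k φ) (β, 0, x) = 0 := by
  have hV : ContDiff ℝ ((2 : ℕ) : WithTop ℕ∞) (waveSol k φ) :=
    contDiff_waveSol hk hn (by rwa [show 2 + (k - 1) = k + 1 by omega])
  have key : ∀ {f : ℝ × ℝ × E → ℝ}, Differentiable ℝ f → (∀ x, f (β, 0, x) = 0) →
      ∀ i x, dirDeriv (spaceDir i) f (β, 0, x) = 0 := by
    intro f hf h0 i x
    have := hasDerivAt_dirDeriv (f := f) (p := (β, 0, x)) (v := spaceDir i) (r := 0) (hf _)
    simp only [Prod.mk_add_mk, Prod.smul_mk, smul_zero, add_zero, zero_smul, h0] at this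
    exact this.unique (hasDerivAt_const _ _)
  refine Finset.sum_eq_zero fun i _ => key ?_ (key ?_ (waveSol_zero k φ β) i) i x
  · exact (contDiff_dirDeriv (m := 1) hV _).differentiable (by simp)
  · exact hV.differentiable (by simp)

lemma dirDeriv_waveVelocity_zero (hk : 0 < k) (hn : n = 2 * k) {φ : ℝ × E → ℝ}
    (hφ : ContDiff ℝ ((k + 1 : ℕ) : WithTop ℕ∞) φ) (β : ℝ) (x : E) :
    dirDeriv timeDir (waveVelocity k φ) (β, 0, x) = 0 := by
  rw [waveVelocity, waveSol_wave hk hn hφ, dirLap_waveSol_zero hk hn hφ]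

end TransmutedWaves

/-! ### Removal of the damping term -/

section Reduction

variable {n : ℕ} {m c : ℝ} {q : ℝ → ℝ}

local notation "E" => EuclideanSpace ℝ (Fin n)

/-- The direction of `t` in the space of points `(t, x)`. -/
noncomputable abbrev timeDir₂ : ℝ × E := (1, 0)

/-- The directions of `x` in the space of points `(t, x)`. -/
noncomputable abbrev spaceDir₂ (i : Fin n) : ℝ × E := (0, basisVec i)

lemma hasDerivAt_timeDir₂ {v : ℝ × E → ℝ} (hv : Differentiable ℝ v) (t : ℝ) (x : E) :
    HasDerivAt (fun t => v (t, x)) (dirDeriv timeDir₂ v (t, x)) t := by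
  have := hasDerivAt_dirDeriv (f := v) (p := (0, x)) (v := timeDir₂) (r := t) (hv _)
  simpa using this

lemma laplacian_slice {v : ℝ × E → ℝ} (hv : ContDiff ℝ 2 v) (t : ℝ) (x : E) :
    Δ (fun x => v (t, x)) x = dirLap spaceDir₂ v (t, x) := by
  have hvx : ContDiff ℝ 2 fun x => v (t, x) := by fun_prop
  rw [laplacian_eq_dirLap hvx]
  have := dirLap_comp_affine hv (ContinuousLinearMap.inr ℝ ℝ E) (t, 0) x basisVec
  simpa using this

lemma hasDerivAt_posTime {t : ℝ} (ht : -1 / 2 < t) : HasDerivAt posTime 1 t := by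
  refine ((hasDerivAt_id t).const_add 1).congr_of_eventuallyEq ?_
  filter_upwards [Ioi_mem_nhds ht] with r hr using posTime_eq (le_of_lt hr)

lemma hasDerivAt_posTime_rpow (r : ℝ) {t : ℝ} (ht : -1 / 2 < t) :
    HasDerivAt (fun t => posTime t ^ r) (r / posTime t * posTime t ^ r) t := by
  have := (hasDerivAt_posTime ht).rpow_const (p := r) (Or.inl (posTime_pos t).ne')
  refine this.congr_deriv ?_
  rw [Real.rpow_sub_one (posTime_pos t).ne']
  ring

/-- Removing the damping term: `u = (1 + t)^{-μ/2} v` solves the Cauchy problem if `v` solves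
`v_tt - Δv + m (1 + t)⁻² v = (1 + t)^{μ/2} g`. -/
lemma isClassicalSolution_of_reduced {μ ν : ℝ} (hm : m = μ * (2 - μ) / 4 + ν ^ 2)
    {v : ℝ × E → ℝ} (hv : ContDiff ℝ 2 v) {g : ℝ → E → ℝ} {u₀ u₁ : E → ℝ}
    (heq : ∀ t, 0 < t → ∀ x, dirDeriv timeDir₂ (dirDeriv timeDir₂ v) (t, x)
      - dirLap spaceDir₂ v (t, x) + m / posTime t ^ 2 * v (t, x) = posTime t ^ (μ / 2) * g t x)
    (h0 : ∀ x, v (0, x) = u₀ x)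
    (h1 : ∀ x, dirDeriv timeDir₂ v (0, x) = u₁ x + μ / 2 * u₀ x) :
    IsClassicalSolution n μ ν g u₀ u₁ (fun t x => posTime t ^ (-μ / 2) * v (t, x)) := by
  have hvd : Differentiable ℝ v := hv.differentiable (by simp)
  have hvt : Differentiable ℝ (dirDeriv timeDir₂ v) :=
    (contDiff_dirDeriv (m := 1) hv _).differentiable (by simp)
  have hd : ∀ (x : E) (t : ℝ), -1 / 2 < t →
      HasDerivAt (fun s => posTime s ^ (-μ / 2) * v (s, x))
        (posTime t ^ (-μ / 2) * (dirDeriv timeDir₂ v (t, x)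
          + -μ / 2 / posTime t * v (t, x))) t := by
    intro x t ht
    refine ((hasDerivAt_posTime_rpow _ ht).fun_mul (hasDerivAt_timeDir₂ hvd t x)).congr_deriv ?_
    ring
  refine ⟨?_, fun t ht x => ?_, fun x => ?_, fun x => ?_⟩
  · refine ContDiff.contDiffOn (ContDiff.mul ?_ hv)
    exact (contDiff_posTime_rpow (m := 2) _).comp contDiff_fst
  · have ht' : -1 / 2 < t := by linarith
    have hp := (posTime_pos t).ne'
    have e1 : iteratedDeriv 2 (fun s => posTime s ^ (-μ / 2) * v (s, x)) t
        = posTime t ^ (-μ / 2) * (dirDeriv timeDir₂ (dirDeriv timeDir₂ v) (t, x)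
          + -μ / posTime t * dirDeriv timeDir₂ v (t, x)
          + (μ / 2) * (μ / 2 + 1) / posTime t ^ 2 * v (t, x)) := by
      rw [iteratedDeriv_succ, iteratedDeriv_one]
      have hev : deriv (fun s => posTime s ^ (-μ / 2) * v (s, x)) =ᶠ[𝓝 t] fun t =>
          posTime t ^ (-μ / 2) * (dirDeriv timeDir₂ v (t, x)
          + -μ / 2 / posTime t * v (t, x)) := by
        filter_upwards [Ioi_mem_nhds ht'] with r hr using (hd x r hr).deriv
      rw [hev.deriv_eq]
      have h2 := ((hasDerivAt_const t (-μ / 2)).fun_div (hasDerivAt_posTime ht') hp).fun_mul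
        (hasDerivAt_timeDir₂ hvd t x)
      rw [((hasDerivAt_posTime_rpow (-μ / 2) ht').fun_mul
        ((hasDerivAt_timeDir₂ hvt t x).fun_add h2)).deriv]
      field_simp
      ring
    have e2 : Δ (fun x => posTime t ^ (-μ / 2) * v (t, x)) x
        = posTime t ^ (-μ / 2) * dirLap spaceDir₂ v (t, x) := by
      have hvx : ContDiff ℝ 2 fun x => v (t, x) := by fun_prop
      rw [← laplacian_slice hv, laplacian_eq_dirLap hvx, laplacian_eq_dirLap (by fun_prop)]
      exact dirLap_mul_of_const contDiff_const hvx _ (fun _ _ => by simp [dirDeriv]) x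
    have e3 : posTime t ^ (-μ / 2) * posTime t ^ (μ / 2) = 1 := by
      rw [← Real.rpow_add (posTime_pos t)]
      simp [neg_div]
    rw [e1, e2, (hd x t ht').deriv, ← posTime_eq ht'.le]
    have h := heq t ht x
    rw [hm] at h
    have h' : dirDeriv timeDir₂ (dirDeriv timeDir₂ v) (t, x)
        = posTime t ^ (μ / 2) * g t x + dirLap spaceDir₂ v (t, x)
          - (μ * (2 - μ) / 4 + ν ^ 2) / posTime t ^ 2 * v (t, x) := by linarith
    rw [h']
    generalize posTime t ^ (-μ / 2) = A at e3 ⊢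
    generalize posTime t ^ (μ / 2) = B at e3 ⊢
    field_simp
    linear_combination (16 * posTime t ^ 2 * g t x) * e3
  · simp only [h0, posTime_eq (t := 0) (by norm_num)]
    simp
  · have := (hd x 0 (by norm_num)).hasDerivWithinAt (s := Ici 0)
    rw [h1, h0, posTime_eq (t := 0) (by norm_num)] at this
    refine this.congr_deriv ?_
    simp
    ring

end Reduction

/-! ### Solution of the Cauchy problem -/

section Solution

variable {n k : ℕ} {m c : ℝ} {q : ℝ → ℝ}

local notation "E" => EuclideanSpace ℝ (Fin n)

/-- The embedding `(t, x) ↦ (0, 0, t, x)`. -/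
noncomputable def zeroStart : ℝ × E →L[ℝ] ℝ × ℝ × ℝ × E :=
  (ContinuousLinearMap.inr ℝ ℝ (ℝ × ℝ × E)).comp (ContinuousLinearMap.inr ℝ ℝ (ℝ × E))

@[simp] lemma zeroStart_apply (p : ℝ × E) : zeroStart p = (0, 0, p.1, p.2) := rfl

/-- The contribution of the initial data to the solution of the undamped equation. -/
noncomputable def homogeneousPart (k : ℕ) (c : ℝ) (q : ℝ → ℝ) (u₀ u₁ : E → ℝ) :
    ℝ × ℝ × ℝ × E → ℝ :=
  fun p => transmute c (waveVelocity k fun z => u₀ z.2) (derivedKernel dirB q) p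
    + transmute c (waveSol k fun z => u₁ z.2) (derivedKernel dirS q) p

/-- The contribution of the source at time `b` to the solution of the undamped equation. The source
is reparametrised by `b = β²`, and `β` is kept as an independent variable: the function
`F(β, x) = f(β², x)` is smooth on the whole space, even though `f(b, x)` is not defined
for `b < 0`. -/
noncomputable def sourcePart (k : ℕ) (μ c : ℝ) (q : ℝ → ℝ) (F : ℝ × E → ℝ) :
    ℝ × ℝ × ℝ × E → ℝ :=
  fun p => posTime p.2.1 ^ (μ / 2) * transmute c (waveSol k F) (derivedKernel dirS q) p

/-- The solution of the undamped equation, for the reduced kernel `q`. -/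
noncomputable def undamped (k : ℕ) (μ c : ℝ) (q : ℝ → ℝ) (F : ℝ × E → ℝ) (u₀ u₁ : E → ℝ) :
    ℝ × E → ℝ :=
  fun p => homogeneousPart k c q u₀ u₁ (zeroStart p)
    + outerIntegral (ContinuousLinearMap.fst ℝ ℝ E) (sourcePart k μ c q F) p

variable {F : ℝ × EuclideanSpace ℝ (Fin n) → ℝ} {u₀ u₁ : EuclideanSpace ℝ (Fin n) → ℝ} {μ : ℝ}

lemma contDiff_two_waveSol (hk : 0 < k) (hn : n = 2 * k)
    (hF : ContDiff ℝ ((k + 1 : ℕ) : WithTop ℕ∞) F) : ContDiff ℝ 2 (waveSol k F) :=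
  contDiff_waveSol (m := 2) hk hn (by rwa [show 2 + (k - 1) = k + 1 by omega])

lemma contDiff_homogeneousPart (hk : 0 < k) (hn : n = 2 * k) (hq : IsRealProfile m c q)
    (hu₀ : ContDiff ℝ ((k + 2 : ℕ) : WithTop ℕ∞) u₀)
    (hu₁ : ContDiff ℝ ((k + 1 : ℕ) : WithTop ℕ∞) u₁) :
    ContDiff ℝ 2 (homogeneousPart k c q u₀ u₁) := by
  refine ContDiff.add ?_ ?_
  · refine contDiff_transmute (j := 2) (contDiff_waveVelocity hk hn ?_) (hq.contDiff_derivedKernel _)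
    rw [show 2 + k = k + 2 by omega]
    exact hu₀.comp contDiff_snd
  · exact contDiff_transmute (j := 2) (contDiff_two_waveSol hk hn (hu₁.comp contDiff_snd))
      (hq.contDiff_derivedKernel _)

lemma contDiff_sourcePart (hk : 0 < k) (hn : n = 2 * k) (hq : IsRealProfile m c q)
    (hF : ContDiff ℝ ((k + 1 : ℕ) : WithTop ℕ∞) F) (μ : ℝ) :
    ContDiff ℝ 2 (sourcePart k μ c q F) := by
  refine ContDiff.mul ?_ (contDiff_transmute (j := 2) (contDiff_two_waveSol hk hn hF)
      (hq.contDiff_derivedKernel _))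
  exact (contDiff_posTime_rpow (m := 2) _).comp (by fun_prop)

/-- The contribution of the source at time `b` vanishes at time `b`. -/
lemma sourcePart_start (p : ℝ × E) (β : ℝ) :
    sourcePart k μ c q F (β, ContinuousLinearMap.fst ℝ ℝ E p, p) = 0 := by
  obtain ⟨t, x⟩ := p
  simp [sourcePart, transmute_start, waveSol_zero]

lemma contDiff_undamped (hk : 0 < k) (hn : n = 2 * k) (hq : IsRealProfile m c q)
    (hF : ContDiff ℝ ((k + 1 : ℕ) : WithTop ℕ∞) F)
    (hu₀ : ContDiff ℝ ((k + 2 : ℕ) : WithTop ℕ∞) u₀)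
    (hu₁ : ContDiff ℝ ((k + 1 : ℕ) : WithTop ℕ∞) u₁) (μ : ℝ) :
    ContDiff ℝ 2 (undamped k μ c q F u₀ u₁) :=
  ((contDiff_homogeneousPart hk hn hq hu₀ hu₁).comp zeroStart.contDiff).add
    (contDiff_two_outerIntegral _ (contDiff_sourcePart hk hn hq hF μ)
      fun p β => sourcePart_start p β)

lemma dirDeriv_comp_zeroStart {f : ℝ × ℝ × ℝ × E → ℝ} (hf : Differentiable ℝ f) (v p : ℝ × E) :
    dirDeriv v (fun p => f (zeroStart p)) p = dirDeriv (zeroStart v) f (zeroStart p) := by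
  have := dirDeriv_comp_affine (f := f) zeroStart 0 (p := p) (hf _) v
  simpa only [zero_add] using this

/-- The first derivatives of the solution: the boundary term of the integral over `b` vanishes. -/
lemma dirDeriv_undamped (hk : 0 < k) (hn : n = 2 * k) (hq : IsRealProfile m c q)
    (hF : ContDiff ℝ ((k + 1 : ℕ) : WithTop ℕ∞) F)
    (hu₀ : ContDiff ℝ ((k + 2 : ℕ) : WithTop ℕ∞) u₀)
    (hu₁ : ContDiff ℝ ((k + 1 : ℕ) : WithTop ℕ∞) u₁) (μ : ℝ) (v : ℝ × E) :
    dirDeriv v (undamped k μ c q F u₀ u₁) = fun p =>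
      dirDeriv (0, 0, v) (homogeneousPart k c q u₀ u₁) (zeroStart p)
      + outerIntegral (ContinuousLinearMap.fst ℝ ℝ E)
          (dirDeriv (0, 0, v) (sourcePart k μ c q F)) p := by
  funext p
  have hH := contDiff_homogeneousPart hk hn hq hu₀ hu₁
  have hS := contDiff_sourcePart hk hn hq hF μ
  have hHd : Differentiable ℝ (homogeneousPart k c q u₀ u₁) := hH.differentiable (by simp)
  have hS1 : ContDiff ℝ 1 (sourcePart k μ c q F) := hS.of_le (by norm_num)
  unfold undamped
  rw [dirDeriv_add (by fun_prop)
    ((contDiff_one_outerIntegral _ hS1).differentiable (by simp) p),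
    dirDeriv_comp_zeroStart hHd, dirDeriv_outerIntegral _ hS1, sourcePart_start]
  simp

/-- The second derivatives of the solution: the boundary term of the integral over `b`, which only occurs
for time derivatives, produces the source. -/
lemma dirDeriv_dirDeriv_undamped (hk : 0 < k) (hn : n = 2 * k) (hq : IsRealProfile m c q)
    (hF : ContDiff ℝ ((k + 1 : ℕ) : WithTop ℕ∞) F)
    (hu₀ : ContDiff ℝ ((k + 2 : ℕ) : WithTop ℕ∞) u₀)
    (hu₁ : ContDiff ℝ ((k + 1 : ℕ) : WithTop ℕ∞) u₁) (μ : ℝ) (v p : ℝ × E) :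
    dirDeriv v (dirDeriv v (undamped k μ c q F u₀ u₁)) p =
      dirDeriv (0, 0, v) (dirDeriv (0, 0, v) (homogeneousPart k c q u₀ u₁)) (zeroStart p)
      + (∫ b in (0 : ℝ)..p.1, dirDeriv (0, 0, v) (dirDeriv (0, 0, v) (sourcePart k μ c q F))
          (√b, b, p))
      + v.1 * dirDeriv (0, 0, v) (sourcePart k μ c q F) (√p.1, p.1, p) := by
  have hH := contDiff_dirDeriv (m := 1) (contDiff_homogeneousPart hk hn hq hu₀ hu₁) (0, 0, v)
  have hS : ContDiff ℝ 1 _ :=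
    contDiff_dirDeriv (m := 1) (contDiff_sourcePart hk hn hq hF μ) (0, 0, v)
  have hHd := hH.differentiable (by simp)
  rw [dirDeriv_undamped hk hn hq hF hu₀ hu₁, dirDeriv_add (by fun_prop)
    ((contDiff_one_outerIntegral _ hS).differentiable (by simp) p),
    dirDeriv_comp_zeroStart hHd, dirDeriv_outerIntegral _ hS, outerIntegral]
  simp only [ContinuousLinearMap.coe_fst', ← add_assoc]
  rfl

lemma homogeneousPart_equation (hk : 0 < k) (hn : n = 2 * k) (hq : IsRealProfile m c q)
    (hu₀ : ContDiff ℝ ((k + 2 : ℕ) : WithTop ℕ∞) u₀)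
    (hu₁ : ContDiff ℝ ((k + 1 : ℕ) : WithTop ℕ∞) u₁) {t : ℝ} (ht : 0 ≤ t) (x : E) :
    dirDeriv timeDir₄ (dirDeriv timeDir₄ (homogeneousPart k c q u₀ u₁)) (0, 0, t, x)
      - dirLap spaceDir₄ (homogeneousPart k c q u₀ u₁) (0, 0, t, x)
      + m / posTime t ^ 2 * homogeneousPart k c q u₀ u₁ (0, 0, t, x) = 0 := by
  have hU₀ : ContDiff ℝ ((k + 2 : ℕ) : WithTop ℕ∞) fun z : ℝ × E => u₀ z.2 := hu₀.comp contDiff_snd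
  have hU₁ : ContDiff ℝ ((k + 1 : ℕ) : WithTop ℕ∞) fun z : ℝ × E => u₁ z.2 := hu₁.comp contDiff_snd
  have hV0 : ContDiff ℝ 2 (waveVelocity k fun z : ℝ × E => u₀ z.2) :=
    contDiff_waveVelocity (j := 2) hk hn (by rwa [add_comm])
  have hV1 : ContDiff ℝ 2 (waveSol k fun z : ℝ × E => u₁ z.2) := contDiff_two_waveSol hk hn hU₁
  have e0 := hq.transmute_dirB_equation hV0 (waveVelocity_wave hk hn hU₀) (β := 0) (b := 0)
    (t := t) (x := x) (dirDeriv_waveVelocity_zero hk hn (hU₀.of_le (by exact_mod_cast Nat.le_succ _))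
      0 x) le_rfl ht
  have e1 := hq.transmute_dirS_equation hV1 (waveSol_wave hk hn hU₁) (β := 0) (b := 0)
    (t := t) (x := x) (waveSol_zero _ _ _ _) le_rfl ht
  have c0 : ContDiff ℝ 2 (transmute c (waveVelocity k fun z : ℝ × E => u₀ z.2)
    (derivedKernel dirB q)) := contDiff_transmute (j := 2) hV0 (hq.contDiff_derivedKernel _)
  have c1 : ContDiff ℝ 2 (transmute c (waveSol k fun z : ℝ × E => u₁ z.2)
    (derivedKernel dirS q)) := contDiff_transmute (j := 2) hV1 (hq.contDiff_derivedKernel _)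
  have d0 := c0.differentiable (by simp)
  have d1 := c1.differentiable (by simp)
  have et : dirDeriv timeDir₄ (homogeneousPart k c q u₀ u₁) = fun p => _ :=
    funext fun p => dirDeriv_add (d0 p) (d1 p) timeDir₄
  rw [et, dirDeriv_add ((contDiff_dirDeriv (m := 1) c0 _).differentiable (by simp) _)
    ((contDiff_dirDeriv (m := 1) c1 _).differentiable (by simp) _)]
  unfold homogeneousPart
  rw [dirLap_add c0 c1]
  linear_combination e0 + e1

lemma dirDeriv_sourcePart (hk : 0 < k) (hn : n = 2 * k) (hq : IsRealProfile m c q)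
    (hF : ContDiff ℝ ((k + 1 : ℕ) : WithTop ℕ∞) F) (μ : ℝ) (v : ℝ × E) :
    dirDeriv (0, 0, v) (sourcePart k μ c q F) = fun p => posTime p.2.1 ^ (μ / 2) *
      dirDeriv (0, 0, v) (transmute c (waveSol k F) (derivedKernel dirS q)) p := by
  have hT : ContDiff ℝ 2 (transmute c (waveSol k F) (derivedKernel dirS q)) :=
    contDiff_transmute (j := 2) (contDiff_two_waveSol hk hn hF) (hq.contDiff_derivedKernel _)
  funext p
  have hp : ContDiff ℝ 1 fun p : ℝ × ℝ × ℝ × E => posTime p.2.1 ^ (μ / 2) :=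
    (contDiff_posTime_rpow (m := 1) (μ / 2)).comp (by fun_prop)
  have hz : dirDeriv (0, 0, v) (fun p : ℝ × ℝ × ℝ × E => posTime p.2.1 ^ (μ / 2)) p = 0 := by
    have := hasDerivAt_dirDeriv (f := fun p : ℝ × ℝ × ℝ × E => posTime p.2.1 ^ (μ / 2))
      (p := p) (v := (0, 0, v)) (r := 0) (hp.differentiable (by simp) _)
    simp only [Prod.snd_add, Prod.fst_add, Prod.smul_snd, Prod.smul_fst, smul_zero, add_zero,
      zero_smul] at this
    exact this.unique (hasDerivAt_const _ _)
  unfold sourcePart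
  rw [dirDeriv_mul (hp.differentiable (by simp) _) (hT.differentiable (by simp) _), hz]
  ring

lemma dirDeriv_dirDeriv_sourcePart (hk : 0 < k) (hn : n = 2 * k) (hq : IsRealProfile m c q)
    (hF : ContDiff ℝ ((k + 1 : ℕ) : WithTop ℕ∞) F) (μ : ℝ) (v : ℝ × E) (p : ℝ × ℝ × ℝ × E) :
    dirDeriv (0, 0, v) (dirDeriv (0, 0, v) (sourcePart k μ c q F)) p = posTime p.2.1 ^ (μ / 2) *
      dirDeriv (0, 0, v) (dirDeriv (0, 0, v)
        (transmute c (waveSol k F) (derivedKernel dirS q))) p := by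
  have hT : ContDiff ℝ 2 (transmute c (waveSol k F) (derivedKernel dirS q)) :=
    contDiff_transmute (j := 2) (contDiff_two_waveSol hk hn hF) (hq.contDiff_derivedKernel _)
  have hT' := contDiff_dirDeriv (m := 1) hT (0, 0, v)
  have hp : ContDiff ℝ 1 fun p : ℝ × ℝ × ℝ × E => posTime p.2.1 ^ (μ / 2) :=
    (contDiff_posTime_rpow (m := 1) (μ / 2)).comp (by fun_prop)
  have hz : dirDeriv (0, 0, v) (fun p : ℝ × ℝ × ℝ × E => posTime p.2.1 ^ (μ / 2)) p = 0 := by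
    have := hasDerivAt_dirDeriv (f := fun p : ℝ × ℝ × ℝ × E => posTime p.2.1 ^ (μ / 2))
      (p := p) (v := (0, 0, v)) (r := 0) (hp.differentiable (by simp) _)
    simp only [Prod.snd_add, Prod.fst_add, Prod.smul_snd, Prod.smul_fst, smul_zero, add_zero,
      zero_smul] at this
    exact this.unique (hasDerivAt_const _ _)
  rw [dirDeriv_sourcePart hk hn hq hF,
    dirDeriv_mul (hp.differentiable (by simp) _) (hT'.differentiable (by simp) _), hz]
  ring

/-- The equation for the solution; the right-hand side is the boundary term of Duhamel's integral. -/
lemma undamped_equation (hk : 0 < k) (hn : n = 2 * k) (hq : IsRealProfile m c q)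
    (hF : ContDiff ℝ ((k + 1 : ℕ) : WithTop ℕ∞) F)
    (hu₀ : ContDiff ℝ ((k + 2 : ℕ) : WithTop ℕ∞) u₀)
    (hu₁ : ContDiff ℝ ((k + 1 : ℕ) : WithTop ℕ∞) u₁) (μ : ℝ) {t : ℝ} (ht : 0 ≤ t) (x : E) :
    dirDeriv timeDir₂ (dirDeriv timeDir₂ (undamped k μ c q F u₀ u₁)) (t, x)
      - dirLap spaceDir₂ (undamped k μ c q F u₀ u₁) (t, x)
      + m / posTime t ^ 2 * undamped k μ c q F u₀ u₁ (t, x)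
      = posTime t ^ (μ / 2) * (c * F (√t, x)) := by
  have hF' : ContDiff ℝ (k : WithTop ℕ∞) F := hF.of_le (by exact_mod_cast Nat.le_succ _)
  have hV : ContDiff ℝ 2 (waveSol k F) := contDiff_two_waveSol hk hn hF
  have hK : ContDiff ℝ 2 (derivedKernel dirS q) := hq.contDiff_derivedKernel (j := 2) _
  have hT : ContDiff ℝ 2 (transmute c (waveSol k F) (derivedKernel dirS q)) :=
    contDiff_transmute (j := 2) hV hK
  have hS := contDiff_sourcePart hk hn hq hF μ
  have hSc := hS.continuous
  have hScc : ∀ v, Continuous (dirDeriv (0, 0, v) (dirDeriv (0, 0, v) (sourcePart k μ c q F))) :=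
    fun v => continuous_dirDeriv (contDiff_dirDeriv (m := 1) hS _) _
  have hH := homogeneousPart_equation hk hn hq hu₀ hu₁ ht x
  have i1 : ∀ v, IntervalIntegrable (fun b => dirDeriv (0, 0, v) (dirDeriv (0, 0, v)
      (sourcePart k μ c q F)) (√b, b, t, x)) volume 0 t := by
    intro v
    have := hScc v
    exact Continuous.intervalIntegrable (by fun_prop) _ _
  have i2 : IntervalIntegrable (fun b => sourcePart k μ c q F (√b, b, t, x)) volume 0 t :=
    Continuous.intervalIntegrable (by fun_prop) _ _
  have hsum : ∑ i, (∫ b in (0 : ℝ)..t, dirDeriv (spaceDir₄ i) (dirDeriv (spaceDir₄ i)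
      (sourcePart k μ c q F)) (√b, b, t, x))
      = ∫ b in (0 : ℝ)..t, ∑ i, dirDeriv (spaceDir₄ i) (dirDeriv (spaceDir₄ i)
      (sourcePart k μ c q F)) (√b, b, t, x) :=
    (intervalIntegral.integral_finsetSum fun i _ => i1 (spaceDir₂ i)).symm
  have i3 : IntervalIntegrable (fun b => ∑ i, dirDeriv (spaceDir₄ i) (dirDeriv (spaceDir₄ i)
      (sourcePart k μ c q F)) (√b, b, t, x)) volume 0 t := by
    have := fun i : Fin n => hScc (spaceDir₂ i)
    exact Continuous.intervalIntegrable (by fun_prop) _ _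
  -- the contribution of each starting time solves the homogeneous equation
  have hzero : (∫ b in (0 : ℝ)..t, dirDeriv timeDir₄ (dirDeriv timeDir₄
      (sourcePart k μ c q F)) (√b, b, t, x)) - (∫ b in (0 : ℝ)..t, ∑ i, dirDeriv (spaceDir₄ i)
      (dirDeriv (spaceDir₄ i) (sourcePart k μ c q F)) (√b, b, t, x))
      + m / posTime t ^ 2 * (∫ b in (0 : ℝ)..t, sourcePart k μ c q F (√b, b, t, x)) = 0 := by
    rw [← intervalIntegral.integral_const_mul, ← intervalIntegral.integral_sub (i1 timeDir₂) i3,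
      ← intervalIntegral.integral_add ((i1 timeDir₂).sub i3) (i2.const_mul _)]
    rw [intervalIntegral.integral_congr (g := fun _ => (0 : ℝ))]
    · simp
    · intro b hb
      rw [uIcc_of_le ht] at hb
      have h := hq.transmute_dirS_equation hV (waveSol_wave hk hn hF) (β := √b) (x := x)
        (waveSol_zero _ _ _ _) hb.1 hb.2
      have et := dirDeriv_dirDeriv_sourcePart hk hn hq hF μ timeDir₂ (√b, b, t, x)
      have ex := fun i : Fin n =>
        dirDeriv_dirDeriv_sourcePart hk hn hq hF μ (spaceDir₂ i) (√b, b, t, x)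
      simp only
      rw [et, Finset.sum_congr rfl fun i _ => ex i, ← Finset.mul_sum, sourcePart]
      unfold dirLap at h
      linear_combination posTime b ^ (μ / 2) * h
  -- the boundary term
  have hend : dirDeriv timeDir₄ (sourcePart k μ c q F) (√t, t, t, x)
      = posTime t ^ (μ / 2) * (c * F (√t, x)) := by
    have e := congrFun (dirDeriv_sourcePart hk hn hq hF μ timeDir₂) (√t, t, t, x)
    rw [e]
    simp only
    congr 1
    have := dirDeriv_transmute_start (c := c) (hV.of_le (by norm_num)) (hK.of_le (by norm_num)) (√t) t x
    rw [this, dirDeriv_waveSol_zero hk hn hF', waveSol_zero]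
    ring
  unfold dirLap at hH ⊢
  simp only [dirDeriv_dirDeriv_undamped hk hn hq hF hu₀ hu₁ μ, zero_mul, add_zero, one_mul,
    zeroStart_apply, Finset.sum_add_distrib]
  rw [hsum, hend]
  simp only [undamped, outerIntegral, zeroStart_apply, ContinuousLinearMap.coe_fst']
  linear_combination hH + hzero

lemma undamped_initial (p : E) (μ : ℝ) (hk : 0 < k) (hn : n = 2 * k)
    (hu₀ : ContDiff ℝ ((k + 2 : ℕ) : WithTop ℕ∞) u₀) :
    undamped k μ c q F u₀ u₁ (0, p) = c * u₀ p := by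
  have h := dirDeriv_waveSol_zero hk hn (φ := fun z : ℝ × E => u₀ z.2)
    ((hu₀.of_le (by norm_cast; omega)).comp contDiff_snd) 0 p
  simp only [undamped, zeroStart_apply, homogeneousPart, transmute_start, waveSol_zero,
    waveVelocity, h, outerIntegral, ContinuousLinearMap.coe_fst']
  simp

lemma dirDeriv_undamped_initial (x : E) (μ : ℝ) (hk : 0 < k) (hn : n = 2 * k)
    (hq : IsRealProfile m c q)
    (hF : ContDiff ℝ ((k + 1 : ℕ) : WithTop ℕ∞) F)
    (hu₀ : ContDiff ℝ ((k + 2 : ℕ) : WithTop ℕ∞) u₀)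
    (hu₁ : ContDiff ℝ ((k + 1 : ℕ) : WithTop ℕ∞) u₁) :
    dirDeriv timeDir₂ (undamped k μ c q F u₀ u₁) (0, x) = c * u₁ x := by
  have hU₀ : ContDiff ℝ ((k + 2 : ℕ) : WithTop ℕ∞) fun z : ℝ × E => u₀ z.2 := hu₀.comp contDiff_snd
  have hU₁ : ContDiff ℝ ((k + 1 : ℕ) : WithTop ℕ∞) fun z : ℝ × E => u₁ z.2 := hu₁.comp contDiff_snd
  have hV0 : ContDiff ℝ 2 (waveVelocity k fun z : ℝ × E => u₀ z.2) :=
    contDiff_waveVelocity (j := 2) hk hn (by rwa [add_comm])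
  have hV1 : ContDiff ℝ 2 (waveSol k fun z : ℝ × E => u₁ z.2) := contDiff_two_waveSol hk hn hU₁
  have hKB : ContDiff ℝ 2 (derivedKernel dirB q) := hq.contDiff_derivedKernel (j := 2) _
  have hKS : ContDiff ℝ 2 (derivedKernel dirS q) := hq.contDiff_derivedKernel (j := 2) _
  have c0 : ContDiff ℝ 2 (transmute c (waveVelocity k fun z : ℝ × E => u₀ z.2)
    (derivedKernel dirB q)) := contDiff_transmute (j := 2) hV0 hKB
  have c1 : ContDiff ℝ 2 (transmute c (waveSol k fun z : ℝ × E => u₁ z.2)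
    (derivedKernel dirS q)) := contDiff_transmute (j := 2) hV1 hKS
  have hdiag := hq.derivedKernel_diag (t := 0) (b := 0) (by norm_num) (by norm_num)
    (v := dirB) (Or.inr rfl)
  simp only [sub_self, mul_zero] at hdiag
  have e0 := dirDeriv_transmute_start (c := c) (hV0.of_le (by norm_num)) (hKB.of_le (by norm_num)) 0 0 x
  have e1 := dirDeriv_transmute_start (c := c) (hV1.of_le (by norm_num)) (hKS.of_le (by norm_num)) 0 0 x
  rw [dirDeriv_waveVelocity_zero hk hn (hU₀.of_le (by exact_mod_cast Nat.le_succ _)), hdiag] at e0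
  rw [dirDeriv_waveSol_zero hk hn (hU₁.of_le (by exact_mod_cast Nat.le_succ _)), waveSol_zero] at e1
  rw [dirDeriv_undamped hk hn hq hF hu₀ hu₁]
  simp only [outerIntegral, zeroStart_apply, ContinuousLinearMap.coe_fst',
    intervalIntegral.integral_same, add_zero]
  unfold homogeneousPart
  rw [dirDeriv_add (c0.differentiable (by simp) _) (c1.differentiable (by simp) _), e0, e1]
  ring

/-- The solution of the Cauchy problem, for the reduced kernel `q`. If `q(0) = 0`, it solves the
homogeneous problem with zero data. -/
lemma isClassicalSolution_undamped {ν : ℝ} (hk : 0 < k) (hn : n = 2 * k)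
    (hm : m = μ * (2 - μ) / 4 + ν ^ 2) (hq : IsRealProfile m c q)
    (hF : ContDiff ℝ ((k + 1 : ℕ) : WithTop ℕ∞) F)
    (hu₀ : ContDiff ℝ ((k + 2 : ℕ) : WithTop ℕ∞) u₀)
    (hu₁ : ContDiff ℝ ((k + 1 : ℕ) : WithTop ℕ∞) u₁) :
    IsClassicalSolution n μ ν (fun t x => c * F (√t, x)) (fun x => c * u₀ x)
      (fun x => c * u₁ x) (fun t x => posTime t ^ (-μ / 2)
        * undamped k μ c q F u₀ (fun x => u₁ x + μ / 2 * u₀ x) (t, x)) := by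
  have hu₁' : ContDiff ℝ ((k + 1 : ℕ) : WithTop ℕ∞) fun x => u₁ x + μ / 2 * u₀ x :=
    hu₁.add (contDiff_const.mul (hu₀.of_le (by exact_mod_cast Nat.le_succ _)))
  refine isClassicalSolution_of_reduced hm (contDiff_undamped hk hn hq hF hu₀ hu₁' μ)
    (fun t ht x => undamped_equation hk hn hq hF hu₀ hu₁' μ ht.le x)
    (fun x => undamped_initial x μ hk hn hu₀) (fun x => ?_)
  rw [dirDeriv_undamped_initial x μ hk hn hq hF hu₀ hu₁']
  ring

end Solution

/-! ### The local energy -/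

section Energy

variable {n : ℕ}

local notation "E" => EuclideanSpace ℝ (Fin n)

/-- The gap `max (R - t - √(1 + |x - x₀|²)) 0` between a point and a hyperboloid inside of the
backward light cone with vertex `(R, x₀)`. Unlike `|x - x₀|` the root is smooth at `x = x₀`. -/
noncomputable def coneGap (R : ℝ) (x₀ : E) (p : ℝ × E) : ℝ :=
  max (R - p.1 - √(1 + ‖p.2 - x₀‖ ^ 2)) 0

lemma coneGap_nonneg (R : ℝ) (x₀ : E) (p : ℝ × E) : 0 ≤ coneGap R x₀ p := le_max_right _ _

lemma coneGap_eq_zero {R : ℝ} {x₀ : E} {t : ℝ} (ht : 0 ≤ t) {x : E}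
    (hx : x ∉ Metric.closedBall x₀ R) : coneGap R x₀ (t, x) = 0 := by
  rw [Metric.mem_closedBall, not_le, dist_eq_norm] at hx
  have h1 : ‖x - x₀‖ ≤ √(1 + ‖x - x₀‖ ^ 2) := Real.le_sqrt_of_sq_le (by linarith)
  exact max_eq_right (by simp only; linarith)

/-- The weight of the energy; it decreases in time at least as fast as it varies in space. -/
noncomputable def coneWeight (R : ℝ) (x₀ : E) (p : ℝ × E) : ℝ := coneGap R x₀ p ^ 2

lemma contDiff_max_zero_sq : ContDiff ℝ 1 fun σ : ℝ => max σ 0 ^ 2 := by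
  rw [contDiff_one_iff_deriv]
  refine ⟨fun σ => (hasDerivAt_max_zero_sq σ).differentiableAt, ?_⟩
  rw [funext fun σ => (hasDerivAt_max_zero_sq σ).deriv]
  fun_prop

lemma contDiff_coneArg (R : ℝ) (x₀ : E) :
    ContDiff ℝ 1 fun p : ℝ × E => R - p.1 - √(1 + ‖p.2 - x₀‖ ^ 2) := by
  have h : ContDiff ℝ 1 fun p : ℝ × E => 1 + ‖p.2 - x₀‖ ^ 2 :=
    contDiff_const.add ((contDiff_snd.sub contDiff_const).norm_sq ℝ)
  exact (contDiff_const.sub contDiff_fst).sub (h.sqrt fun p => by positivity)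

lemma contDiff_coneWeight (R : ℝ) (x₀ : E) : ContDiff ℝ 1 (coneWeight R x₀) :=
  contDiff_max_zero_sq.comp (contDiff_coneArg R x₀)

lemma dirDeriv_coneWeight (R : ℝ) (x₀ : E) (v p : ℝ × E) :
    dirDeriv v (coneWeight R x₀) p = 2 * coneGap R x₀ p
      * (-v.1 - inner ℝ (p.2 - x₀) v.2 / √(1 + ‖p.2 - x₀‖ ^ 2)) := by
  have hpos : 0 < 1 + ‖p.2 - x₀‖ ^ 2 := by positivity
  have e := dirDeriv_comp_real (g := fun σ : ℝ => max σ 0 ^ 2)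
    (f := fun p : ℝ × E => R - p.1 - √(1 + ‖p.2 - x₀‖ ^ 2)) (p := p)
    (hasDerivAt_max_zero_sq _).differentiableAt
    ((contDiff_coneArg R x₀).differentiable one_ne_zero p) v
  have e' : dirDeriv v (fun p : ℝ × E => R - p.1 - √(1 + ‖p.2 - x₀‖ ^ 2)) p
      = -v.1 - inner ℝ (p.2 - x₀) v.2 / √(1 + ‖p.2 - x₀‖ ^ 2) := by
    have h1 : HasFDerivAt (fun p : ℝ × E => p.2 - x₀) (ContinuousLinearMap.snd ℝ ℝ E) p :=
      hasFDerivAt_snd.sub_const x₀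
    have h2 := ((h1.norm_sq).const_add 1).sqrt hpos.ne'
    have h3 := ((hasFDerivAt_fst (𝕜 := ℝ) (p := p)).const_sub R).sub h2
    have h4 : HasFDerivAt (fun p : ℝ × E => R - p.1 - √(1 + ‖p.2 - x₀‖ ^ 2)) _ p := h3
    rw [dirDeriv, h4.fderiv]
    simp
    field_simp
    rw [inner_sub_left]
  rw [e'] at e
  rw [(hasDerivAt_max_zero_sq _).deriv] at e
  exact e

lemma inner_basisVec (y : E) (i : Fin n) : inner ℝ y (basisVec i) = y i := by
  simp [basisVec, EuclideanSpace.inner_single_right]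

/-- The energy density `w_t² + |∇w|² + w²`. -/
noncomputable def energyDensity (w : ℝ × E → ℝ) (p : ℝ × E) : ℝ :=
  dirDeriv timeDir₂ w p ^ 2 + ∑ i, dirDeriv (spaceDir₂ i) w p ^ 2 + w p ^ 2

lemma contDiff_energyDensity {w : ℝ × E → ℝ} (hw : ContDiff ℝ 2 w) :
    ContDiff ℝ 1 (energyDensity w) := by
  have h1 : ∀ v, ContDiff ℝ 1 (dirDeriv v w) := contDiff_dirDeriv (m := 1) hw
  refine (((h1 _).pow 2).add (ContDiff.sum fun i _ => (h1 _).pow 2)).add ?_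
  exact (hw.of_le (by norm_num)).pow 2

lemma dirDeriv_sq {P : Type} [NormedAddCommGroup P] [NormedSpace ℝ P] {f : P → ℝ} {p : P}
    (hf : DifferentiableAt ℝ f p) (v : P) :
    dirDeriv v (fun p => f p ^ 2) p = 2 * f p * dirDeriv v f p := by
  simp only [sq]
  rw [dirDeriv_mul hf hf]
  ring

lemma dirDeriv_energyDensity {w : ℝ × E → ℝ} (hw : ContDiff ℝ 2 w) (p : ℝ × E) :
    dirDeriv timeDir₂ (energyDensity w) p
      = 2 * dirDeriv timeDir₂ w p * dirDeriv timeDir₂ (dirDeriv timeDir₂ w) p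
        + ∑ i, 2 * dirDeriv (spaceDir₂ i) w p * dirDeriv (spaceDir₂ i) (dirDeriv timeDir₂ w) p
        + 2 * w p * dirDeriv timeDir₂ w p := by
  have h1 : ∀ v, Differentiable ℝ (dirDeriv v w) := fun v =>
    (contDiff_dirDeriv (m := 1) hw v).differentiable (by simp)
  have h0 : Differentiable ℝ w := hw.differentiable (by simp)
  have h2 : ∀ v : ℝ × E, DifferentiableAt ℝ (fun p => dirDeriv v w p ^ 2) p := fun v =>
    (h1 v p).fun_pow 2
  unfold energyDensity
  rw [dirDeriv_add ((h2 _).fun_add (DifferentiableAt.fun_sum fun i _ => h2 _)) ((h0 p).fun_pow 2),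
    dirDeriv_add (h2 _) (DifferentiableAt.fun_sum fun i _ => h2 _),
    dirDeriv_sum _ (fun i _ => h2 _), dirDeriv_sq (h1 _ p), dirDeriv_sq (h0 p)]
  congr 2
  refine Finset.sum_congr rfl fun i _ => ?_
  rw [dirDeriv_sq (h1 _ p), dirDeriv_comm hw]

lemma slice_dirDeriv {f : ℝ × E → ℝ} (hf : Differentiable ℝ f) (t : ℝ) (v x : E) :
    dirDeriv v (fun x => f (t, x)) x = dirDeriv (0, v) f (t, x) := by
  have := dirDeriv_comp_affine (f := f) (ContinuousLinearMap.inr ℝ ℝ E) (t, 0) (p := x) (hf _) v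
  simpa using this

/-- The divergence terms of the energy identity integrate to zero. -/
lemma integral_divergence_eq_zero {w : ℝ × E → ℝ} (hw : ContDiff ℝ 2 w) (R : ℝ) (x₀ : E) {t : ℝ}
    (ht : 0 ≤ t) (i : Fin n) :
    ∫ x in Metric.closedBall x₀ R,
      (coneWeight R x₀ (t, x) * dirDeriv (spaceDir₂ i) w (t, x)
          * dirDeriv (spaceDir₂ i) (dirDeriv timeDir₂ w) (t, x)
        + (dirDeriv (spaceDir₂ i) (coneWeight R x₀) (t, x) * dirDeriv (spaceDir₂ i) w (t, x)
          + coneWeight R x₀ (t, x) * dirDeriv (spaceDir₂ i) (dirDeriv (spaceDir₂ i) w) (t, x))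
          * dirDeriv timeDir₂ w (t, x)) = 0 := by
  have hχ := contDiff_coneWeight R x₀
  have h1 : ∀ v, ContDiff ℝ 1 (dirDeriv v w) := contDiff_dirDeriv (m := 1) hw
  have dχ := hχ.differentiable one_ne_zero
  have d1 := fun v => (h1 v).differentiable one_ne_zero
  have h00 : ∀ x ∉ Metric.closedBall x₀ R, coneWeight R x₀ (t, x) = 0 := fun x hx => by
    rw [coneWeight, coneGap_eq_zero ht hx]; simp
  rw [setIntegral_eq_integral_of_forall_compl_eq_zero]
  swap
  · intro x hx
    rw [h00 x hx, dirDeriv_coneWeight, coneGap_eq_zero ht hx]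
    simp
  have ha : ContDiff ℝ 1 fun x => coneWeight R x₀ (t, x) * dirDeriv (spaceDir₂ i) w (t, x) := by
    have := h1 (spaceDir₂ i)
    fun_prop
  have hac : HasCompactSupport fun x =>
      coneWeight R x₀ (t, x) * dirDeriv (spaceDir₂ i) w (t, x) :=
    HasCompactSupport.intro (isCompact_closedBall x₀ R) fun x hx => by simp [h00 x hx]
  have hb : ContDiff ℝ 1 fun x => dirDeriv timeDir₂ w (t, x) := by
    have := h1 timeDir₂
    fun_prop
  have key := integral_mul_dirDeriv ha hac hb (basisVec i)
  have e1 : ∀ x, dirDeriv (basisVec i) (fun x => dirDeriv timeDir₂ w (t, x)) x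
      = dirDeriv (spaceDir₂ i) (dirDeriv timeDir₂ w) (t, x) := fun x =>
    slice_dirDeriv (d1 _) t _ x
  have e2 : ∀ x, dirDeriv (basisVec i)
      (fun x => coneWeight R x₀ (t, x) * dirDeriv (spaceDir₂ i) w (t, x)) x
      = dirDeriv (spaceDir₂ i) (coneWeight R x₀) (t, x) * dirDeriv (spaceDir₂ i) w (t, x)
          + coneWeight R x₀ (t, x) * dirDeriv (spaceDir₂ i) (dirDeriv (spaceDir₂ i) w) (t, x) := by
    intro x
    rw [slice_dirDeriv (f := fun p => coneWeight R x₀ p * dirDeriv (spaceDir₂ i) w p)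
      (dχ.fun_mul (d1 _)) t _ x, dirDeriv_mul (dχ _) (d1 _ _)]
  simp only [e1, e2] at key
  have c1 := (h1 (spaceDir₂ i)).continuous
  have c2 := (h1 timeDir₂).continuous
  have c3 := continuous_dirDeriv (h1 timeDir₂) (spaceDir₂ i)
  have c4 := continuous_dirDeriv (h1 (spaceDir₂ i)) (spaceDir₂ i)
  have c5 := hχ.continuous
  have c6 := continuous_dirDeriv hχ (spaceDir₂ i)
  rw [integral_add, key]
  · ring
  · refine Continuous.integrable_of_hasCompactSupport (by fun_prop) ?_
    exact HasCompactSupport.intro (isCompact_closedBall x₀ R) fun x hx => by simp [h00 x hx]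
  · refine Continuous.integrable_of_hasCompactSupport (by fun_prop) ?_
    exact HasCompactSupport.intro (isCompact_closedBall x₀ R) fun x hx => by
      rw [h00 x hx, dirDeriv_coneWeight, coneGap_eq_zero ht hx]; simp

/-- The pointwise inequality behind the energy estimate: the decay of the weight controls the flux
through the lateral boundary. -/
lemma flux_le {ι : Type} [Fintype ι] {M A U r N L : ℝ} {B y : ι → ℝ} (hM : 0 ≤ M) (hr : 0 < r)
    (hy : ∑ i, y i ^ 2 ≤ r ^ 2) (hN : 2 * A * N + 2 * A * U ≤ L * (A ^ 2 + U ^ 2)) (hL : 0 ≤ L) :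
    -(2 * M) * (A ^ 2 + ∑ i, B i ^ 2 + U ^ 2) + M ^ 2 * (2 * A * N + 2 * U * A)
      + ∑ i, 4 * M * (y i / r) * B i * A ≤ L * (M ^ 2 * (A ^ 2 + ∑ i, B i ^ 2 + U ^ 2)) := by
  have h1 : ∑ i, (y i / r) ^ 2 ≤ 1 := by
    simp only [div_pow]
    rw [← Finset.sum_div, div_le_one (by positivity)]
    exact hy
  have h2 : 0 ≤ ∑ i, (A * (y i / r) - B i) ^ 2 := Finset.sum_nonneg fun i _ => sq_nonneg _
  have h3 : ∑ i, (A * (y i / r) - B i) ^ 2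
      = A ^ 2 * ∑ i, (y i / r) ^ 2 - 2 * A * ∑ i, (y i / r) * B i + ∑ i, B i ^ 2 := by
    rw [Finset.mul_sum, Finset.mul_sum, ← Finset.sum_sub_distrib, ← Finset.sum_add_distrib]
    exact Finset.sum_congr rfl fun i _ => by ring
  have h4 : ∑ i, 4 * M * (y i / r) * B i * A = 4 * M * A * ∑ i, (y i / r) * B i := by
    rw [Finset.mul_sum]
    exact Finset.sum_congr rfl fun i _ => by ring
  have h5 : 0 ≤ ∑ i, B i ^ 2 := Finset.sum_nonneg fun i _ => sq_nonneg _
  rw [h3] at h2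
  rw [h4]
  generalize ∑ i, (y i / r) ^ 2 = S at *
  generalize ∑ i, (y i / r) * B i = T at *
  generalize ∑ i, B i ^ 2 = Q at *
  have a1 : 2 * A * T ≤ A ^ 2 + Q := by nlinarith [sq_nonneg A]
  have a2 : M * (2 * A * T) ≤ M * (A ^ 2 + Q) := mul_le_mul_of_nonneg_left a1 hM
  have a3 := mul_le_mul_of_nonneg_left hN (sq_nonneg M)
  have a4 : 0 ≤ L * (M ^ 2 * Q) := by positivity
  have a5 : 0 ≤ M * U ^ 2 := by positivity
  nlinarith

/-- The local energy. -/
noncomputable def localEnergy (w : ℝ × E → ℝ) (R : ℝ) (x₀ : E) (t : ℝ) : ℝ :=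
  ∫ x in Metric.closedBall x₀ R, coneWeight R x₀ (t, x) * energyDensity w (t, x)

/-- The energy estimate for the homogeneous equation: the weight `M²` has the time derivative `-2 M`
and a gradient of length at most `2 M`, so that its decay absorbs the flux `4 M |∇w| |w_t|`. -/
lemma localEnergy_deriv {w : ℝ × E → ℝ} (hw : ContDiff ℝ 2 w) {μ ν : ℝ} (hμ : 0 ≤ μ) (R : ℝ)
    (x₀ : E) {t : ℝ} (ht : 0 < t)
    (heq : ∀ x, dirDeriv timeDir₂ (dirDeriv timeDir₂ w) (t, x) - dirLap spaceDir₂ w (t, x)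
      + μ / (1 + t) * dirDeriv timeDir₂ w (t, x) + ν ^ 2 / (1 + t) ^ 2 * w (t, x) = 0) :
    ∃ e', HasDerivAt (localEnergy w R x₀) e' t ∧ e' ≤ (1 + ν ^ 2) * localEnergy w R x₀ t := by
  set K := Metric.closedBall x₀ R with hKdef
  have hKc : IsCompact K := isCompact_closedBall x₀ R
  set χ := coneWeight R x₀ with hχdef
  have hχ : ContDiff ℝ 1 χ := contDiff_coneWeight R x₀
  have hD := contDiff_energyDensity hw
  have hh : ContDiff ℝ 1 fun p : ℝ × E => χ p * energyDensity w p := hχ.mul hD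
  have hρ : Integrable (fun _ : E => (1 : ℝ)) (volume.restrict K) :=
    integrableOn_const hKc.measure_lt_top.ne
  have hρK : ∀ᵐ y ∂(volume.restrict K), (1 : ℝ) ≠ 0 → y ∈ K := by
    filter_upwards [ae_restrict_mem hKc.measurableSet] with y hy _ using hy
  have hint := contDiff_weighted_integral hρ hKc hρK 1 (h := fun p : ℝ × E =>
    χ p * energyDensity w p) (by simpa using hh)
  have e0 : localEnergy w R x₀
      = fun t => ∫ x, (1 : ℝ) • (χ (t, x) * energyDensity w (t, x)) ∂(volume.restrict K) := by
    funext t; simp [localEnergy, hχdef, hKdef]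
  have hder : HasDerivAt (localEnergy w R x₀)
      (∫ x in K, dirDeriv timeDir₂ (fun p => χ p * energyDensity w p) (t, x)) t := by
    have h1 := dirDeriv_weighted_integral hρ hKc hρK hh (1 : ℝ) t
    have h2 := hasDerivAt_dirDeriv (f := localEnergy w R x₀) (p := 0) (v := (1 : ℝ)) (r := t)
      (by rw [e0]; exact hint.differentiable (by simp) _)
    simp only [zero_add, smul_eq_mul, mul_one] at h2
    refine h2.congr_deriv ?_
    rw [e0]
    simpa using h1
  refine ⟨_, hder, ?_⟩
  have h1 : ∀ v, ContDiff ℝ 1 (dirDeriv v w) := contDiff_dirDeriv (m := 1) hw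
  have c0 := hw.continuous
  have c1 := fun v => (h1 v).continuous
  have c2 := fun u v => continuous_dirDeriv (h1 u) v
  have c3 := hχ.continuous
  have c4 := fun v => continuous_dirDeriv hχ v
  have c5 := hD.continuous
  have c6 := continuous_dirDeriv hh timeDir₂
  -- The terms `∂_i (χ w_i w_t)` have integral zero. Subtracting them from the time derivative of the
  -- energy density removes the second derivatives of `w`.
  set Dv : Fin n → E → ℝ := fun i x => χ (t, x) * dirDeriv (spaceDir₂ i) w (t, x)
          * dirDeriv (spaceDir₂ i) (dirDeriv timeDir₂ w) (t, x)
        + (dirDeriv (spaceDir₂ i) χ (t, x) * dirDeriv (spaceDir₂ i) w (t, x)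
          + χ (t, x) * dirDeriv (spaceDir₂ i) (dirDeriv (spaceDir₂ i) w) (t, x))
          * dirDeriv timeDir₂ w (t, x) with hDv
  have cDv : ∀ i, Continuous (Dv i) := by
    intro i
    have := c1 (spaceDir₂ i)
    have := c1 timeDir₂
    have := c2 timeDir₂ (spaceDir₂ i)
    have := c2 (spaceDir₂ i) (spaceDir₂ i)
    have := c4 (spaceDir₂ i)
    simp only [hDv]
    fun_prop
  have iK : ∀ {g : E → ℝ}, Continuous g → IntegrableOn g K := fun hg =>
    hg.continuousOn.integrableOn_compact hKc
  have hz : ∫ x in K, ∑ i, 2 * Dv i x = 0 := by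
    rw [integral_finsetSum _ fun i _ => (iK (cDv i)).const_mul 2]
    refine Finset.sum_eq_zero fun i _ => ?_
    rw [integral_const_mul, integral_divergence_eq_zero hw R x₀ ht.le i, mul_zero]
  have hcsum : Continuous fun x => ∑ i, 2 * Dv i x := by fun_prop
  have ctd : Continuous fun x => dirDeriv timeDir₂ (fun p => χ p * energyDensity w p) (t, x) := by
    fun_prop
  have hsub : ∫ x in K, dirDeriv timeDir₂ (fun p => χ p * energyDensity w p) (t, x)
      = ∫ x in K, (dirDeriv timeDir₂ (fun p => χ p * energyDensity w p) (t, x)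
        - ∑ i, 2 * Dv i x) := by
    rw [integral_sub (iK ctd) (iK hcsum), hz, sub_zero]
  rw [hsub, localEnergy, ← integral_const_mul]
  refine setIntegral_mono (iK (ctd.sub hcsum)) (iK (by simp only [← hχdef]; fun_prop)) fun x => ?_
  simp only
  have hr : 0 < √(1 + ‖x - x₀‖ ^ 2) := Real.sqrt_pos.2 (by positivity)
  have hy : ∑ i, (x - x₀) i ^ 2 ≤ √(1 + ‖x - x₀‖ ^ 2) ^ 2 := by
    rw [Real.sq_sqrt (by positivity), EuclideanSpace.norm_sq_eq]
    simp
  have ht1 : (1 : ℝ) ≤ 1 + t := by linarith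
  -- the lower-order terms; the damping term is nonnegative and can be dropped
  have hN : 2 * dirDeriv timeDir₂ w (t, x) * (-(μ / (1 + t) * dirDeriv timeDir₂ w (t, x)
      + ν ^ 2 / (1 + t) ^ 2 * w (t, x))) + 2 * dirDeriv timeDir₂ w (t, x) * w (t, x)
      ≤ (1 + ν ^ 2) * (dirDeriv timeDir₂ w (t, x) ^ 2 + w (t, x) ^ 2) := by
    generalize dirDeriv timeDir₂ w (t, x) = A
    generalize w (t, x) = U
    have b1 : 0 ≤ μ / (1 + t) * A ^ 2 := by positivity
    have b2 : 0 ≤ ν ^ 2 / (1 + t) ^ 2 := by positivity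
    have b3 : ν ^ 2 / (1 + t) ^ 2 ≤ ν ^ 2 := div_le_self (sq_nonneg ν) (one_le_pow₀ ht1)
    generalize ν ^ 2 / (1 + t) ^ 2 = s at *
    have b4 : 0 ≤ s * (A + U) ^ 2 := by positivity
    have b5 : s * (A ^ 2 + U ^ 2) ≤ ν ^ 2 * (A ^ 2 + U ^ 2) :=
      mul_le_mul_of_nonneg_right b3 (by positivity)
    nlinarith [sq_nonneg (A - U)]
  have key := flux_le (B := fun i => dirDeriv (spaceDir₂ i) w (t, x)) (y := fun i => (x - x₀) i)
    (coneGap_nonneg R x₀ (t, x)) hr hy hN (by positivity)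
  refine le_trans (le_of_eq ?_) key
  have hlap := heq x
  rw [dirDeriv_mul (hχ.differentiable one_ne_zero _) (hD.differentiable one_ne_zero _),
    dirDeriv_energyDensity hw]
  have hsumD : ∑ i, 2 * Dv i x = χ (t, x) * ∑ i, 2 * dirDeriv (spaceDir₂ i) w (t, x)
        * dirDeriv (spaceDir₂ i) (dirDeriv timeDir₂ w) (t, x)
      + 2 * χ (t, x) * dirDeriv timeDir₂ w (t, x) * dirLap spaceDir₂ w (t, x)
      - ∑ i, 4 * coneGap R x₀ (t, x) * ((x - x₀) i / √(1 + ‖x - x₀‖ ^ 2))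
        * dirDeriv (spaceDir₂ i) w (t, x) * dirDeriv timeDir₂ w (t, x) := by
    unfold dirLap
    rw [Finset.mul_sum, Finset.mul_sum, ← Finset.sum_add_distrib, ← Finset.sum_sub_distrib]
    refine Finset.sum_congr rfl fun i _ => ?_
    have := dirDeriv_coneWeight R x₀ (spaceDir₂ i) (t, x)
    simp only [inner_basisVec] at this
    simp only [hDv, hχdef, this]
    ring
  have hT : dirDeriv timeDir₂ χ (t, x) = -(2 * coneGap R x₀ (t, x)) := by
    rw [hχdef, dirDeriv_coneWeight]
    simp
  have hχv : χ (t, x) = coneGap R x₀ (t, x) ^ 2 := rfl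
  rw [hsumD, hT, hχv, energyDensity]
  linear_combination (2 * coneGap R x₀ (t, x) ^ 2 * dirDeriv timeDir₂ w (t, x)) * hlap

end Energy

/-! ### Uniqueness of classical solutions -/

section Uniqueness

variable {n : ℕ}

local notation "E" => EuclideanSpace ℝ (Fin n)

/-- A smooth positive function on the line that equals `t` for `t ≥ ε`. -/
noncomputable def clampTime (ε t : ℝ) : ℝ := 2 * ε * posTime (t / (2 * ε) - 1)

lemma clampTime_pos {ε : ℝ} (hε : 0 < ε) (t : ℝ) : 0 < clampTime ε t := by
  have := posTime_pos (t / (2 * ε) - 1)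
  unfold clampTime
  positivity

lemma clampTime_eq {ε t : ℝ} (hε : 0 < ε) (ht : ε ≤ t) : clampTime ε t = t := by
  have : 1 / 2 ≤ t / (2 * ε) := by rw [div_le_div_iff₀ (by norm_num) (by positivity)]; linarith
  rw [clampTime, posTime_eq (by linarith)]
  field_simp
  ring

/-- A function of class `C²` for nonnegative times, modified for times below `ε` so as to be of
class `C²` everywhere. -/
noncomputable def clamped (ε : ℝ) (u : ℝ × E → ℝ) (p : ℝ × E) : ℝ := u (clampTime ε p.1, p.2)

lemma contDiff_clamped {ε : ℝ} (hε : 0 < ε) {u : ℝ × E → ℝ}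
    (hu : ContDiffOn ℝ 2 u (Ici (0 : ℝ) ×ˢ univ)) : ContDiff ℝ 2 (clamped ε u) := by
  have h : ContDiff ℝ 2 fun p : ℝ × E => clampTime ε p.1 := by
    have : ContDiff ℝ 2 (clampTime ε) :=
      contDiff_const.mul ((contDiff_posTime (m := 2)).comp (by fun_prop))
    exact this.comp contDiff_fst
  exact hu.comp_contDiff (h.prodMk contDiff_snd) fun p => ⟨(clampTime_pos hε _).le, mem_univ _⟩

lemma clamped_eq {ε t : ℝ} (hε : 0 < ε) (ht : ε ≤ t) (u : ℝ × E → ℝ) (x : E) :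
    clamped ε u (t, x) = u (t, x) := by
  rw [clamped, clampTime_eq hε ht]

lemma deriv_eq_clamped {ε t : ℝ} (hε : 0 < ε) (ht : ε < t) {u : ℝ × E → ℝ}
    (hu : ContDiffOn ℝ 2 u (Ici (0 : ℝ) ×ˢ univ)) (x : E) :
    deriv (fun s => u (s, x)) t = dirDeriv timeDir₂ (clamped ε u) (t, x) := by
  have hd : Differentiable ℝ (clamped ε u) := (contDiff_clamped hε hu).differentiable (by simp)
  rw [← (hasDerivAt_timeDir₂ hd t x).deriv]
  refine EventuallyEq.deriv_eq ?_
  filter_upwards [Ioi_mem_nhds ht] with s hs using (clamped_eq hε (le_of_lt hs) u x).symm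

lemma iteratedDeriv_eq_clamped {ε t : ℝ} (hε : 0 < ε) (ht : ε < t) {u : ℝ × E → ℝ}
    (hu : ContDiffOn ℝ 2 u (Ici (0 : ℝ) ×ˢ univ)) (x : E) :
    iteratedDeriv 2 (fun s => u (s, x)) t
      = dirDeriv timeDir₂ (dirDeriv timeDir₂ (clamped ε u)) (t, x) := by
  have hd : Differentiable ℝ (dirDeriv timeDir₂ (clamped ε u)) :=
    (contDiff_dirDeriv (m := 1) (contDiff_clamped hε hu) _).differentiable (by simp)
  rw [iteratedDeriv_succ, iteratedDeriv_one, ← (hasDerivAt_timeDir₂ hd t x).deriv]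
  refine EventuallyEq.deriv_eq ?_
  filter_upwards [Ioi_mem_nhds ht] with s hs using deriv_eq_clamped hε hs hu x

lemma laplacian_eq_clamped {ε t : ℝ} (hε : 0 < ε) (ht : ε < t) {u : ℝ × E → ℝ}
    (hu : ContDiffOn ℝ 2 u (Ici (0 : ℝ) ×ˢ univ)) (x : E) :
    Δ (fun x => u (t, x)) x = dirLap spaceDir₂ (clamped ε u) (t, x) := by
  rw [← laplacian_slice (contDiff_clamped hε hu)]
  simp only [clamped_eq hε ht.le]

/-- The equation for `u` in terms of the modified function. -/
lemma IsClassicalSolution.clamped_equation {μ ν : ℝ} {g : ℝ → E → ℝ} {u₀ u₁ : E → ℝ}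
    {u : ℝ → E → ℝ} (h : IsClassicalSolution n μ ν g u₀ u₁ u) {ε t : ℝ} (hε : 0 < ε)
    (ht : ε < t) (x : E) :
    dirDeriv timeDir₂ (dirDeriv timeDir₂ (clamped ε fun p => u p.1 p.2)) (t, x)
      - dirLap spaceDir₂ (clamped ε fun p => u p.1 p.2) (t, x)
      + μ / (1 + t) * dirDeriv timeDir₂ (clamped ε fun p => u p.1 p.2) (t, x)
      + ν ^ 2 / (1 + t) ^ 2 * clamped ε (fun p => u p.1 p.2) (t, x) = g t x := by
  have hu := h.contDiffOn
  rw [← iteratedDeriv_eq_clamped hε ht hu, ← laplacian_eq_clamped hε ht hu,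
    ← deriv_eq_clamped hε ht hu, clamped_eq hε ht.le, ← h.equation t (hε.trans ht) x]

lemma uniqueDiffOn_halfSpace : UniqueDiffOn ℝ (Ici (0 : ℝ) ×ˢ (univ : Set E)) :=
  (uniqueDiffOn_Ici 0).prod uniqueDiffOn_univ

/-- The derivative of `u` in the direction `v`, one-sided at time zero and extended to negative
times by its values at time zero. It makes the energy continuous up to time zero, where the initial
conditions are used. -/
noncomputable def oneSidedDeriv (u : ℝ × E → ℝ) (v : ℝ × E) (p : ℝ × E) : ℝ :=
  fderivWithin ℝ u (Ici (0 : ℝ) ×ˢ univ) (max p.1 0, p.2) v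

lemma continuous_oneSidedDeriv {u : ℝ × E → ℝ} (hu : ContDiffOn ℝ 2 u (Ici (0 : ℝ) ×ˢ univ))
    (v : ℝ × E) : Continuous (oneSidedDeriv u v) := by
  have h := hu.continuousOn_fderivWithin uniqueDiffOn_halfSpace (by norm_num)
  have h' : Continuous fun p : ℝ × E =>
      fderivWithin ℝ u (Ici (0 : ℝ) ×ˢ univ) (max p.1 0, p.2) :=
    h.comp_continuous (by fun_prop) fun p =>
      ⟨mem_Ici.2 (le_max_right _ _), mem_univ _⟩
  exact h'.clm_apply continuous_const

lemma oneSidedDeriv_eq {ε t : ℝ} (hε : 0 < ε) (ht : ε < t) {u : ℝ × E → ℝ} (v : ℝ × E) (x : E) :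
    oneSidedDeriv u v (t, x) = dirDeriv v (clamped ε u) (t, x) := by
  have ht0 : 0 < t := hε.trans ht
  rw [oneSidedDeriv, max_eq_left ht0.le, fderivWithin_of_mem_nhds
    (prod_mem_nhds (Ici_mem_nhds ht0) univ_mem), dirDeriv]
  congr 1
  refine EventuallyEq.fderiv_eq ?_
  filter_upwards [prod_mem_nhds (Ioi_mem_nhds ht) (univ_mem (f := 𝓝 x))] with p hp
  exact (clamped_eq hε (le_of_lt hp.1) u p.2).symm

lemma hasDerivWithinAt_slice {u : ℝ × E → ℝ} (hu : ContDiffOn ℝ 2 u (Ici (0 : ℝ) ×ˢ univ))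
    (x : E) : HasDerivWithinAt (fun t => u (t, x)) (oneSidedDeriv u timeDir₂ (0, x)) (Ici 0) 0 := by
  have hd : DifferentiableWithinAt ℝ u (Ici (0 : ℝ) ×ˢ univ) (0, x) :=
    hu.differentiableOn (by norm_num) _ ⟨mem_Ici.2 le_rfl, mem_univ _⟩
  have h1 : HasDerivWithinAt (fun t : ℝ => (t, x)) (1, 0) (Ici 0) 0 :=
    ((hasDerivAt_id (0 : ℝ)).prodMk (hasDerivAt_const 0 x)).hasDerivWithinAt
  have hm : MapsTo (fun t : ℝ => (t, x)) (Ici 0) (Ici (0 : ℝ) ×ˢ univ) :=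
    fun t ht => ⟨ht, mem_univ _⟩
  have := hd.hasFDerivWithinAt.comp_hasDerivWithinAt (0 : ℝ) h1 hm
  simpa [oneSidedDeriv, Function.comp_def] using this

lemma oneSidedDeriv_space_zero {u : ℝ × E → ℝ} (hu : ContDiffOn ℝ 2 u (Ici (0 : ℝ) ×ˢ univ))
    (h0 : ∀ x, u (0, x) = 0) (i : Fin n) (x : E) :
    oneSidedDeriv u (spaceDir₂ i) (0, x) = 0 := by
  have hd : DifferentiableWithinAt ℝ u (Ici (0 : ℝ) ×ˢ univ) (0, x) :=
    hu.differentiableOn (by norm_num) _ ⟨mem_Ici.2 le_rfl, mem_univ _⟩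
  have h1 : HasDerivAt (fun r : ℝ => ((0 : ℝ), x + r • basisVec i)) (0, basisVec i) 0 := by
    refine (hasDerivAt_const (0 : ℝ) (0 : ℝ)).prodMk ?_
    simpa using ((hasDerivAt_id (0 : ℝ)).smul_const (basisVec i)).const_add x
  have h2 : HasFDerivWithinAt u (fderivWithin ℝ u (Ici (0 : ℝ) ×ˢ univ) (0, x))
      (Ici (0 : ℝ) ×ˢ univ) ((0 : ℝ), x + (0 : ℝ) • basisVec i) := by
    simpa using hd.hasFDerivWithinAt
  have hm : MapsTo (fun r : ℝ => ((0 : ℝ), x + r • basisVec i)) univ (Ici (0 : ℝ) ×ˢ univ) :=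
    fun r _ => ⟨mem_Ici.2 le_rfl, mem_univ _⟩
  have := h2.comp_hasDerivWithinAt (0 : ℝ) h1.hasDerivWithinAt hm
  rw [hasDerivWithinAt_univ] at this
  have h3 : (u ∘ fun r : ℝ => ((0 : ℝ), x + r • basisVec i)) = fun _ => 0 := by
    funext r; simp [h0]
  rw [h3] at this
  simpa [oneSidedDeriv] using this.unique (hasDerivAt_const _ _)

/-- The local energy of `u`, continuous up to time zero. -/
noncomputable def localEnergyClosed (u : ℝ × E → ℝ) (R : ℝ) (x₀ : E) (t : ℝ) : ℝ :=
  ∫ x in Metric.closedBall x₀ R, coneWeight R x₀ (t, x) * (oneSidedDeriv u timeDir₂ (t, x) ^ 2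
    + ∑ i, oneSidedDeriv u (spaceDir₂ i) (t, x) ^ 2 + u (max t 0, x) ^ 2)

lemma continuous_energy_integrand {u : ℝ × E → ℝ} (hu : ContDiffOn ℝ 2 u (Ici (0 : ℝ) ×ˢ univ))
    (R : ℝ) (x₀ : E) : Continuous fun p : ℝ × E => coneWeight R x₀ p *
      (oneSidedDeriv u timeDir₂ p ^ 2 + ∑ i, oneSidedDeriv u (spaceDir₂ i) p ^ 2
        + u (max p.1 0, p.2) ^ 2) := by
  have h1 := (contDiff_coneWeight R x₀).continuous
  have h2 := continuous_oneSidedDeriv hu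
  have h3 : Continuous fun p : ℝ × E => u (max p.1 0, p.2) :=
    hu.continuousOn.comp_continuous (by fun_prop) fun p =>
      ⟨mem_Ici.2 (le_max_right _ _), mem_univ _⟩
  have h4 := h2 timeDir₂
  have h5 := fun i : Fin n => h2 (spaceDir₂ i)
  exact h1.mul (((h4.pow 2).add (continuous_finsetSum _ fun i _ => (h5 i).pow 2)).add (h3.pow 2))

lemma continuous_localEnergyClosed {u : ℝ × E → ℝ}
    (hu : ContDiffOn ℝ 2 u (Ici (0 : ℝ) ×ˢ univ)) (R : ℝ) (x₀ : E) :
    Continuous (localEnergyClosed u R x₀) := by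
  have hKc : IsCompact (Metric.closedBall x₀ R) := isCompact_closedBall x₀ R
  have hρ : Integrable (fun _ : E => (1 : ℝ)) (volume.restrict (Metric.closedBall x₀ R)) :=
    integrableOn_const hKc.measure_lt_top.ne
  have hρK : ∀ᵐ y ∂(volume.restrict (Metric.closedBall x₀ R)), (1 : ℝ) ≠ 0 →
      y ∈ Metric.closedBall x₀ R := by
    filter_upwards [ae_restrict_mem hKc.measurableSet] with y hy _ using hy
  have := continuousOn_weighted_integral hρ hKc hρK isOpen_univ (P := ℝ)
    (h := fun t x => coneWeight R x₀ (t, x) * (oneSidedDeriv u timeDir₂ (t, x) ^ 2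
    + ∑ i, oneSidedDeriv u (spaceDir₂ i) (t, x) ^ 2 + u (max t 0, x) ^ 2))
    (continuous_energy_integrand hu R x₀).continuousOn
  rw [continuousOn_univ] at this
  simp only [one_smul] at this
  exact this

lemma localEnergyClosed_eq {u : ℝ × E → ℝ} {ε t : ℝ} (hε : 0 < ε) (ht : ε < t) (R : ℝ) (x₀ : E) :
    localEnergyClosed u R x₀ t = localEnergy (clamped ε u) R x₀ t := by
  have ht0 : 0 ≤ t := (hε.trans ht).le
  simp only [localEnergyClosed, localEnergy, energyDensity, oneSidedDeriv_eq hε ht,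
    clamped_eq hε ht.le, max_eq_left ht0]

/-- A classical solution of the homogeneous equation with vanishing data vanishes. -/
theorem IsClassicalSolution.eq_zero {μ ν : ℝ} (hμ : 0 ≤ μ) {u : ℝ → E → ℝ}
    (h : IsClassicalSolution n μ ν (fun _ _ => 0) (fun _ => 0) (fun _ => 0) u) {t₀ : ℝ}
    (ht₀ : 0 < t₀) (x₀ : E) : u t₀ x₀ = 0 := by
  set U : ℝ × E → ℝ := fun p => u p.1 p.2 with hU
  have hu : ContDiffOn ℝ 2 U (Ici (0 : ℝ) ×ˢ univ) := h.contDiffOn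
  have h0 : ∀ x, U (0, x) = 0 := h.initial_value
  -- for this `R` the weight at `(t₀, x₀)` is `1`
  set R := t₀ + 2 with hR
  set e := localEnergyClosed U R x₀ with he
  have hec : Continuous e := continuous_localEnergyClosed hu R x₀
  set L := 1 + ν ^ 2 with hL
  have hder : ∀ t, 0 < t → ∃ e', HasDerivAt e e' t ∧ e' ≤ L * e t := by
    intro t ht
    obtain ⟨e', h1, h2⟩ := localEnergy_deriv (contDiff_clamped (half_pos ht) hu) hμ (ν := ν) R x₀ ht
      (fun x => h.clamped_equation (half_pos ht) (half_lt_self ht) x)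
    refine ⟨e', h1.congr_of_eventuallyEq ?_, ?_⟩
    · filter_upwards [Ioi_mem_nhds (half_lt_self ht)] with s hs
      exact localEnergyClosed_eq (half_pos ht) hs R x₀
    · rwa [he, localEnergyClosed_eq (half_pos ht) (half_lt_self ht) R x₀]
  have he0 : e 0 = 0 := by
    have ht0 : ∀ x, oneSidedDeriv U timeDir₂ (0, x) = 0 := fun x =>
      (uniqueDiffOn_Ici (0 : ℝ) 0 (mem_Ici.2 le_rfl)).eq_deriv _ (hasDerivWithinAt_slice hu x)
        (h.initial_velocity x)
    simp only [he, localEnergyClosed, ht0, oneSidedDeriv_space_zero hu h0, max_self, h0]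
    simp
  have hnn : ∀ x, 0 ≤ coneWeight R x₀ (t₀, x) * (oneSidedDeriv U timeDir₂ (t₀, x) ^ 2
    + ∑ i, oneSidedDeriv U (spaceDir₂ i) (t₀, x) ^ 2 + U (max t₀ 0, x) ^ 2) := by
    intro x
    have : 0 ≤ ∑ i, oneSidedDeriv U (spaceDir₂ i) (t₀, x) ^ 2 :=
      Finset.sum_nonneg fun i _ => sq_nonneg _
    refine mul_nonneg (sq_nonneg _) (by positivity)
  -- Grönwall's argument
  have hanti : AntitoneOn (fun t => Real.exp (-L * t) * e t) (Icc 0 t₀) := by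
    have hd : ∀ t, 0 < t → ∃ g', HasDerivAt (fun t => Real.exp (-L * t) * e t) g' t ∧ g' ≤ 0 := by
      intro t ht
      obtain ⟨e', h1, h2⟩ := hder t ht
      have h3 : HasDerivAt (fun t => Real.exp (-L * t)) (Real.exp (-L * t) * -L) t := by
        simpa using ((hasDerivAt_id t).const_mul (-L)).exp
      refine ⟨_, h3.fun_mul h1, ?_⟩
      have : 0 < Real.exp (-L * t) := Real.exp_pos _
      nlinarith
    refine antitoneOn_of_deriv_nonpos (convex_Icc _ _) (by fun_prop) ?_ ?_
    · intro t ht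
      rw [interior_Icc] at ht
      obtain ⟨g', h1, _⟩ := hd t ht.1
      exact h1.differentiableAt.differentiableWithinAt
    · intro t ht
      rw [interior_Icc] at ht
      obtain ⟨g', h1, h2⟩ := hd t ht.1
      rwa [h1.deriv]
  have hle := hanti (left_mem_Icc.2 ht₀.le) (right_mem_Icc.2 ht₀.le) ht₀.le
  simp only [he0, mul_zero] at hle
  have hele : e t₀ ≤ 0 := nonpos_of_mul_nonpos_right hle (Real.exp_pos _)
  have hcont := (continuous_energy_integrand hu R x₀).comp
    (Continuous.prodMk_right t₀ : Continuous fun x : E => (t₀, x))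
  by_contra hne
  have hpos : 0 < e t₀ := by
    rw [he, localEnergyClosed]
    rw [setIntegral_pos_iff_support_of_nonneg_ae (ae_of_all _ hnn)
      (hcont.continuousOn.integrableOn_compact (isCompact_closedBall x₀ R))]
    refine lt_of_lt_of_le ?_ (measure_mono (inter_subset_inter_right _ Metric.ball_subset_closedBall))
    refine IsOpen.measure_pos _ ((hcont.isOpen_support).inter Metric.isOpen_ball)
      ⟨x₀, ?_, Metric.mem_ball_self (by linarith)⟩
    have hg : coneGap R x₀ (t₀, x₀) = 1 := by
      simp only [coneGap, hR, sub_self, norm_zero]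
      norm_num
    have hS : 0 ≤ ∑ i, oneSidedDeriv U (spaceDir₂ i) (t₀, x₀) ^ 2 :=
      Finset.sum_nonneg fun i _ => sq_nonneg _
    have hUne : U (max t₀ 0, x₀) ≠ 0 := by
      rw [max_eq_left ht₀.le]
      exact hne
    have hUpos : 0 < U (max t₀ 0, x₀) ^ 2 := by positivity
    rw [Function.mem_support]
    simp only [coneWeight, hg]
    positivity
  linarith

lemma IsClassicalSolution.sub {μ ν : ℝ} {g₁ g₂ : ℝ → E → ℝ} {a₁ a₂ b₁ b₂ : E → ℝ}
    {u₁ u₂ : ℝ → E → ℝ} (h₁ : IsClassicalSolution n μ ν g₁ a₁ b₁ u₁)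
    (h₂ : IsClassicalSolution n μ ν g₂ a₂ b₂ u₂) :
    IsClassicalSolution n μ ν (fun t x => g₁ t x - g₂ t x) (fun x => a₁ x - a₂ x)
      (fun x => b₁ x - b₂ x) (fun t x => u₁ t x - u₂ t x) := by
  have hu₁ := h₁.contDiffOn
  have hu₂ := h₂.contDiffOn
  refine ⟨hu₁.sub hu₂, fun t ht x => ?_, fun x => ?_, fun x => ?_⟩
  · rw [← h₁.equation t ht x, ← h₂.equation t ht x]
    have hs := fun {u : ℝ → E → ℝ}
      (hu : ContDiffOn ℝ 2 (fun p : ℝ × E => u p.1 p.2) (Ici (0 : ℝ) ×ˢ univ)) =>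
      (hu.contDiffAt (x := (t, x)) (prod_mem_nhds (Ici_mem_nhds ht) univ_mem))
    have ht' : ∀ {u : ℝ → E → ℝ},
        ContDiffOn ℝ 2 (fun p : ℝ × E => u p.1 p.2) (Ici (0 : ℝ) ×ˢ univ) →
        ContDiffAt ℝ 2 (fun s => u s x) t := fun hu =>
      (hs hu).comp t (f := fun s => (s, x)) (by fun_prop)
    have hx' : ∀ {u : ℝ → E → ℝ},
        ContDiffOn ℝ 2 (fun p : ℝ × E => u p.1 p.2) (Ici (0 : ℝ) ×ˢ univ) →
        ContDiffAt ℝ 2 (fun x => u t x) x := fun hu =>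
      (hs hu).comp x (f := fun x => (t, x)) (by fun_prop)
    have e1 := iteratedDeriv_fun_sub (n := 2) (ht' hu₁) (ht' hu₂)
    have e2 : Δ (fun x => u₁ t x - u₂ t x) x = Δ (u₁ t) x - Δ (u₂ t) x :=
      (hx' hu₁).laplacian_sub (hx' hu₂)
    have e3 : deriv (fun s => u₁ s x - u₂ s x) t
        = deriv (fun s => u₁ s x) t - deriv (fun s => u₂ s x) t :=
      deriv_fun_sub ((ht' hu₁).differentiableAt (by simp)) ((ht' hu₂).differentiableAt (by simp))
    rw [e1, e2, e3]
    ring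
  · simp only [h₁.initial_value, h₂.initial_value]
  · exact (h₁.initial_velocity x).sub (h₂.initial_velocity x)

/-- Classical solutions are unique. -/
theorem IsClassicalSolution.unique {μ ν : ℝ} (hμ : 0 ≤ μ) {g : ℝ → E → ℝ} {u₀ u₁ : E → ℝ}
    {u v : ℝ → E → ℝ} (hu : IsClassicalSolution n μ ν g u₀ u₁ u)
    (hv : IsClassicalSolution n μ ν g u₀ u₁ v) {t : ℝ} (ht : 0 < t) (x : E) : u t x = v t x := by
  have h := hu.sub hv
  simp only [sub_self] at h
  exact sub_eq_zero.1 (h.eq_zero hμ ht x)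

end Uniqueness

/-! ### Linearity of the wave operator -/

section Linearity

variable {n k : ℕ}

local notation "E" => EuclideanSpace ℝ (Fin n)

lemma descentMean_add_const_mul (hn : 0 < n) {φ ψ : ℝ × E → ℝ} (hφ : Continuous φ)
    (hψ : Continuous ψ) (r : ℝ) (p : ℝ × ℝ × E) :
    descentMean (fun z => φ z + r * ψ z) p = descentMean φ p + r * descentMean ψ p := by
  have hi : ∀ {φ : ℝ × E → ℝ}, Continuous φ →
      Integrable fun y : E => descentWeight y * φ (p.1, p.2.2 + p.2.1 • y) := fun hφ =>
    integrable_weighted (integrable_descentWeight hn) (isCompact_closedBall (0 : E) 1)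
      (ae_of_all _ fun y => descentWeight_ne_zero) (by fun_prop)
  have h1 := integral_add (hi hφ) ((hi hψ).const_mul r)
  rw [integral_const_mul] at h1
  unfold descentMean
  have h2 : ∀ y : E, descentWeight y * (φ (p.1, p.2.2 + p.2.1 • y) + r * ψ (p.1, p.2.2 + p.2.1 • y))
      = descentWeight y * φ (p.1, p.2.2 + p.2.1 • y)
        + r * (descentWeight y * ψ (p.1, p.2.2 + p.2.1 • y)) := fun y => by ring
  simp only [h2, h1]
  ring

lemma waveSeq_add_const_mul (hn : 0 < n) {φ ψ : ℝ × E → ℝ} (r : ℝ) (j : ℕ)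
    (hφ : ContDiff ℝ (j : WithTop ℕ∞) φ) (hψ : ContDiff ℝ (j : WithTop ℕ∞) ψ) :
    waveSeq k (fun z => φ z + r * ψ z) j = fun p => waveSeq k φ j p + r * waveSeq k ψ j p := by
  induction j with
  | zero => exact funext fun p => descentMean_add_const_mul hn hφ.continuous hψ.continuous r p
  | succ j ih =>
    have hle : ((j : ℕ) : WithTop ℕ∞) ≤ ((j + 1 : ℕ) : WithTop ℕ∞) := by
      exact_mod_cast Nat.le_succ j
    have hd : ∀ {φ : ℝ × E → ℝ}, ContDiff ℝ ((j + 1 : ℕ) : WithTop ℕ∞) φ →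
        Differentiable ℝ (waveSeq k φ j) := fun h =>
      (contDiff_waveSeq hn k (m := 1) j (by rwa [add_comm])).differentiable (by simp)
    funext p
    simp only [waveSeq, ih (hφ.of_le hle) (hψ.of_le hle)]
    rw [dirDeriv_add (hd hφ p) ((hd hψ p).const_mul r), dirDeriv_const_mul (hd hψ p)]
    ring

lemma waveVelocity_add_const_mul (hk : 0 < k) (hn : n = 2 * k) {φ ψ : ℝ × E → ℝ} (r : ℝ)
    (hφ : ContDiff ℝ (k : WithTop ℕ∞) φ) (hψ : ContDiff ℝ (k : WithTop ℕ∞) ψ) (p : ℝ × ℝ × E) :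
    waveVelocity k (fun z => φ z + r * ψ z) p = waveVelocity k φ p + r * waveVelocity k ψ p := by
  unfold waveVelocity
  rw [dirDeriv_waveSol hk hn (hφ.add (contDiff_const.mul hψ)), dirDeriv_waveSol hk hn hφ,
    dirDeriv_waveSol hk hn hψ, waveSeq_add_const_mul (by omega) r k hφ hψ]
  ring

end Linearity

/-! ### The representation formula for a real profile -/

section ReducedFormula

variable {n k : ℕ} {m c : ℝ} {q : ℝ → ℝ}

local notation "E" => EuclideanSpace ℝ (Fin n)

/-- Integration by parts moves the derivative from the kernel to the wave. -/
lemma transmute_derivedKernel_eq (hk : 0 < k) (hn : n = 2 * k) (hq : IsRealProfile m c q)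
    {φ : ℝ × E → ℝ} (hφ : ContDiff ℝ (k : WithTop ℕ∞) φ) {β b t : ℝ} (hb : 0 ≤ b) (hbt : b ≤ t)
    (x : E) :
    transmute c (waveSol k φ) (derivedKernel dirS q) (β, b, t, x)
      = ∫ s in (0 : ℝ)..(t - b), waveVelocity k φ (β, s, x) * kappa q (t, b, s) := by
  have hV : ContDiff ℝ 1 (waveSol k φ) :=
    contDiff_waveSol (m := 1) hk hn (by rwa [show 1 + (k - 1) = k by omega])
  have hκ : ContDiff ℝ 1 (kappa q) := hq.contDiff_kappa (j := 1)
  have dV := hV.differentiable one_ne_zero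
  have dκ := hκ.differentiable one_ne_zero
  have cV := hV.continuous
  have cκ := hκ.continuous
  have cV' : Continuous (waveVelocity k φ) := continuous_dirDeriv hV timeDir
  have cκ' := continuous_dirDeriv hκ dirS
  have h := intervalIntegral.integral_eq_sub_of_hasDerivAt (a := 0) (b := t - b)
    (f := fun s => waveSol k φ (β, s, x) * kappa q (t, b, s))
    (f' := fun s => waveVelocity k φ (β, s, x) * kappa q (t, b, s)
      + waveSol k φ (β, s, x) * dirDeriv dirS (kappa q) (t, b, s))
    (fun s _ => (hasDerivAt_wave_time dV β s x).fun_mul (hasDerivAt_dirS dκ t b s))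
    (Continuous.intervalIntegrable (by fun_prop) _ _)
  rw [intervalIntegral.integral_add (Continuous.intervalIntegrable (by fun_prop) _ _)
    (Continuous.intervalIntegrable (by fun_prop) _ _)] at h
  have hz : kappa q (t, b, t - b) = c := by
    rw [kappa, zeta_eq (by linarith) (by linarith)]
    simp [hq.at_zero]
  rw [hz, waveSol_zero] at h
  rw [transmute, primitiveAt_transmuteIntegrand, wavePoint_apply]
  have e : ∫ s in (0 : ℝ)..(t - b), waveSol k φ (β, s, x) * derivedKernel dirS q (t, b, s)
      = (-1) * ∫ s in (0 : ℝ)..(t - b), waveSol k φ (β, s, x) * dirDeriv dirS (kappa q) (t, b, s) := by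
    rw [← intervalIntegral.integral_const_mul]
    refine intervalIntegral.integral_congr fun s _ => ?_
    simp only [derivedKernel]
    ring
  rw [e]
  simp only
  linear_combination -h

variable {F : ℝ × EuclideanSpace ℝ (Fin n) → ℝ} {u₀ g : EuclideanSpace ℝ (Fin n) → ℝ} {μ : ℝ}

/-- The representation formula without the damping factor, for a reduced kernel `q`;
here `g = u₁ + μ u₀`. -/
noncomputable def reducedFormula (k : ℕ) (μ c : ℝ) (q : ℝ → ℝ) (F : ℝ × E → ℝ) (u₀ g : E → ℝ)
    (t : ℝ) (x : E) : ℝ :=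
  c * waveVelocity k (fun z => u₀ z.2) (0, t, x)
    + (∫ s in (0 : ℝ)..t, waveVelocity k (fun z => u₀ z.2) (0, s, x)
        * (derivedKernel dirB q (t, 0, s) - μ / 2 * kappa q (t, 0, s)))
    + (∫ s in (0 : ℝ)..t, waveVelocity k (fun z => g z.2) (0, s, x) * kappa q (t, 0, s))
    + ∫ b in (0 : ℝ)..t, posTime b ^ (μ / 2)
        * ∫ s in (0 : ℝ)..(t - b), waveVelocity k F (√b, s, x) * kappa q (t, b, s)

/-- The summand `μ/2` of the velocity `u₁ + (μ/2) u₀` of the reduced problem is completed to `u₁ + μ u₀`,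
at the expense of the kernel of `w[u₀]`. -/
lemma undamped_eq_reducedFormula (hk : 0 < k) (hn : n = 2 * k) (hq : IsRealProfile m c q)
    {u₁ : E → ℝ} (hF : ContDiff ℝ (k : WithTop ℕ∞) F) (hu₀ : ContDiff ℝ (k : WithTop ℕ∞) u₀)
    (hu₁ : ContDiff ℝ (k : WithTop ℕ∞) u₁) {t : ℝ} (ht : 0 ≤ t) (x : E) :
    undamped k μ c q F u₀ (fun x => u₁ x + μ / 2 * u₀ x) (t, x)
      = reducedFormula k μ c q F u₀ (fun x => u₁ x + μ * u₀ x) t x := by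
  have hU₀ : ContDiff ℝ (k : WithTop ℕ∞) fun z : ℝ × E => u₀ z.2 := hu₀.comp contDiff_snd
  have hU₁ : ContDiff ℝ (k : WithTop ℕ∞) fun z : ℝ × E => u₁ z.2 + μ / 2 * u₀ z.2 :=
    (hu₁.comp contDiff_snd).add (contDiff_const.mul hU₀)
  have hlin : ∀ p : ℝ × ℝ × E, waveVelocity k (fun z : ℝ × E => u₁ z.2 + μ * u₀ z.2) p
      = waveVelocity k (fun z : ℝ × E => u₁ z.2 + μ / 2 * u₀ z.2) p
        + μ / 2 * waveVelocity k (fun z : ℝ × E => u₀ z.2) p := by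
    intro p
    rw [← waveVelocity_add_const_mul hk hn (μ / 2) hU₁ hU₀]
    congr 2
    funext z
    ring
  have cκ := (hq.contDiff_kappa (j := 0)).continuous
  have cB := (hq.contDiff_derivedKernel dirB (j := 0)).continuous
  have cw : ∀ {φ : ℝ × E → ℝ}, ContDiff ℝ (k : WithTop ℕ∞) φ → Continuous (waveVelocity k φ) :=
    fun hφ => (contDiff_waveVelocity (j := 0) hk hn (by simpa using hφ)).continuous
  have c0 := cw hU₀
  have c1 := cw hU₁
  have e1 : ∫ s in (0 : ℝ)..t, waveVelocity k (fun z : ℝ × E => u₁ z.2 + μ * u₀ z.2) (0, s, x)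
        * kappa q (t, 0, s)
      = (∫ s in (0 : ℝ)..t, waveVelocity k (fun z : ℝ × E => u₁ z.2 + μ / 2 * u₀ z.2) (0, s, x)
        * kappa q (t, 0, s))
      + ∫ s in (0 : ℝ)..t, waveVelocity k (fun z : ℝ × E => u₀ z.2) (0, s, x)
        * (μ / 2 * kappa q (t, 0, s)) := by
    rw [← intervalIntegral.integral_add (Continuous.intervalIntegrable (by fun_prop) _ _)
      (Continuous.intervalIntegrable (by fun_prop) _ _)]
    refine intervalIntegral.integral_congr fun s _ => ?_
    simp only [hlin]
    ring
  have e2 : ∫ s in (0 : ℝ)..t, waveVelocity k (fun z : ℝ × E => u₀ z.2) (0, s, x)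
        * derivedKernel dirB q (t, 0, s)
      = (∫ s in (0 : ℝ)..t, waveVelocity k (fun z : ℝ × E => u₀ z.2) (0, s, x)
        * (derivedKernel dirB q (t, 0, s) - μ / 2 * kappa q (t, 0, s)))
      + ∫ s in (0 : ℝ)..t, waveVelocity k (fun z : ℝ × E => u₀ z.2) (0, s, x)
        * (μ / 2 * kappa q (t, 0, s)) := by
    rw [← intervalIntegral.integral_add (Continuous.intervalIntegrable (by fun_prop) _ _)
      (Continuous.intervalIntegrable (by fun_prop) _ _)]
    refine intervalIntegral.integral_congr fun s _ => ?_
    ring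
  have e3 : ∫ b in (0 : ℝ)..t, sourcePart k μ c q F (√b, b, t, x)
      = ∫ b in (0 : ℝ)..t, posTime b ^ (μ / 2)
        * ∫ s in (0 : ℝ)..(t - b), waveVelocity k F (√b, s, x) * kappa q (t, b, s) := by
    refine intervalIntegral.integral_congr fun b hb => ?_
    rw [uIcc_of_le ht] at hb
    simp only [sourcePart]
    rw [transmute_derivedKernel_eq hk hn hq hF hb.1 hb.2]
  have e4 := transmute_derivedKernel_eq hk hn hq hU₁ (β := 0) (b := 0) le_rfl ht x
  simp only [sub_zero] at e4
  simp only [undamped, reducedFormula, homogeneousPart, zeroStart_apply, outerIntegral,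
    ContinuousLinearMap.coe_fst', e3, e4]
  rw [transmute, primitiveAt_transmuteIntegrand, wavePoint_apply]
  simp only [sub_zero]
  linear_combination e2 - e1

end ReducedFormula

/-! ### The complex kernel -/

section ComplexKernel

/-- The exponent `(1 - √δ)/2`. -/
noncomputable def kernelExponent (μ ν : ℝ) : ℂ := (1 - sqrtDiscr μ ν) / 2

lemma kernelExponent_mul (μ ν : ℝ) :
    kernelExponent μ ν * (1 - kernelExponent μ ν) = ((μ * (2 - μ) / 4 + ν ^ 2 : ℝ) : ℂ) := by
  have h : sqrtDiscr μ ν ^ 2 = ((discr μ ν : ℝ) : ℂ) := by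
    rw [sqrtDiscr, ← Complex.cpow_nat_mul]
    norm_num
  rw [discr] at h
  push_cast at h ⊢
  rw [kernelExponent]
  linear_combination (-1 / 4) * h

/-- The complex kernel with real part `k₁` and imaginary part `k₂`. -/
noncomputable def complexKernel (k₁ k₂ : ℝ × ℝ × ℝ → ℝ) (p : ℝ × ℝ × ℝ) : ℂ :=
  (k₁ p : ℂ) + (k₂ p : ℂ) * Complex.I

lemma profile_eq_cutProfile (a : ℂ) {ζ : ℝ} (hζ : ζ ≤ 1 / 8) :
    profile a ζ = (cutProfile Complex.reCLM a ζ : ℂ)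
      + (cutProfile Complex.imCLM a ζ : ℂ) * Complex.I := by
  rw [cutProfile_eq _ _ hζ, cutProfile_eq _ _ hζ]
  exact (Complex.re_add_im _).symm

lemma ofReal_cpow_eq_exp {r : ℝ} (hr : 0 < r) (z : ℂ) :
    (r : ℂ) ^ z = Complex.exp ((Real.log r : ℂ) * z) := by
  rw [Complex.cpow_def_of_ne_zero (by exact_mod_cast hr.ne'), Complex.ofReal_log hr.le]

/-- The kernel `E` in terms of the profile: the denominator `(t + b + 2)² - s²` equals
`4 (1 + t) (1 + b) (1 - ζ)`, and the argument of the hypergeometric function is `ζ / (ζ - 1)`. -/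
lemma kernelE_eq_profile (μ ν : ℝ) {t b s : ℝ} (ht : -1 / 2 ≤ t) (hb : -1 / 2 ≤ b)
    (hz : zeta (t, b, s) < 1) :
    kernelE μ ν t 0 b s = (2 : ℂ) ^ (sqrtDiscr μ ν - 1)
      * ((posTime t ^ (-μ / 2) * posTime b ^ (μ / 2) : ℝ)
        * profile (kernelExponent μ ν) (zeta (t, b, s))) := by
  have hT : 0 < 1 + t := by linarith
  have hB : 0 < 1 + b := by linarith
  have hz' := hz
  have h1z : 0 < 1 - zeta (t, b, s) := by linarith
  have hzeq := zeta_eq ht hb s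
  set ζ := zeta (t, b, s) with hζ
  have hD : (t + b + 2) ^ 2 - (s - 0) ^ 2 = 4 * (1 + t) * (1 + b) * (1 - ζ) := by
    rw [hzeq]; field_simp; ring
  have harg : ((t - b) ^ 2 - (s - 0) ^ 2) / ((t + b + 2) ^ 2 - (s - 0) ^ 2) = ζ / (ζ - 1) := by
    have h1 : (t - b) ^ 2 - (s - 0) ^ 2 = 4 * (1 + t) * (1 + b) * (-ζ) := by
      rw [hzeq]; field_simp; ring
    have h2 : ζ - 1 ≠ 0 := by linarith
    rw [hD, h1]
    field_simp
    ring
  have hDpos : 0 < 4 * (1 + t) * (1 + b) * (1 - ζ) := by positivity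
  have hlog : Real.log (4 * (1 + t) * (1 + b) * (1 - ζ))
      = 2 * Real.log 2 + Real.log (1 + t) + Real.log (1 + b) + Real.log (1 - ζ) := by
    rw [Real.log_mul (by positivity) h1z.ne', Real.log_mul (by positivity) hB.ne',
      Real.log_mul (by norm_num) hT.ne', show (4 : ℝ) = 2 ^ 2 by norm_num, Real.log_pow]
    norm_num
  have h2 : (2 : ℂ) = ((2 : ℝ) : ℂ) := by norm_num
  -- all powers are exponentials of real logarithms
  rw [kernelE, harg, hD, profile, posTime_eq ht, posTime_eq hb, Real.rpow_def_of_pos hT,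
    Real.rpow_def_of_pos hB, ofReal_cpow_eq_exp hT, ofReal_cpow_eq_exp hB, ofReal_cpow_eq_exp hDpos,
    hlog, h2, ofReal_cpow_eq_exp (by norm_num : (0 : ℝ) < 2), kernelExponent]
  push_cast
  rw [← Complex.exp_add, ← Complex.exp_add, ← mul_assoc, ← mul_assoc, ← Complex.exp_add,
    ← Complex.exp_add, ← Complex.exp_add]
  congr 2
  ring

variable (μ ν : ℝ)

/-- The real part of the reduced kernel. -/
noncomputable def profileRe : ℝ → ℝ := cutProfile Complex.reCLM (kernelExponent μ ν)

/-- The imaginary part of the reduced kernel. -/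
noncomputable def profileIm : ℝ → ℝ := cutProfile Complex.imCLM (kernelExponent μ ν)

lemma isRealProfile_profileRe : IsRealProfile (μ * (2 - μ) / 4 + ν ^ 2) 1 (profileRe μ ν) := by
  simpa [profileRe] using isRealProfile_cutProfile Complex.reCLM (kernelExponent_mul μ ν)

lemma isRealProfile_profileIm : IsRealProfile (μ * (2 - μ) / 4 + ν ^ 2) 0 (profileIm μ ν) := by
  simpa [profileIm] using isRealProfile_cutProfile Complex.imCLM (kernelExponent_mul μ ν)

variable {μ ν}

lemma kernelE_eq {t b s : ℝ} (h : (t, b, s) ∈ kernelDomain) :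
    kernelE μ ν t 0 b s = (2 : ℂ) ^ (sqrtDiscr μ ν - 1)
      * ((posTime t ^ (-μ / 2) * posTime b ^ (μ / 2) : ℝ)
        * complexKernel (kappa (profileRe μ ν)) (kappa (profileIm μ ν)) (t, b, s)) := by
  obtain ⟨ht, hb, hz⟩ := h
  rw [kernelE_eq_profile μ ν ht.le hb.le (by linarith), profile_eq_cutProfile _ hz.le]
  rfl

lemma kernelK₁_eq {t s : ℝ} (hs : 0 ≤ s) (hst : s ≤ t) :
    kernelK₁ μ ν t 0 s = (2 : ℂ) ^ (sqrtDiscr μ ν - 1) * ((posTime t ^ (-μ / 2) : ℝ)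
        * complexKernel (kappa (profileRe μ ν)) (kappa (profileIm μ ν)) (t, 0, s)) := by
  rw [kernelK₁, kernelE_eq (mem_kernelDomain le_rfl hs (by linarith)),
    posTime_eq (t := 0) (by norm_num)]
  simp

/-- The kernel `-∂_b ((1 + b)^{μ/2} q(ζ))` at `b = 0` that multiplies `w[u₀]`. -/
noncomputable def initialKernel (μ : ℝ) (q : ℝ → ℝ) (p : ℝ × ℝ × ℝ) : ℝ :=
  derivedKernel dirB q p - μ / 2 * kappa q p

lemma IsRealProfile.hasDerivAt_initialKernel {m c : ℝ} {q : ℝ → ℝ} (hq : IsRealProfile m c q)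
    (μ t s : ℝ) :
    HasDerivAt (fun b => posTime b ^ (μ / 2) * kappa q (t, b, s)) (-initialKernel μ q (t, 0, s)) 0 := by
  have h1 := hasDerivAt_dirB ((hq.contDiff_kappa (j := 1)).differentiable (by simp)) t 0 s
  refine ((hasDerivAt_posTime_rpow (μ / 2) (by norm_num)).fun_mul h1).congr_deriv ?_
  rw [posTime_eq (t := 0) (by norm_num), initialKernel, derivedKernel]
  simp

/-- The derivative of `E` in `b` at zero. The point may lie on the boundary `s = t` of the characteristic
triangle, but it is an interior point of `kernelDomain`. -/
lemma hasDerivAt_kernelE {t s : ℝ} (hs : 0 ≤ s) (hst : s ≤ t) :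
    HasDerivAt (fun b => kernelE μ ν t 0 b s)
      (-((2 : ℂ) ^ (sqrtDiscr μ ν - 1) * ((posTime t ^ (-μ / 2) : ℝ) * complexKernel
        (initialKernel μ (profileRe μ ν)) (initialKernel μ (profileIm μ ν)) (t, 0, s)))) 0 := by
  have h1 := ((isRealProfile_profileRe μ ν).hasDerivAt_initialKernel μ t s).ofReal_comp
  have h2 := ((isRealProfile_profileIm μ ν).hasDerivAt_initialKernel μ t s).ofReal_comp
  have h3 := ((h1.fun_add (h2.mul_const Complex.I)).const_mul
    ((posTime t ^ (-μ / 2) : ℝ) : ℂ)).const_mul ((2 : ℂ) ^ (sqrtDiscr μ ν - 1))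
  have h4 : (fun b : ℝ => (t, b, s)) ⁻¹' kernelDomain ∈ 𝓝 (0 : ℝ) :=
    (isOpen_kernelDomain.preimage (by fun_prop)).mem_nhds
      (mem_kernelDomain le_rfl hs (by linarith))
  refine (h3.congr_of_eventuallyEq ?_).congr_deriv ?_
  · filter_upwards [h4] with b hb
    rw [kernelE_eq hb, complexKernel]
    push_cast
    ring
  · rw [complexKernel]
    push_cast
    ring

lemma kernelK₀_eq {t s : ℝ} (hs : 0 ≤ s) (hst : s ≤ t) :
    kernelK₀ μ ν t 0 s = (2 : ℂ) ^ (sqrtDiscr μ ν - 1) * ((posTime t ^ (-μ / 2) : ℝ)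
      * complexKernel (initialKernel μ (profileRe μ ν)) (initialKernel μ (profileIm μ ν))
        (t, 0, s)) := by
  rw [kernelK₀, (hasDerivAt_kernelE hs hst).deriv, neg_neg]

lemma integral_mul_complexKernel {w : ℝ → ℝ} {k₁ k₂ : ℝ × ℝ × ℝ → ℝ} (hw : Continuous w)
    (h₁ : Continuous k₁) (h₂ : Continuous k₂) (A : ℂ) (t b d : ℝ) :
    ∫ s in (0 : ℝ)..d, (w s : ℂ) * (A * complexKernel k₁ k₂ (t, b, s))
      = A * (((∫ s in (0 : ℝ)..d, w s * k₁ (t, b, s) : ℝ) : ℂ)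
        + ((∫ s in (0 : ℝ)..d, w s * k₂ (t, b, s) : ℝ) : ℂ) * Complex.I) := by
  rw [← intervalIntegral.integral_ofReal, ← intervalIntegral.integral_ofReal,
    ← intervalIntegral.integral_mul_const, ← intervalIntegral.integral_add
      (Continuous.intervalIntegrable (by fun_prop) _ _)
      (Continuous.intervalIntegrable (by fun_prop) _ _), ← intervalIntegral.integral_const_mul]
  refine intervalIntegral.integral_congr fun s _ => ?_
  simp only [complexKernel]
  push_cast
  ring

end ComplexKernel

/-! ### The representation formula -/

section Formula

variable {n k : ℕ} {μ ν : ℝ}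

local notation "E" => EuclideanSpace ℝ (Fin n)

variable {f : ℝ → EuclideanSpace ℝ (Fin n) → ℝ} {F : ℝ × EuclideanSpace ℝ (Fin n) → ℝ}
  {u₀ u₁ : EuclideanSpace ℝ (Fin n) → ℝ}

lemma continuous_waveVelocity (hk : 0 < k) (hn : n = 2 * k) {φ : ℝ × E → ℝ}
    (hφ : ContDiff ℝ (k : WithTop ℕ∞) φ) : Continuous (waveVelocity k φ) :=
  (contDiff_waveVelocity (j := 0) hk hn (by simpa using hφ)).continuous

lemma IsRealProfile.continuous_kappa {m c : ℝ} {q : ℝ → ℝ} (hq : IsRealProfile m c q) :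
    Continuous (kappa q) := (hq.contDiff_kappa (j := 0)).continuous

lemma IsRealProfile.continuous_initialKernel {m c : ℝ} {q : ℝ → ℝ} (hq : IsRealProfile m c q)
    (μ : ℝ) : Continuous (initialKernel μ q) :=
  (hq.contDiff_derivedKernel dirB (j := 0)).continuous.sub (continuous_const.mul hq.continuous_kappa)

lemma continuous_complexKernel {k₁ k₂ : ℝ × ℝ × ℝ → ℝ} (h₁ : Continuous k₁) (h₂ : Continuous k₂) :
    Continuous (complexKernel k₁ k₂) := by
  unfold complexKernel
  fun_prop

lemma inner_integrand_eq (hk : 0 < k) (hn : n = 2 * k) (hF : ContDiff ℝ (k : WithTop ℕ∞) F)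
    (hfF : ∀ b, 0 ≤ b → f b = fun z => F (√b, z)) {t b s : ℝ} (hb : 0 ≤ b) (hs : 0 < s)
    (hst : s ≤ t - b) (x : E) :
    (evenWaveOp n (f b) s x : ℂ) * kernelE μ ν t 0 b s
      = (waveVelocity k F (√b, s, x) : ℂ) * ((2 : ℂ) ^ (sqrtDiscr μ ν - 1)
        * (posTime t ^ (-μ / 2) * posTime b ^ (μ / 2) : ℝ)
        * complexKernel (kappa (profileRe μ ν)) (kappa (profileIm μ ν)) (t, b, s)) := by
  rw [hfF b hb, evenWaveOp_eq hk hn hF (√b) x hs, kernelE_eq (mem_kernelDomain hb hs.le hst),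
    waveVelocity]
  ring

lemma inner_integral_eq (hk : 0 < k) (hn : n = 2 * k) (hF : ContDiff ℝ (k : WithTop ℕ∞) F)
    (hfF : ∀ b, 0 ≤ b → f b = fun z => F (√b, z)) {t b : ℝ} (hb : 0 ≤ b) (hbt : b ≤ t) (x : E) :
    ∫ s in (0 : ℝ)..(t - b), (evenWaveOp n (f b) s x : ℂ) * kernelE μ ν t 0 b s
      = (2 : ℂ) ^ (sqrtDiscr μ ν - 1) * (posTime t ^ (-μ / 2) : ℝ)
        * (((posTime b ^ (μ / 2) * ∫ s in (0 : ℝ)..(t - b), waveVelocity k F (√b, s, x)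
            * kappa (profileRe μ ν) (t, b, s) : ℝ) : ℂ)
          + ((posTime b ^ (μ / 2) * ∫ s in (0 : ℝ)..(t - b), waveVelocity k F (√b, s, x)
            * kappa (profileIm μ ν) (t, b, s) : ℝ) : ℂ) * Complex.I) := by
  have cw := continuous_waveVelocity hk hn hF
  have h1 := intervalIntegral.integral_congr_Ioo_of_le (μ := volume) (sub_nonneg.2 hbt)
    (f := fun s => (evenWaveOp n (f b) s x : ℂ) * kernelE μ ν t 0 b s)
    (g := fun s => (waveVelocity k F (√b, s, x) : ℂ) * ((2 : ℂ) ^ (sqrtDiscr μ ν - 1)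
        * (posTime t ^ (-μ / 2) * posTime b ^ (μ / 2) : ℝ)
        * complexKernel (kappa (profileRe μ ν)) (kappa (profileIm μ ν)) (t, b, s)))
    (fun s hs => inner_integrand_eq hk hn hF hfF hb hs.1 hs.2.le x)
  rw [h1, integral_mul_complexKernel (w := fun s => waveVelocity k F (√b, s, x)) (by fun_prop)
    (isRealProfile_profileRe μ ν).continuous_kappa (isRealProfile_profileIm μ ν).continuous_kappa]
  push_cast
  ring

lemma continuous_inner_integral (hk : 0 < k) (hn : n = 2 * k) (hF : ContDiff ℝ (k : WithTop ℕ∞) F)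
    {q : ℝ → ℝ} (hq : Continuous (kappa q)) (μ t : ℝ) (x : E) :
    Continuous fun b => posTime b ^ (μ / 2)
      * ∫ s in (0 : ℝ)..(t - b), waveVelocity k F (√b, s, x) * kappa q (t, b, s) := by
  have cw := continuous_waveVelocity hk hn hF
  have cp := (contDiff_posTime_rpow (m := 0) (μ / 2)).continuous
  refine cp.mul ?_
  exact intervalIntegral.continuous_parametric_intervalIntegral_of_continuous
    (f := fun b s => waveVelocity k F (√b, s, x) * kappa q (t, b, s)) (by fun_prop) (by fun_prop)

lemma evenWaveOp_eq_waveVelocity (hk : 0 < k) (hn : n = 2 * k) {φ : E → ℝ}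
    (hφ : ContDiff ℝ (k : WithTop ℕ∞) φ) {s : ℝ} (hs : 0 < s) (x : E) :
    evenWaveOp n φ s x = waveVelocity k (fun z : ℝ × E => φ z.2) (0, s, x) :=
  evenWaveOp_eq hk hn (φ := fun z : ℝ × E => φ z.2) (hφ.comp contDiff_snd) 0 x hs

lemma initial_integrand_eq (hk : 0 < k) (hn : n = 2 * k) {φ : E → ℝ}
    (hφ : ContDiff ℝ (k : WithTop ℕ∞) φ) {t : ℝ} (x : E) {K : ℝ → ℂ} {K' : ℝ × ℝ × ℝ → ℂ} {A : ℂ}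
    (hK : ∀ s, 0 ≤ s → s ≤ t → K s = A * K' (t, 0, s)) :
    EqOn (fun s => (evenWaveOp n φ s x : ℂ) * K s) (fun s =>
      (waveVelocity k (fun z : ℝ × E => φ z.2) (0, s, x) : ℂ) * (A * K' (t, 0, s)))
      (Ioo 0 t) := by
  intro s hs
  simp only
  rw [hK s hs.1.le hs.2.le, evenWaveOp_eq_waveVelocity hk hn hφ hs.1]

/-- All terms of the representation formula are well defined. -/
lemma evenRepresentationWellDefined (hk : 0 < k) (hn : n = 2 * k)
    (hF : ContDiff ℝ (k : WithTop ℕ∞) F) (hfF : ∀ b, 0 ≤ b → f b = fun z => F (√b, z))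
    (hu₀ : ContDiff ℝ (k : WithTop ℕ∞) u₀) (hu₁ : ContDiff ℝ (k : WithTop ℕ∞) u₁) {t : ℝ}
    (ht : 0 < t) (x : E) : EvenRepresentationWellDefined n μ ν f u₀ u₁ t x := by
  have hRe := isRealProfile_profileRe μ ν
  have hIm := isRealProfile_profileIm μ ν
  have hg : ContDiff ℝ (k : WithTop ℕ∞) fun z => u₁ z + μ * u₀ z := hu₁.add (contDiff_const.mul hu₀)
  have hwd : ∀ {φ : E → ℝ}, ContDiff ℝ (k : WithTop ℕ∞) φ → ∀ s, 0 < s →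
      EvenWaveOpWellDefined n φ s x := fun {φ} hφ s hs =>
    evenWaveOpWellDefined_of_contDiff hk hn (φ := fun z : ℝ × E => φ z.2) (hφ.comp contDiff_snd)
      0 x hs
  have cw : ∀ {φ : E → ℝ}, ContDiff ℝ (k : WithTop ℕ∞) φ →
      Continuous (waveVelocity k fun z : ℝ × E => φ z.2) := fun hφ =>
    continuous_waveVelocity hk hn (hφ.comp contDiff_snd)
  have cF := continuous_waveVelocity hk hn hF
  have cK := continuous_complexKernel hRe.continuous_kappa hIm.continuous_kappa
  have cK0 := continuous_complexKernel (hRe.continuous_initialKernel μ)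
    (hIm.continuous_initialKernel μ)
  refine ⟨fun s hs _ => hwd hu₀ s hs, fun s hs _ => hwd hg s hs, fun b hb s hs _ => ?_,
    fun s hs => (hasDerivAt_kernelE hs.1 hs.2).differentiableAt, ?_, ?_, fun b hb => ?_, ?_⟩
  · rw [hfF b hb.1]
    exact evenWaveOpWellDefined_of_contDiff hk hn hF (√b) x hs
  · refine IntervalIntegrable.congr_uIoo ?_ (by
      rw [uIoo_of_le ht.le]
      exact (initial_integrand_eq hk hn hu₀ x (A := (2 : ℂ) ^ (sqrtDiscr μ ν - 1)
        * (posTime t ^ (-μ / 2) : ℝ)) fun s hs hst => by rw [kernelK₀_eq hs hst, mul_assoc]).symm)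
    have := cw hu₀
    exact Continuous.intervalIntegrable (by fun_prop) _ _
  · refine IntervalIntegrable.congr_uIoo ?_ (by
      rw [uIoo_of_le ht.le]
      exact (initial_integrand_eq hk hn hg x (A := (2 : ℂ) ^ (sqrtDiscr μ ν - 1)
        * (posTime t ^ (-μ / 2) : ℝ)) fun s hs hst => by rw [kernelK₁_eq hs hst, mul_assoc]).symm)
    have := cw hg
    exact Continuous.intervalIntegrable (by fun_prop) _ _
  · refine IntervalIntegrable.congr_uIoo (f := fun s => (waveVelocity k F (√b, s, x) : ℂ)
        * ((2 : ℂ) ^ (sqrtDiscr μ ν - 1) * (posTime t ^ (-μ / 2) * posTime b ^ (μ / 2) : ℝ)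
        * complexKernel (kappa (profileRe μ ν)) (kappa (profileIm μ ν)) (t, b, s))) ?_ ?_
    · exact Continuous.intervalIntegrable (by fun_prop) _ _
    · rw [uIoo_of_le (sub_nonneg.2 hb.2)]
      exact fun s hs => (inner_integrand_eq hk hn hF hfF hb.1 hs.1 hs.2.le x).symm
  · have c1 := continuous_inner_integral hk hn hF hRe.continuous_kappa μ t x
    have c2 := continuous_inner_integral hk hn hF hIm.continuous_kappa μ t x
    refine IntervalIntegrable.congr_uIoo (f := fun b => (2 : ℂ) ^ (sqrtDiscr μ ν - 1)
        * (posTime t ^ (-μ / 2) : ℝ)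
        * (((posTime b ^ (μ / 2) * ∫ s in (0 : ℝ)..(t - b), waveVelocity k F (√b, s, x)
            * kappa (profileRe μ ν) (t, b, s) : ℝ) : ℂ)
          + ((posTime b ^ (μ / 2) * ∫ s in (0 : ℝ)..(t - b), waveVelocity k F (√b, s, x)
            * kappa (profileIm μ ν) (t, b, s) : ℝ) : ℂ) * Complex.I)) ?_ ?_
    · refine Continuous.intervalIntegrable (continuous_const.mul ?_) _ _
      exact (Complex.continuous_ofReal.comp c1).add
        ((Complex.continuous_ofReal.comp c2).mul continuous_const)
    · rw [uIoo_of_le ht.le]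
      exact fun b hb => (inner_integral_eq hk hn hF hfF hb.1.le hb.2.le x).symm

/-- The real and imaginary parts of the representation formula are the solutions for the real and
the imaginary part of the profile. -/
lemma evenRepresentation_eq (hk : 0 < k) (hn : n = 2 * k)
    (hF : ContDiff ℝ (k : WithTop ℕ∞) F) (hfF : ∀ b, 0 ≤ b → f b = fun z => F (√b, z))
    (hu₀ : ContDiff ℝ (k : WithTop ℕ∞) u₀) (hu₁ : ContDiff ℝ (k : WithTop ℕ∞) u₁) {t : ℝ}
    (ht : 0 < t) (x : E) :
    evenRepresentation n μ ν f u₀ u₁ t x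
      = ((posTime t ^ (-μ / 2) * reducedFormula k μ 1 (profileRe μ ν) F u₀
          (fun z => u₁ z + μ * u₀ z) t x : ℝ) : ℂ)
        + ((posTime t ^ (-μ / 2) * reducedFormula k μ 0 (profileIm μ ν) F u₀
          (fun z => u₁ z + μ * u₀ z) t x : ℝ) : ℂ) * Complex.I := by
  have hRe := isRealProfile_profileRe μ ν
  have hIm := isRealProfile_profileIm μ ν
  have hg : ContDiff ℝ (k : WithTop ℕ∞) fun z => u₁ z + μ * u₀ z := hu₁.add (contDiff_const.mul hu₀)
  have cw : ∀ {φ : E → ℝ}, ContDiff ℝ (k : WithTop ℕ∞) φ →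
      Continuous (waveVelocity k fun z : ℝ × E => φ z.2) := fun hφ =>
    continuous_waveVelocity hk hn (hφ.comp contDiff_snd)
  have cw0 := cw hu₀
  have cwg := cw hg
  set C : ℂ := (2 : ℂ) ^ (sqrtDiscr μ ν - 1) with hC
  have hC0 : C ≠ 0 := by
    rw [hC, Complex.cpow_def_of_ne_zero (by norm_num)]
    exact Complex.exp_ne_zero _
  have e0 := intervalIntegral.integral_congr_Ioo_of_le (μ := volume) ht.le
    (initial_integrand_eq hk hn hu₀ x (A := C * (posTime t ^ (-μ / 2) : ℝ))
      (K := kernelK₀ μ ν t 0) (K' := complexKernel (initialKernel μ (profileRe μ ν))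
        (initialKernel μ (profileIm μ ν)))
      fun s hs hst => by rw [kernelK₀_eq hs hst, mul_assoc])
  have e1 := intervalIntegral.integral_congr_Ioo_of_le (μ := volume) ht.le
    (initial_integrand_eq hk hn hg x (A := C * (posTime t ^ (-μ / 2) : ℝ))
      (K := kernelK₁ μ ν t 0) (K' := complexKernel (kappa (profileRe μ ν)) (kappa (profileIm μ ν)))
      fun s hs hst => by rw [kernelK₁_eq hs hst, mul_assoc])
  rw [integral_mul_complexKernel
    (w := fun s => waveVelocity k (fun z : ℝ × E => u₀ z.2) (0, s, x)) (by fun_prop)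
    (hRe.continuous_initialKernel μ) (hIm.continuous_initialKernel μ)] at e0
  rw [integral_mul_complexKernel
    (w := fun s => waveVelocity k (fun z : ℝ × E => u₁ z.2 + μ * u₀ z.2) (0, s, x)) (by fun_prop)
    hRe.continuous_kappa hIm.continuous_kappa] at e1
  have c1 := continuous_inner_integral hk hn hF hRe.continuous_kappa μ t x
  have c2 := continuous_inner_integral hk hn hF hIm.continuous_kappa μ t x
  have e2 : ∫ b in (0 : ℝ)..t, (∫ s in (0 : ℝ)..(t - b),
      (evenWaveOp n (f b) s x : ℂ) * kernelE μ ν t 0 b s)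
      = C * (posTime t ^ (-μ / 2) : ℝ) * (((∫ b in (0 : ℝ)..t, posTime b ^ (μ / 2)
          * ∫ s in (0 : ℝ)..(t - b), waveVelocity k F (√b, s, x)
            * kappa (profileRe μ ν) (t, b, s) : ℝ) : ℂ)
        + ((∫ b in (0 : ℝ)..t, posTime b ^ (μ / 2)
          * ∫ s in (0 : ℝ)..(t - b), waveVelocity k F (√b, s, x)
            * kappa (profileIm μ ν) (t, b, s) : ℝ) : ℂ) * Complex.I) := by
    rw [intervalIntegral.integral_congr_Ioo_of_le (μ := volume) ht.le
      fun b hb => inner_integral_eq hk hn hF hfF hb.1.le hb.2.le x,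
      intervalIntegral.integral_const_mul, intervalIntegral.integral_add,
      intervalIntegral.integral_mul_const, intervalIntegral.integral_ofReal,
      intervalIntegral.integral_ofReal]
    · exact (Complex.continuous_ofReal.comp c1).intervalIntegrable _ _
    · exact ((Complex.continuous_ofReal.comp c2).mul continuous_const).intervalIntegrable _ _
  rw [evenRepresentation, e0, e1, e2, evenWaveOp_eq_waveVelocity hk hn hu₀ ht,
    ← posTime_eq (t := t) (by linarith)]
  simp only [reducedFormula, initialKernel]
  push_cast
  field_simp
  ring

end Formula

end ScaleInvariantWave

theorem theorem1p3 (n : ℕ) (hn : 2 ≤ n) (hn_even : Even n) (μ ν : ℝ) (hμ : 0 ≤ μ)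
    (f : ℝ → EuclideanSpace ℝ (Fin n) → ℝ) (u₀ u₁ : EuclideanSpace ℝ (Fin n) → ℝ)
    (hf : ContDiffOn ℝ ((n / 2 + 1 : ℕ) : WithTop ℕ∞)
      (fun p : ℝ × EuclideanSpace ℝ (Fin n) => f p.1 p.2) (Set.Ici (0 : ℝ) ×ˢ Set.univ))
    (hu₀ : ContDiff ℝ ((n / 2 + 2 : ℕ) : WithTop ℕ∞) u₀)
    (hu₁ : ContDiff ℝ ((n / 2 + 1 : ℕ) : WithTop ℕ∞) u₁) :
    (∃ u, ScaleInvariantWave.IsClassicalSolution n μ ν f u₀ u₁ u) ∧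
    (∀ t : ℝ, 0 < t → ∀ x : EuclideanSpace ℝ (Fin n),
      ScaleInvariantWave.EvenRepresentationWellDefined n μ ν f u₀ u₁ t x) ∧
    (∀ u, ScaleInvariantWave.IsClassicalSolution n μ ν f u₀ u₁ u →
      ∀ t : ℝ, 0 < t → ∀ x : EuclideanSpace ℝ (Fin n),
        (u t x : ℂ) = ScaleInvariantWave.evenRepresentation n μ ν f u₀ u₁ t x) := by
  obtain ⟨k, hk2⟩ := hn_even
  have hn2 : n = 2 * k := by omega
  have hk : 0 < k := by omega
  have hnk : n / 2 = k := by omega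
  rw [hnk] at hf hu₀ hu₁
  -- `f` is only given for nonnegative times; `f(β², x)` makes sense for all `β`
  set F : ℝ × EuclideanSpace ℝ (Fin n) → ℝ := fun z => f (z.1 ^ 2) z.2 with hFdef
  have hF : ContDiff ℝ ((k + 1 : ℕ) : WithTop ℕ∞) F :=
    hf.comp_contDiff (f := fun z : ℝ × EuclideanSpace ℝ (Fin n) => (z.1 ^ 2, z.2)) (by fun_prop)
      fun z => ⟨mem_Ici.2 (sq_nonneg _), mem_univ _⟩
  have hfF : ∀ b, 0 ≤ b → f b = fun z => F (√b, z) := fun b hb => by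
    funext z
    simp only [hFdef, Real.sq_sqrt hb]
  have hle1 : (k : WithTop ℕ∞) ≤ ((k + 1 : ℕ) : WithTop ℕ∞) := by exact_mod_cast Nat.le_succ k
  have hle2 : (k : WithTop ℕ∞) ≤ ((k + 2 : ℕ) : WithTop ℕ∞) := by
    exact_mod_cast Nat.le_add_right k 2
  have hRe := ScaleInvariantWave.isRealProfile_profileRe μ ν
  have hIm := ScaleInvariantWave.isRealProfile_profileIm μ ν
  have hsol := ScaleInvariantWave.isClassicalSolution_undamped (ν := ν) hk hn2 rfl hRe hF hu₀ hu₁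
  have hzero := ScaleInvariantWave.isClassicalSolution_undamped (ν := ν) hk hn2 rfl hIm hF hu₀ hu₁
  have hsol' : ScaleInvariantWave.IsClassicalSolution n μ ν f u₀ u₁ _ :=
    ⟨hsol.contDiffOn, fun t ht x => by
      have h := hsol.equation t ht x
      simp only [one_mul] at h
      rw [h, hfF t ht.le],
      by simpa only [one_mul] using hsol.initial_value,
      by simpa only [one_mul] using hsol.initial_velocity⟩
  refine ⟨⟨_, hsol'⟩, fun t ht x => ScaleInvariantWave.evenRepresentationWellDefined hk hn2
    (hF.of_le hle1) hfF (hu₀.of_le hle2) (hu₁.of_le hle1) ht x, fun u hu t ht x => ?_⟩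
  have h1 := hu.unique hμ hsol' ht x
  -- the imaginary part of the formula solves the homogeneous problem with vanishing data
  simp only [zero_mul] at hzero
  have h2 := hzero.eq_zero hμ ht x
  rw [ScaleInvariantWave.undamped_eq_reducedFormula hk hn2 hRe (hF.of_le hle1) (hu₀.of_le hle2)
    (hu₁.of_le hle1) ht.le x] at h1
  rw [ScaleInvariantWave.undamped_eq_reducedFormula hk hn2 hIm (hF.of_le hle1) (hu₀.of_le hle2)
    (hu₁.of_le hle1) ht.le x] at h2
  rw [ScaleInvariantWave.evenRepresentation_eq hk hn2 (hF.of_le hle1) hfF (hu₀.of_le hle2)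
    (hu₁.of_le hle1) ht x, h1, h2]
  simp
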